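/- Let $\mathcal E=\mathrm{Sh}(C,J)$ be the topos of sheaves on a small site. A "set" or "discrete space" is an object of $\mathcal E$; frames, Boolean algebras, ideals and locales are taken internally in $\mathcal E$, and statements about elements are interpreted in the internal logic of $\mathcal E$. The discrete space on a set $X$ is the locale whose frame of opens is the power object $\mathcal P X$; a locale is Stone if, for some Boolean algebra $A$, its frame of opens is isomorphic to the frame $\mathrm{Idl}(A)$ of ideals of $A$ (so that it is $\mathrm{Spec}\,A$). Let $X$ and $Y$ be sets, and suppose that the discrete space $Y$ is Stone. Then all products $Z\times X$ with a locale $Z$ and the exponential $Y^X$ exist in the category of locales of $\mathcal E$, and $Y^X$ is Stone. For $x\in X$ and $y\in Y$ the open $(x,y)=\{\theta\mid\theta(x)=y\}$ of $Y^X$ is clopen, and the Boolean algebra of clopens (complemented opens) of $Y^X$ is generated by these elements, indexed by $X\times Y$, subject to the following relations for each $x\in X$: $$1\le\bigvee_{y\in Y}(x,y),\qquad (x,y)\wedge(x,y')\le 0\quad\text{for all } y,y'\in Y \text{ with } y\ne y'.$$ That is, the clopens $(x,y)$ satisfy these relations, the first one meaning that $1$ is below every upper bound of the elements $(x,y)$,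 $y\in Y$; and for every Boolean algebra $A$ in $\mathcal E$ and every map $\delta\colon X\times Y\to A$ satisfying the same relations there is a unique homomorphism of Boolean algebras from the clopens of $Y^X$ to $A$ that sends $(x,y)$ to $\delta(x,y)$. -/

import Mathlib

open CategoryTheory CategoryTheory.Limits Opposite

universe u

/-! Everything takes place inside the Grothendieck topos `Sheaf J (Type u)` of sheaves on a small
site `(C, J)`; its objects are the sets (discrete spaces).  Internal statements are spelled out on
sections by the Kripke-Joyal (sheaf) semantics. -/

namespace InternalLocale

section Families

variable {C : Type u} [SmallCategory C]

/-- A family of elements of a presheaf `P` over the stage `U`: a subpresheaf of `P` restricted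
to the slice over `U`. -/
@[ext]
structure SubFamily (P : Cᵒᵖ ⥤ Type u) (U : C) where
  /-- The elements lying over `f : V ⟶ U`. -/
  carrier : ∀ ⦃V : C⦄, (V ⟶ U) → Set (P.obj (op V))
  restrict : ∀ ⦃V : C⦄ (f : V ⟶ U) (x : P.obj (op V)), x ∈ carrier f →
    ∀ ⦃W : C⦄ (g : W ⟶ V), P.map g.op x ∈ carrier (g ≫ f)

/-- A family that is moreover local for the topology: when `P` is a sheaf this is a subsheaf of `P`
restricted to the slice over `U`, that is, a section over `U` of the power sheaf of `P`. -/
@[ext]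
structure LocalFamily (J : GrothendieckTopology C) (P : Cᵒᵖ ⥤ Type u) (U : C) extends
    SubFamily P U where
  isLocal : ∀ ⦃V : C⦄ (f : V ⟶ U) (x : P.obj (op V)) (S : Sieve V), S ∈ J V →
    (∀ ⦃W : C⦄ (g : W ⟶ V), S g → P.map g.op x ∈ carrier (g ≫ f)) → x ∈ carrier f

namespace LocalFamily

variable {J : GrothendieckTopology C} {P : Cᵒᵖ ⥤ Type u} {U : C}

theorem ext_mem {S T : LocalFamily J P U}
    (h : ∀ ⦃V : C⦄ (f : V ⟶ U) (x : P.obj (op V)), x ∈ S.carrier f ↔ x ∈ T.carrier f) : S = T := by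
  apply LocalFamily.ext
  funext V f
  ext x
  exact h f x

/-- Families are ordered by inclusion. -/
instance : PartialOrder (LocalFamily J P U) where
  le S T := ∀ ⦃V : C⦄ (f : V ⟶ U) (x : P.obj (op V)), x ∈ S.carrier f → x ∈ T.carrier f
  le_refl _ _ _ _ h := h
  le_trans _ _ _ h h' _ f x hx := h' f x (h f x hx)
  le_antisymm _ _ h h' := ext_mem fun _ f x => ⟨h f x, h' f x⟩

theorem le_iff {S T : LocalFamily J P U} : S ≤ T ↔
    ∀ ⦃V : C⦄ (f : V ⟶ U) (x : P.obj (op V)), x ∈ S.carrier f → x ∈ T.carrier f := Iff.rfl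

/-- Restriction of a family along `h : U' ⟶ U`. -/
def pull {U' : C} (h : U' ⟶ U) (S : LocalFamily J P U) : LocalFamily J P U' where
  carrier _ f := S.carrier (f ≫ h)
  restrict _ f x hx _ g := by
    simpa using S.restrict (f ≫ h) x hx g
  isLocal _ f x R hR hx := S.isLocal (f ≫ h) x R hR fun _ g hg => by
    simpa using hx g hg

theorem mem_pull {U' V : C} (h : U' ⟶ U) (S : LocalFamily J P U) (f : V ⟶ U')
    (x : P.obj (op V)) : x ∈ (S.pull h).carrier f ↔ x ∈ S.carrier (f ≫ h) := Iff.rfl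

/-- The local family generated by a family. -/
def closure (S : SubFamily P U) : LocalFamily J P U where
  carrier V f := {x | ∃ R ∈ J V, ∀ ⦃W : C⦄ (g : W ⟶ V), R g →
    P.map g.op x ∈ S.carrier (g ≫ f)}
  restrict := by
    rintro V f x ⟨R, hR, hx⟩ W g
    refine ⟨R.pullback g, J.pullback_stable g hR, fun W' g' hg' => ?_⟩
    have := hx (g' ≫ g) hg'
    simpa using this
  isLocal := by
    intro V f x R hR hx
    refine ⟨_, J.bind_covering (S := R)
      (R := fun W g hg => Classical.choose (hx g hg)) hR
      (fun W g hg => (Classical.choose_spec (hx g hg)).1), ?_⟩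
    rintro W g ⟨W', k, g', hg', hk, rfl⟩
    have := (Classical.choose_spec (hx g' hg')).2 k hk
    simpa using this

theorem mem_closure {S : SubFamily P U} {V : C} {f : V ⟶ U} {x : P.obj (op V)} :
    x ∈ (closure (J := J) S).carrier f ↔ ∃ R ∈ J V, ∀ ⦃W : C⦄ (g : W ⟶ V), R g →
      P.map g.op x ∈ S.carrier (g ≫ f) := Iff.rfl

theorem subset_closure {S : SubFamily P U} {V : C} {f : V ⟶ U} {x : P.obj (op V)}
    (hx : x ∈ S.carrier f) : x ∈ (closure (J := J) S).carrier f :=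
  ⟨⊤, J.top_mem V, fun _ g _ => S.restrict f x hx g⟩

theorem closure_le {S : SubFamily P U} {T : LocalFamily J P U}
    (h : ∀ ⦃V : C⦄ (f : V ⟶ U) (x : P.obj (op V)), x ∈ S.carrier f → x ∈ T.carrier f) :
    closure S ≤ T := by
  rintro V f x ⟨R, hR, hx⟩
  exact T.isLocal f x R hR fun W g hg => h _ _ (hx g hg)

/-- The union of a set of families. -/
def union (s : Set (LocalFamily J P U)) : SubFamily P U where
  carrier _ f := {x | ∃ S ∈ s, x ∈ S.carrier f}
  restrict := by
    rintro V f x ⟨S, hS, hx⟩ W g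
    exact ⟨S, hS, S.restrict f x hx g⟩

/-- Meets are intersections, joins are the local families generated by unions. -/
instance : CompleteLattice (LocalFamily J P U) where
  inf S T :=
    { carrier := fun _ f => S.carrier f ∩ T.carrier f
      restrict := fun _ f x hx _ g => ⟨S.restrict f x hx.1 g, T.restrict f x hx.2 g⟩
      isLocal := fun _ f x R hR hx => ⟨S.isLocal f x R hR fun _ g hg => (hx g hg).1,
        T.isLocal f x R hR fun _ g hg => (hx g hg).2⟩ }
  inf_le_left _ _ _ _ _ h := h.1
  inf_le_right _ _ _ _ _ h := h.2
  le_inf _ _ _ h h' _ f x hx := ⟨h f x hx, h' f x hx⟩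
  sup S T := closure (union {S, T})
  le_sup_left S T _ f x hx := subset_closure ⟨S, by simp, hx⟩
  le_sup_right S T _ f x hx := subset_closure ⟨T, by simp, hx⟩
  sup_le S T R h h' := closure_le <| by
    rintro V f x ⟨Q, hQ, hx⟩
    rcases hQ with rfl | rfl
    · exact h f x hx
    · exact h' f x hx
  sSup s := closure (union s)
  isLUB_sSup s := ⟨fun S hS _ f x hx => subset_closure ⟨S, hS, hx⟩, fun T hT => closure_le <| by
    rintro V f x ⟨Q, hQ, hx⟩
    exact hT hQ f x hx⟩
  sInf s :=
    { carrier := fun _ f => {x | ∀ S ∈ s, x ∈ S.carrier f}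
      restrict := fun _ f x hx _ g S hS => S.restrict f x (hx S hS) g
      isLocal := fun _ f x R hR hx S hS => S.isLocal f x R hR fun _ g hg => hx g hg S hS }
  isGLB_sInf s := ⟨fun S hS _ f x hx => hx S hS, fun T hT _ f x hx S hS => hT hS f x hx⟩
  top :=
    { carrier := fun _ _ => Set.univ
      restrict := fun _ _ _ _ _ _ => trivial
      isLocal := fun _ _ _ _ _ _ => trivial }
  le_top _ _ _ _ _ := trivial
  bot := closure
    { carrier := fun _ _ => ∅
      restrict := fun _ _ _ h => h.elim }
  bot_le _ := closure_le fun _ _ _ h => h.elim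

theorem mem_inf {S T : LocalFamily J P U} {V : C} {f : V ⟶ U} {x : P.obj (op V)} :
    x ∈ (S ⊓ T).carrier f ↔ x ∈ S.carrier f ∧ x ∈ T.carrier f := Iff.rfl

theorem mem_top {V : C} {f : V ⟶ U} {x : P.obj (op V)} :
    x ∈ (⊤ : LocalFamily J P U).carrier f := trivial

theorem mem_sSup {s : Set (LocalFamily J P U)} {V : C} {f : V ⟶ U} {x : P.obj (op V)} :
    x ∈ (sSup s).carrier f ↔ ∃ R ∈ J V, ∀ ⦃W : C⦄ (g : W ⟶ V), R g →
      ∃ S ∈ s, P.map g.op x ∈ S.carrier (g ≫ f) := Iff.rfl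

instance : Order.Frame (LocalFamily J P U) := Order.Frame.ofMinimalAxioms
  { inf_sSup_le_iSup_inf := by
      rintro T s V f x ⟨hT, R, hR, hx⟩
      refine LocalFamily.isLocal _ f x R hR fun W g hg => ?_
      obtain ⟨S, hS, hxS⟩ := hx g hg
      have h : T ⊓ S ≤ ⨆ b ∈ s, T ⊓ b := le_iSup₂_of_le S hS le_rfl
      exact h _ _ ⟨T.restrict f x hT g, hxS⟩ }

/-- Restriction is a frame homomorphism. -/
def pullHom {U' : C} (h : U' ⟶ U) : FrameHom (LocalFamily J P U) (LocalFamily J P U') where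
  toFun := pull h
  map_inf' _ _ := rfl
  map_top' := rfl
  map_sSup' s := by
    refine ext_mem fun V f x => ?_
    rw [mem_pull, mem_sSup, mem_sSup]
    simp [mem_pull]

end LocalFamily

end Families

variable {C : Type u} [SmallCategory C] {J : GrothendieckTopology C}

section Frames

/-- `s` is the join over `U` of the family `Φ` of elements of `L`, in the internal logic: at every
later stage, the upper bounds of `Φ` are the elements above `s`. -/
def IsJoin (L : Cᵒᵖ ⥤ Frm.{u}) {U : C} (Φ : SubFamily (L ⋙ forget Frm) U)
    (s : L.obj (op U)) : Prop :=
  ∀ ⦃V : C⦄ (f : V ⟶ U) (b : L.obj (op V)),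
    L.map f.op s ≤ b ↔
      ∀ ⦃W : C⦄ (g : W ⟶ V) (a : L.obj (op W)), a ∈ Φ.carrier (g ≫ f) → a ≤ L.map g.op b

/-- The family of all `a ⊓ t` with `a` in `Φ`. -/
def infFamily (L : Cᵒᵖ ⥤ Frm.{u}) {U : C} (Φ : SubFamily (L ⋙ forget Frm) U)
    (t : L.obj (op U)) : SubFamily (L ⋙ forget Frm) U where
  carrier V f := {c | ∃ a : L.obj (op V), a ∈ Φ.carrier f ∧ c = a ⊓ L.map f.op t}
  restrict := by
    rintro V f _ ⟨a, ha, rfl⟩ W g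
    refine ⟨L.map g.op a, Φ.restrict f a ha g, ?_⟩
    simp

/-- The image of a family under a natural family of frame homomorphisms. -/
def imageFamily {L M : Cᵒᵖ ⥤ Frm.{u}} (φ : L ⟶ M) {U : C} (Φ : SubFamily (L ⋙ forget Frm) U) :
    SubFamily (M ⋙ forget Frm) U where
  carrier V f := {c | ∃ a : L.obj (op V), a ∈ Φ.carrier f ∧ c = φ.app (op V) a}
  restrict := by
    rintro V f _ ⟨a, ha, rfl⟩ W g
    refine ⟨L.map g.op a, Φ.restrict f a ha g, ?_⟩
    exact (NatTrans.naturality_apply φ g.op a).symm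

variable (J) in
/-- An internal frame of `Sheaf J (Type u)`: an internal poset with finite meets and with joins of
all internal families of elements, over which binary meets distribute.  (The sections of such an
object over any stage form a frame, and restrictions are frame homomorphisms, since the external
joins are the internal joins of constant families; so nothing is lost by starting from a
presheaf with values in `Frm`.) -/
structure IFrame where
  /-- The sections. -/
  obj : Cᵒᵖ ⥤ Frm.{u}
  isSheaf : Presieve.IsSheaf J (obj ⋙ forget Frm)
  exists_isJoin : ∀ {U : C} (Φ : SubFamily (obj ⋙ forget Frm) U), ∃ s, IsJoin obj Φ s
  inf_isJoin : ∀ {U : C} (Φ : SubFamily (obj ⋙ forget Frm) U) (s t : obj.obj (op U)),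
    IsJoin obj Φ s → IsJoin obj (infFamily obj Φ t) (s ⊓ t)

/-- An internal frame homomorphism: it preserves finite meets and all internal joins. -/
@[ext]
structure IFrame.Hom (L M : IFrame J) where
  /-- The natural transformation. -/
  hom : L.obj ⟶ M.obj
  isJoin : ∀ {U : C} (Φ : SubFamily (L.obj ⋙ forget Frm) U) (s : L.obj.obj (op U)),
    IsJoin L.obj Φ s → IsJoin M.obj (imageFamily hom Φ) (hom.app (op U) s)

instance : Category (IFrame J) where
  Hom L M := IFrame.Hom L M
  id L := ⟨𝟙 L.obj, fun Φ s h => by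
    have : imageFamily (𝟙 L.obj) Φ = Φ := by
      apply SubFamily.ext
      funext V f
      ext c
      simp [imageFamily]
    rw [this]
    simpa using h⟩
  comp φ ψ := ⟨φ.hom ≫ ψ.hom, fun Φ s h => by
    have : imageFamily (φ.hom ≫ ψ.hom) Φ = imageFamily ψ.hom (imageFamily φ.hom Φ) := by
      apply SubFamily.ext
      funext V f
      ext c
      simp [imageFamily]
    rw [this]
    simpa using ψ.isJoin _ _ (φ.isJoin _ _ h)⟩
  id_comp _ := IFrame.Hom.ext (Category.id_comp _)
  comp_id _ := IFrame.Hom.ext (Category.comp_id _)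
  assoc _ _ _ := IFrame.Hom.ext (Category.assoc _ _ _)

variable (J) in
/-- The category of internal locales (localic spaces) of `Sheaf J (Type u)`. -/
abbrev ILocale := (IFrame J)ᵒᵖ

/-- The frame of opens of an internal locale. -/
abbrev opens (Z : ILocale J) : Cᵒᵖ ⥤ Frm.{u} := Z.unop.obj

/-- The inverse image of an open under a map of internal locales. -/
abbrev preim {Z W : ILocale J} (φ : Z ⟶ W) {U : C} (a : (opens W).obj (op U)) :
    (opens Z).obj (op U) := IFrame.Hom.hom φ.unop |>.app (op U) a

end Frames

section Discrete

variable (J) in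
/-- The presheaf of local families of elements of `P`, as a presheaf of frames. -/
def powerFrm (P : Cᵒᵖ ⥤ Type u) : Cᵒᵖ ⥤ Frm.{u} where
  obj U := Frm.of (LocalFamily J P U.unop)
  map h := Frm.ofHom (LocalFamily.pullHom h.unop)
  map_id U := by
    apply Frm.hom_ext
    refine DFunLike.ext _ _ fun (S : LocalFamily J P U.unop) => ?_
    refine LocalFamily.ext_mem fun V f x => ?_
    change x ∈ S.carrier (f ≫ 𝟙 _) ↔ x ∈ S.carrier f
    rw [Category.comp_id]
  map_comp {U _ _} h k := by
    apply Frm.hom_ext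
    refine DFunLike.ext _ _ fun (S : LocalFamily J P U.unop) => ?_
    refine LocalFamily.ext_mem fun V f x => ?_
    change x ∈ S.carrier (f ≫ k.unop ≫ h.unop) ↔ x ∈ S.carrier ((f ≫ k.unop) ≫ h.unop)
    rw [Category.assoc]

theorem powerFrm_map (P : Cᵒᵖ ⥤ Type u) {U V : C} (h : V ⟶ U) (S : LocalFamily J P U) :
    (powerFrm J P).map h.op S = S.pull h := rfl

theorem powerFrm_isSheaf (P : Cᵒᵖ ⥤ Type u) :
    Presieve.IsSheaf J (powerFrm J P ⋙ forget Frm) := by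
  intro U R hR x hx
  rw [Presieve.compatible_iff_sieveCompatible] at hx
  let y : ∀ ⦃V : C⦄ (f : V ⟶ U), R f → LocalFamily J P V := fun V f h => x f h
  have hy : ∀ ⦃V W : C⦄ (f : V ⟶ U) (g : W ⟶ V) (h : R f),
      y (g ≫ f) (R.downward_closed h g) = (y f h).pull g := fun V W f g h => hx f g h
  let S : SubFamily P U :=
    { carrier := fun V f => {z | ∃ h : R f, z ∈ (y f h).carrier (𝟙 V)}
      restrict := by
        rintro V f z ⟨h, hz⟩ W g
        refine ⟨R.downward_closed h g, ?_⟩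
        rw [hy f g h, LocalFamily.mem_pull]
        have := (y f h).restrict (𝟙 V) z hz g
        simpa using this }
  refine ⟨(LocalFamily.closure S : LocalFamily J P U), ?_, ?_⟩
  · intro V f h
    change (LocalFamily.closure S : LocalFamily J P U).pull f = y f h
    refine LocalFamily.ext_mem fun W k z => ?_
    have key : ∀ ⦃W' : C⦄ (g : W' ⟶ W), (∃ h' : R (g ≫ k ≫ f),
        P.map g.op z ∈ (y (g ≫ k ≫ f) h').carrier (𝟙 W')) ↔
          P.map g.op z ∈ (y f h).carrier (g ≫ k) := by
      intro W' g
      have h2 : R ((g ≫ k) ≫ f) := R.downward_closed h _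
      have h3 := hy f (g ≫ k) h
      have h4 : ∀ h', y (g ≫ k ≫ f) h' = (y f h).pull (g ≫ k) := by
        intro h'
        rw [← h3]
        congr 1
        simp
      constructor
      · rintro ⟨h', hz⟩
        rw [h4, LocalFamily.mem_pull] at hz
        simpa using hz
      · intro hz
        refine ⟨by simpa using h2, ?_⟩
        rw [h4, LocalFamily.mem_pull]
        simpa using hz
    constructor
    · rintro ⟨Q, hQ, hz⟩
      exact (y f h).isLocal k z Q hQ fun W' g hg => (key g).1 (hz g hg)
    · intro hz
      exact ⟨⊤, J.top_mem _, fun W' g _ => (key g).2 ((y f h).restrict k z hz g)⟩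
  · intro T hT
    change LocalFamily J P U at T
    have hT' : ∀ ⦃V : C⦄ (f : V ⟶ U) (h : R f), T.pull f = y f h := fun V f h => hT f h
    refine LocalFamily.ext_mem fun V f z => ?_
    constructor
    · intro hz
      refine ⟨R.pullback f, J.pullback_stable f hR, fun W g hg => ⟨hg, ?_⟩⟩
      rw [← hT' _ hg, LocalFamily.mem_pull]
      simpa using T.restrict f z hz g
    · rintro ⟨Q, hQ, hz⟩
      refine T.isLocal f z Q hQ fun W g hg => ?_
      obtain ⟨h', hz'⟩ := hz g hg
      rw [← hT' _ h', LocalFamily.mem_pull] at hz'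
      simpa using hz'

/-- The union of an internal family of subsheaves. -/
def unionFamily (P : Cᵒᵖ ⥤ Type u) {U : C} (Φ : SubFamily (powerFrm J P ⋙ forget Frm) U) :
    SubFamily P U where
  carrier V f := {x | ∃ T : LocalFamily J P V, T ∈ Φ.carrier f ∧ x ∈ T.carrier (𝟙 V)}
  restrict := by
    rintro V f x ⟨T, hT, hx⟩ W g
    refine ⟨T.pull g, Φ.restrict f T hT g, ?_⟩
    rw [LocalFamily.mem_pull]
    simpa using T.restrict (𝟙 V) x hx g

theorem isJoin_unionFamily (P : Cᵒᵖ ⥤ Type u) {U : C}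
    (Φ : SubFamily (powerFrm J P ⋙ forget Frm) U) :
    IsJoin (powerFrm J P) Φ (LocalFamily.closure (unionFamily P Φ) : LocalFamily J P U) := by
  intro V f b
  change LocalFamily J P V at b
  change (LocalFamily.closure (unionFamily P Φ) : LocalFamily J P U).pull f ≤ b ↔
    ∀ ⦃W : C⦄ (g : W ⟶ V) (a : LocalFamily J P W), a ∈ Φ.carrier (g ≫ f) → a ≤ b.pull g
  constructor
  · intro h W g a ha W' k x hx
    rw [LocalFamily.mem_pull]
    refine h _ _ ?_
    rw [LocalFamily.mem_pull]
    refine LocalFamily.subset_closure ⟨a.pull k, ?_, ?_⟩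
    · have := Φ.restrict (g ≫ f) a ha k
      rw [Category.assoc]
      exact this
    · rw [LocalFamily.mem_pull]
      simpa using hx
  · rintro h W k x ⟨R, hR, hx⟩
    refine b.isLocal k x R hR fun W' g hg => ?_
    obtain ⟨T, hT, hxT⟩ := hx g hg
    have := h (g ≫ k) T (by simpa using hT) (𝟙 _) _ hxT
    rw [LocalFamily.mem_pull] at this
    simpa using this

theorem IsJoin.unique {L : Cᵒᵖ ⥤ Frm.{u}} {U : C} {Φ : SubFamily (L ⋙ forget Frm) U}
    {s t : L.obj (op U)} (hs : IsJoin L Φ s) (ht : IsJoin L Φ t) : s = t := by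
  have h : ∀ b : L.obj (op U), s ≤ b ↔ t ≤ b := by
    intro b
    have h1 := hs (𝟙 U) b
    have h2 := ht (𝟙 U) b
    simp only [op_id, CategoryTheory.Functor.map_id] at h1 h2
    exact h1.trans h2.symm
  exact le_antisymm ((h t).2 le_rfl) ((h s).1 le_rfl)

/-- The power object of a sheaf, as an internal frame. -/
def power (X : Sheaf J (Type u)) : IFrame J where
  obj := powerFrm J X.obj
  isSheaf := powerFrm_isSheaf X.obj
  exists_isJoin Φ := ⟨_, isJoin_unionFamily X.obj Φ⟩
  inf_isJoin {U} Φ s t h := by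
    rw [h.unique (isJoin_unionFamily X.obj Φ)]
    have key : (LocalFamily.closure (unionFamily X.obj Φ) : LocalFamily J X.obj U) ⊓ t =
        LocalFamily.closure (unionFamily X.obj (infFamily (powerFrm J X.obj) Φ t)) := by
      change LocalFamily J X.obj U at t
      refine LocalFamily.ext_mem fun V f x => ?_
      constructor
      · rintro ⟨⟨R, hR, hx⟩, hxt⟩
        refine ⟨R, hR, fun W g hg => ?_⟩
        obtain ⟨T, hT, hxT⟩ := hx g hg
        refine ⟨T ⊓ t.pull (g ≫ f), ⟨T, hT, rfl⟩, hxT, ?_⟩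
        rw [LocalFamily.mem_pull]
        simpa using t.restrict f x hxt g
      · rintro ⟨R, hR, hx⟩
        refine ⟨⟨R, hR, fun W g hg => ?_⟩, t.isLocal f x R hR fun W g hg => ?_⟩
        · obtain ⟨_, ⟨T, hT, rfl⟩, hxT⟩ := hx g hg
          exact ⟨T, hT, hxT.1⟩
        · obtain ⟨_, ⟨T, hT, rfl⟩, hxT⟩ := hx g hg
          have : X.obj.map g.op x ∈ t.carrier (𝟙 _ ≫ g ≫ f) := hxT.2
          simpa using this
    have := isJoin_unionFamily X.obj (infFamily (powerFrm J X.obj) Φ t)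
    rw [← key] at this
    exact this

/-- A set (sheaf) `X` as a discrete space: its opens are the subsheaves. -/
def discrete (X : Sheaf J (Type u)) : ILocale J := op (power X)

/-- The open point `{x}` of the discrete space `X`, for `x` an element of `X` over `U`. -/
def point (X : Sheaf J (Type u)) {U : C} (x : X.obj.obj (op U)) :
    (opens (discrete X)).obj (op U) := show LocalFamily J X.obj U from
  { carrier := fun _ f => {X.obj.map f.op x}
    restrict := by
      rintro V f _ rfl W g
      simp
    isLocal := by
      intro V f z R hR h
      have hs := (isSheaf_iff_isSheaf_of_type J X.obj).1 X.property
      refine (hs R hR).isSeparatedFor.ext fun W g hg => ?_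
      have h' : X.obj.map g.op z = X.obj.map (g ≫ f).op x := h g hg
      rw [h']
      simp }

end Discrete

section Boolean

variable (J) in
/-- An internal Boolean algebra of `Sheaf J (Type u)`: a sheaf of Boolean algebras. -/
structure IBool where
  /-- The sections. -/
  obj : Cᵒᵖ ⥤ BoolAlg.{u}
  isSheaf : Presieve.IsSheaf J (obj ⋙ forget BoolAlg)

/-- The internal ideals of `A` over the stage `U`: the sections over `U` of `Idl A`. -/
def Idl (A : IBool J) (U : C) : Type u :=
  {I : LocalFamily J (A.obj ⋙ forget BoolAlg) U // ∀ ⦃V : C⦄ (f : V ⟶ U),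
    (⊥ : A.obj.obj (op V)) ∈ I.carrier f ∧
    (∀ a b : A.obj.obj (op V), a ≤ b → b ∈ I.carrier f → a ∈ I.carrier f) ∧
    ∀ a b : A.obj.obj (op V), a ∈ I.carrier f → b ∈ I.carrier f → a ⊔ b ∈ I.carrier f}

instance (A : IBool J) (U : C) : PartialOrder (Idl A U) := Subtype.partialOrder _

/-- Restriction of internal ideals. -/
def Idl.pull {A : IBool J} {U V : C} (h : V ⟶ U) (I : Idl A U) : Idl A V :=
  ⟨I.1.pull h, fun _ f => I.2 (f ≫ h)⟩

/-- `Z` is a Stone space: it is the spectrum of some internal Boolean algebra `A`, that is,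
its internal frame of opens is isomorphic to the ideal completion of `A`. -/
def IsStone (Z : ILocale J) : Prop :=
  ∃ (A : IBool J) (e : ∀ U : C, (opens Z).obj (op U) ≃o Idl A U),
    ∀ ⦃U V : C⦄ (h : V ⟶ U) (a : (opens Z).obj (op U)),
      e V ((opens Z).map h.op a) = (e U a).pull h

noncomputable instance (L : Type u) [Order.Frame L] : BooleanAlgebra (Complementeds L) :=
  DistribLattice.booleanAlgebraOfComplemented _

/-- A frame homomorphism restricts to the complemented elements. -/
def complMap {L M : Type u} [Order.Frame L] [Order.Frame M] (φ : FrameHom L M) :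
    BoundedLatticeHom (Complementeds L) (Complementeds M) where
  toFun a := ⟨φ a.1, by
    obtain ⟨b, hb⟩ := a.2
    exact ⟨φ b, hb.map φ⟩⟩
  map_sup' a b := Subtype.ext (map_sup φ a.1 b.1)
  map_inf' a b := Subtype.ext (map_inf φ a.1 b.1)
  map_top' := Subtype.ext (map_top φ)
  map_bot' := Subtype.ext (map_bot φ)

/-- The clopens of `Z` over each stage: the complemented opens. -/
noncomputable def clopFunctor (Z : ILocale J) : Cᵒᵖ ⥤ BoolAlg.{u} where
  obj U := BoolAlg.of (Complementeds ((opens Z).obj U))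
  map h := BoolAlg.ofHom (complMap ((opens Z).map h).hom)
  map_id U := by
    apply BoolAlg.hom_ext
    refine DFunLike.ext _ _ fun (a : Complementeds ((opens Z).obj U)) => ?_
    apply Subtype.ext
    change (opens Z).map (𝟙 U) a.1 = a.1
    simp
  map_comp {U _ _} h k := by
    apply BoolAlg.hom_ext
    refine DFunLike.ext _ _ fun (a : Complementeds ((opens Z).obj U)) => ?_
    apply Subtype.ext
    change (opens Z).map (h ≫ k) a.1 = (opens Z).map k ((opens Z).map h a.1)
    simp

theorem clopFunctor_isSheaf (Z : ILocale J) :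
    Presieve.IsSheaf J (clopFunctor Z ⋙ forget BoolAlg) := by
  intro U R hR x hx
  rw [Presieve.compatible_iff_sieveCompatible] at hx
  have hZ := Z.unop.isSheaf R hR
  let y : ∀ ⦃V : C⦄ (f : V ⟶ U), R f → Complementeds ((opens Z).obj (op V)) := fun V f h => x f h
  have hy : ∀ ⦃V W : C⦄ (f : V ⟶ U) (g : W ⟶ V) (h : R f),
      (y (g ≫ f) (R.downward_closed h g)).1 = (opens Z).map g.op (y f h).1 :=
    fun V W f g h => congrArg Subtype.val (hx f g h)
  let y' : Presieve.FamilyOfElements (opens Z ⋙ forget Frm) R.arrows := fun V f h => (y f h).1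
  let z' : Presieve.FamilyOfElements (opens Z ⋙ forget Frm) R.arrows :=
    fun V f h => ((y f h)ᶜ).1
  have hcompl : ∀ ⦃V : C⦄ (f : V ⟶ U) (h : R f), IsCompl (y f h).1 ((y f h)ᶜ).1 := by
    intro V f h
    have h1 : IsCompl (y f h) (y f h)ᶜ := isCompl_compl
    rw [Complementeds.isCompl_coe]
    exact h1
  have hy' : y'.Compatible := by
    rw [Presieve.compatible_iff_sieveCompatible]
    exact fun V W f g h => hy f g h
  have hz' : z'.Compatible := by
    rw [Presieve.compatible_iff_sieveCompatible]
    intro V W f g h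
    have h1 := hcompl (g ≫ f) (R.downward_closed h g)
    have h2 := (hcompl f h).map ((opens Z).map g.op).hom
    have h3 : IsCompl (y (g ≫ f) (R.downward_closed h g)).1
      ((opens Z).map g.op ((y f h)ᶜ).1) := by
      rw [hy f g h]
      exact h2
    exact h1.right_unique h3
  obtain ⟨a, ha, ha'⟩ := hZ y' hy'
  obtain ⟨b, hb, -⟩ := hZ z' hz'
  change (opens Z).obj (op U) at a b
  have ha1 : ∀ ⦃V : C⦄ (f : V ⟶ U) (h : R f), (opens Z).map f.op a = (y f h).1 := ha
  have hb1 : ∀ ⦃V : C⦄ (f : V ⟶ U) (h : R f), (opens Z).map f.op b = ((y f h)ᶜ).1 := hb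
  have sep : ∀ c d : (opens Z).obj (op U),
      (∀ ⦃V : C⦄ (f : V ⟶ U), R f → (opens Z).map f.op c = (opens Z).map f.op d) → c = d :=
    fun c d h => hZ.isSeparatedFor.ext fun V f hf => h f hf
  have hab : IsCompl a b := by
    apply IsCompl.of_eq
    · refine sep _ _ fun V f h => ?_
      rw [map_inf, map_bot, ha1 f h, hb1 f h, (hcompl f h).inf_eq_bot]
    · refine sep _ _ fun V f h => ?_
      rw [map_sup, map_top, ha1 f h, hb1 f h, (hcompl f h).sup_eq_top]
  refine ⟨(⟨a, b, hab⟩ : Complementeds ((opens Z).obj (op U))), ?_, ?_⟩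
  · intro V f h
    exact Subtype.ext (ha1 f h)
  · intro c hc
    change Complementeds ((opens Z).obj (op U)) at c
    apply Subtype.ext
    exact ha' c.1 fun V f h => congrArg Subtype.val (hc f h)

/-- The internal Boolean algebra of clopens of `Z`. -/
noncomputable def Clop (Z : ILocale J) : IBool J where
  obj := clopFunctor Z
  isSheaf := clopFunctor_isSheaf Z

/-- The open underlying a clopen. -/
def Clop.toOpen {Z : ILocale J} {U : C} (a : (Clop Z).obj.obj (op U)) :
    (opens Z).obj (op U) := Subtype.val (p := IsComplemented) a

/-- Elements `(x, y)` of an internal Boolean algebra, indexed by the set `X × Y`. -/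
abbrev Generators (X Y : Sheaf J (Type u)) (B : IBool J) :=
  FunctorToTypes.prod X.obj Y.obj ⟶ B.obj ⋙ forget BoolAlg

/-- The element `(x, y)`. -/
def Generators.elt {X Y : Sheaf J (Type u)} {B : IBool J} (γ : Generators X Y B) {U : C}
    (x : X.obj.obj (op U)) (y : Y.obj.obj (op U)) : B.obj.obj (op U) :=
  γ.app (op U) (x, y)

/-- The relations `1 ≤ ⋁ y, (x, y)` and `(x, y) ∧ (x, y') ≤ 0` for `y ≠ y'`, in the internal logic.
The first says that `1` is below every upper bound of the `(x, y)`, where `y` ranges over the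
elements of `Y` at all later stages.  In the second, `y ≠ y'` over `U` means that any stage over
`U` at which `y` and `y'` become equal is covered by the empty family. -/
structure SatisfiesRelations {X Y : Sheaf J (Type u)} {B : IBool J} (γ : Generators X Y B) :
    Prop where
  total : ∀ ⦃U : C⦄ (x : X.obj.obj (op U)) (b : B.obj.obj (op U)),
    (∀ ⦃V : C⦄ (f : V ⟶ U) (y : Y.obj.obj (op V)),
      γ.elt (X.obj.map f.op x) y ≤ B.obj.map f.op b) → ⊤ ≤ b
  single : ∀ ⦃U : C⦄ (x : X.obj.obj (op U)) (y y' : Y.obj.obj (op U)),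
    (∀ ⦃V : C⦄ (f : V ⟶ U), Y.obj.map f.op y = Y.obj.map f.op y' → ⊥ ∈ J V) →
      γ.elt x y ⊓ γ.elt x y' ≤ ⊥

/-- `B` is generated by the elements `(x, y)` subject to the above relations: it is universal among
internal Boolean algebras with such elements. -/
structure IsPresentedBy {X Y : Sheaf J (Type u)} {B : IBool J} (γ : Generators X Y B) :
    Prop where
  relations : SatisfiesRelations γ
  universal : ∀ (A : IBool J) (δ : Generators X Y A), SatisfiesRelations δ →
    ∃! φ : B.obj ⟶ A.obj, ∀ ⦃U : C⦄ (x : X.obj.obj (op U)) (y : Y.obj.obj (op U)),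
      φ.app (op U) (γ.elt x y) = δ.elt x y

end Boolean

/-- `W`, with the evaluation map `ev : W × X ⟶ Y` on the product `p` of `W` and `X`, is the
exponential `Y ^ X` in `D`, where all products with `X` exist. -/
structure IsExponential {D : Type*} [Category D] {X Y W : D} (p : BinaryFan W X)
    (hp : IsLimit p) (ev : p.pt ⟶ Y) : Prop where
  hasProducts : ∀ Z : D, HasBinaryProduct Z X
  universal : ∀ (Z : D) (q : BinaryFan Z X), IsLimit q → ∀ g : q.pt ⟶ Y,
    ∃! h : Z ⟶ W, hp.lift (BinaryFan.mk (q.fst ≫ h) q.snd) ≫ ev = g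

end InternalLocale

/-! The hypothesis is used only to see that `Y` is finite and decidable in the internal logic.
Suppose subsheaves of `Y` correspond to ideals of a Boolean algebra `A`. The elements of `A` whose
subsheaf lies in a finitely listed one form an ideal. Every point of `Y` lies in the subsheaf of
this ideal, so it contains `⊤`, and `Y` is finite (`finSieve_mem`). A singleton is a join of
subsheaves given by elements of `A`, hence locally is one of them, hence is complemented; so
equality on `Y` is decidable (`decSieve_mem`).

The exponential is the locale of functional relations from `X` to `Y`. Its frame is presented by
generators `(x, y)` and the two relations: an open is a set of words (finite meets of generators)
closed under the corresponding covers. Frame homomorphisms from it to `L` are the functional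
relations with values in `L` (`GraphData.hom`, `GraphOpen.hom_ext`). On the other side, since `X` is
discrete, the product of `X` with a locale with frame `L` has frame `L ^ X` (`prodFanIsLimit`), and
a map to the discrete space `Y` is a partition indexed by `Y`. A `Y`-indexed partition of `L ^ X`,
evaluated at each `x`, is a functional relation with values in `L`; decidability of `Y` gives the
way back. This is the exponential law (`evalHom_comp_liftHom_eq_iff`).

Finiteness of `Y` makes the first relation a finite join, so all relations become finitary. Hence
any ideal of a Boolean algebra satisfying the relations pulls back to an open (`Generators.pre`),
and looking at the empty word gives compactness (`Generators.mem_top_of_pre_eq_top`). Decidability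
makes each generator complemented, so words are clopen, and opens correspond to ideals of clopens
(`pre_clopensBelow`, `clopensBelow_pre`). For the universal property, a clopen and its complement
are covered by words; compactness selects finitely many of them, and the join of the values of those
in the clopen is its image (`exists_represents`). It is the only possible one (`Represents.unique`,
`represents_hom`). -/

namespace InternalLocale

/-! ### The frame of functional graphs, presented by words and covers. -/

section GraphOpens

variable {C : Type u} [SmallCategory C] {J : GrothendieckTopology C}

theorem map_map_type (X : Cᵒᵖ ⥤ Type u) {U V W : C} (f : V ⟶ U) (g : W ⟶ V) (x : X.obj (op U)) :
    X.map g.op (X.map f.op x) = X.map (g ≫ f).op x := by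
  simp

theorem map_map_frm (L : Cᵒᵖ ⥤ Frm.{u}) {U V W : C} (f : V ⟶ U) (g : W ⟶ V)
    (x : L.obj (op U)) : L.map g.op (L.map f.op x) = L.map (g ≫ f).op x := by
  simp

theorem map_map_bool (A : Cᵒᵖ ⥤ BoolAlg.{u}) {U V W : C} (f : V ⟶ U) (g : W ⟶ V)
    (x : A.obj (op U)) : A.map g.op (A.map f.op x) = A.map (g ≫ f).op x := by
  simp

/-- Internal inequality of two elements. -/
def Apart (J : GrothendieckTopology C) (Y : Cᵒᵖ ⥤ Type u) {U : C} (y y' : Y.obj (op U)) : Prop :=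
  ∀ ⦃V : C⦄ (f : V ⟶ U), Y.map f.op y = Y.map f.op y' → ⊥ ∈ J V

theorem Apart.map {Y : Cᵒᵖ ⥤ Type u} {U V : C} {y y' : Y.obj (op U)} (h : Apart J Y y y')
    (f : V ⟶ U) : Apart J Y (Y.map f.op y) (Y.map f.op y') := by
  intro W g hg
  rw [map_map_type, map_map_type] at hg
  exact h _ hg

/-- Finite lists of generators `(x, y)`, thought of as their meets. -/
abbrev Word (X Y : Cᵒᵖ ⥤ Type u) (U : C) : Type u := List (X.obj (op U) × Y.obj (op U))

/-- Restriction of words. -/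
def wres {X Y : Cᵒᵖ ⥤ Type u} {U V : C} (f : V ⟶ U) (l : Word X Y U) : Word X Y V :=
  l.map fun p => (X.map f.op p.1, Y.map f.op p.2)

section

variable {X Y : Cᵒᵖ ⥤ Type u} {U V W : C}

@[simp]
theorem wres_nil (f : V ⟶ U) : wres f ([] : Word X Y U) = [] := rfl

@[simp]
theorem wres_cons (f : V ⟶ U) (x : X.obj (op U)) (y : Y.obj (op U)) (l : Word X Y U) :
    wres f ((x, y) :: l) = (X.map f.op x, Y.map f.op y) :: wres f l := rfl

@[simp]
theorem wres_append (f : V ⟶ U) (l l' : Word X Y U) :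
    wres f (l ++ l') = wres f l ++ wres f l' := List.map_append

@[simp]
theorem wres_id (l : Word X Y U) : wres (𝟙 U) l = l := by
  simp [wres]

@[simp]
theorem wres_wres (f : V ⟶ U) (g : W ⟶ V) (l : Word X Y U) :
    wres g (wres f l) = wres (g ≫ f) l := by
  simp [wres]

theorem wres_subset (f : V ⟶ U) {l l' : Word X Y U} (h : l ⊆ l') : wres f l ⊆ wres f l' :=
  List.map_subset _ h

end

/-- The presheaf of words. -/
def words (X Y : Cᵒᵖ ⥤ Type u) : Cᵒᵖ ⥤ Type u where
  obj U := Word X Y U.unop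
  map f := ↾(wres f.unop)
  map_id U := by
    refine ConcreteCategory.hom_ext _ _ fun l => ?_
    exact wres_id l
  map_comp f g := by
    refine ConcreteCategory.hom_ext _ _ fun l => ?_
    exact (wres_wres f.unop g.unop l).symm

variable {X Y : Cᵒᵖ ⥤ Type u} {U : C}

/-- The closure conditions defining the opens of the locale of functional graphs in `X × Y`. -/
structure IsGraphOpen (I : LocalFamily J (words X Y) U) : Prop where
  mono : ∀ ⦃V : C⦄ (f : V ⟶ U) (l l' : Word X Y V), l ⊆ l' → l ∈ I.carrier f → l' ∈ I.carrier f
  total : ∀ ⦃V : C⦄ (f : V ⟶ U) (l : Word X Y V) (x : X.obj (op V)),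
    (∀ ⦃W : C⦄ (g : W ⟶ V) (y : Y.obj (op W)),
      ((X.map g.op x, y) :: wres g l : Word X Y W) ∈ I.carrier (g ≫ f)) → l ∈ I.carrier f
  single : ∀ ⦃V : C⦄ (f : V ⟶ U) (l : Word X Y V) (x : X.obj (op V)) (y y' : Y.obj (op V)),
    Apart J Y y y' → ((x, y) :: (x, y') :: l : Word X Y V) ∈ I.carrier f

variable (J X Y U) in
/-- The opens over `U` of the locale of functional graphs in `X × Y`. -/
def GraphOpen : Type u := {I : LocalFamily J (words X Y) U // IsGraphOpen I}

/-- The least graph open containing a family of words. -/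
inductive Gen (J : GrothendieckTopology C) (S : SubFamily (words X Y) U) :
    ∀ ⦃V : C⦄, (V ⟶ U) → Word X Y V → Prop
  | base {V : C} (f : V ⟶ U) (l : Word X Y V) (h : l ∈ S.carrier f) : Gen J S f l
  | isLocal {V : C} (f : V ⟶ U) (l : Word X Y V) (R : Sieve V) (hR : R ∈ J V)
      (h : ∀ ⦃W : C⦄ (g : W ⟶ V), R g → Gen J S (g ≫ f) (wres g l)) : Gen J S f l
  | mono {V : C} (f : V ⟶ U) (l l' : Word X Y V) (h : l ⊆ l') (hl : Gen J S f l) : Gen J S f l'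
  | total {V : C} (f : V ⟶ U) (l : Word X Y V) (x : X.obj (op V))
      (h : ∀ ⦃W : C⦄ (g : W ⟶ V) (y : Y.obj (op W)),
        Gen J S (g ≫ f) ((X.map g.op x, y) :: wres g l)) : Gen J S f l
  | single {V : C} (f : V ⟶ U) (l : Word X Y V) (x : X.obj (op V)) (y y' : Y.obj (op V))
      (h : Apart J Y y y') : Gen J S f ((x, y) :: (x, y') :: l)

/-- Every rule of `Gen` is stable under change of stage, so the inductive closure needs no separate
rule for restriction. -/
theorem Gen.restrict {S : SubFamily (words X Y) U} {V : C} {f : V ⟶ U} {l : Word X Y V}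
    (h : Gen J S f l) : ∀ ⦃W : C⦄ (g : W ⟶ V), Gen J S (g ≫ f) (wres g l) := by
  induction h with
  | base f l h => exact fun W g => .base _ _ (S.restrict f l h g)
  | isLocal f l R hR _ ih =>
    intro W g
    refine .isLocal _ _ (R.pullback g) (J.pullback_stable g hR) fun W' k hk => ?_
    simpa using ih (k ≫ g) hk (𝟙 _)
  | mono f l l' h _ ih => exact fun W g => .mono _ _ _ (wres_subset g h) (ih g)
  | total f l x _ ih =>
    intro W g
    refine .total _ _ (X.map g.op x) fun W' k y => ?_
    simpa using ih (k ≫ g) y (𝟙 _)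
  | single f l x y y' h => exact fun W g => .single _ _ _ _ _ (h.map g)

namespace GraphOpen

instance : PartialOrder (GraphOpen J X Y U) := Subtype.partialOrder _

/-- Membership of a word in a graph open. -/
def Mem (I : GraphOpen J X Y U) {V : C} (f : V ⟶ U) (l : Word X Y V) : Prop := l ∈ I.1.carrier f

section

variable (I : GraphOpen J X Y U) {V : C} (f : V ⟶ U)

theorem mem_restrict {l : Word X Y V} (h : I.Mem f l) {W : C} (g : W ⟶ V) :
    I.Mem (g ≫ f) (wres g l) := I.1.restrict f l h g

theorem mem_local {l : Word X Y V} {R : Sieve V} (hR : R ∈ J V)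
    (h : ∀ ⦃W : C⦄ (g : W ⟶ V), R g → I.Mem (g ≫ f) (wres g l)) : I.Mem f l :=
  I.1.isLocal f l R hR h

theorem mem_mono {l l' : Word X Y V} (h : l ⊆ l') (hl : I.Mem f l) : I.Mem f l' :=
  I.2.mono f l l' h hl

theorem mem_total {l : Word X Y V} (x : X.obj (op V))
    (h : ∀ ⦃W : C⦄ (g : W ⟶ V) (y : Y.obj (op W)),
      I.Mem (g ≫ f) ((X.map g.op x, y) :: wres g l)) : I.Mem f l :=
  I.2.total f l x h

theorem mem_single {l : Word X Y V} {x : X.obj (op V)} {y y' : Y.obj (op V)}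
    (h : Apart J Y y y') (hl : (x, y) ∈ l) (hl' : (x, y') ∈ l) : I.Mem f l :=
  I.mem_mono f (by simp [hl, hl']) (I.2.single f l x y y' h)

end

theorem ext_mem {I K : GraphOpen J X Y U}
    (h : ∀ ⦃V : C⦄ (f : V ⟶ U) (l : Word X Y V), I.Mem f l ↔ K.Mem f l) : I = K :=
  le_antisymm (fun _ f l => (h f l).1) (fun _ f l => (h f l).2)

/-- The graph open with given members. -/
def mk' (M : ∀ ⦃V : C⦄, (V ⟶ U) → Word X Y V → Prop)
    (restrict : ∀ ⦃V : C⦄ (f : V ⟶ U) (l : Word X Y V), M f l → ∀ ⦃W : C⦄ (g : W ⟶ V),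
      M (g ≫ f) (wres g l))
    (isLocal : ∀ ⦃V : C⦄ (f : V ⟶ U) (l : Word X Y V) (R : Sieve V), R ∈ J V →
      (∀ ⦃W : C⦄ (g : W ⟶ V), R g → M (g ≫ f) (wres g l)) → M f l)
    (mono : ∀ ⦃V : C⦄ (f : V ⟶ U) (l l' : Word X Y V), l ⊆ l' → M f l → M f l')
    (total : ∀ ⦃V : C⦄ (f : V ⟶ U) (l : Word X Y V) (x : X.obj (op V)),
      (∀ ⦃W : C⦄ (g : W ⟶ V) (y : Y.obj (op W)),
        M (g ≫ f) ((X.map g.op x, y) :: wres g l)) → M f l)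
    (single : ∀ ⦃V : C⦄ (f : V ⟶ U) (l : Word X Y V) (x : X.obj (op V)) (y y' : Y.obj (op V)),
      Apart J Y y y' → M f ((x, y) :: (x, y') :: l)) : GraphOpen J X Y U :=
  ⟨{ carrier := fun _ f => {l | M f l}
     restrict := restrict
     isLocal := isLocal }, ⟨mono, total, single⟩⟩

/-- The least graph open containing a family of words. -/
def hull (S : SubFamily (words X Y) U) : GraphOpen J X Y U :=
  mk' (fun _ f l => Gen J S f l) (fun _ _ _ h => h.restrict) (fun _ => .isLocal) (fun _ => .mono)
    (fun _ => .total) (fun _ => .single)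

/-- Restriction of graph opens. -/
def pull {U' : C} (h : U' ⟶ U) (I : GraphOpen J X Y U) : GraphOpen J X Y U' :=
  ⟨I.1.pull h, fun _ f => I.2.mono (f ≫ h), fun _ f l x hx => I.2.total (f ≫ h) l x fun _ g y => by
    have := hx g y
    change _ ∈ I.1.carrier ((g ≫ f) ≫ h) at this
    rwa [Category.assoc] at this, fun _ f => I.2.single (f ≫ h)⟩

theorem mem_pull_id {V : C} (h : V ⟶ U) (I : GraphOpen J X Y U) (l : Word X Y V) :
    (I.pull h).Mem (𝟙 V) l ↔ I.Mem h l := by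
  change I.Mem (𝟙 V ≫ h) l ↔ _
  rw [Category.id_comp]

@[simp]
theorem mem_pull {U' V : C} (h : U' ⟶ U) (I : GraphOpen J X Y U) (f : V ⟶ U') (l : Word X Y V) :
    (I.pull h).Mem f l ↔ I.Mem (f ≫ h) l := Iff.rfl

/-- The premises of a rule of `Gen` at an arrow sit at composites with that arrow, so a derivation
at `f ≫ h` never leaves the arrows that factor through `h`. Restricting a hull therefore keeps its
universal property over the new stage. -/
theorem pull_hull_le {S : SubFamily (words X Y) U} {U' : C} (h : U' ⟶ U)
    {I : GraphOpen J X Y U'} : (hull S).pull h ≤ I ↔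
      ∀ ⦃V : C⦄ (f : V ⟶ U') (l : Word X Y V), l ∈ S.carrier (f ≫ h) → I.Mem f l := by
  refine ⟨fun H V f l hl => H f l (.base _ _ hl), fun H => ?_⟩
  -- The arrow is generalized to `k` with an equation, because induction on `Gen` needs a free
  -- index.
  have key : ∀ ⦃V : C⦄ (k : V ⟶ U) (l : Word X Y V), Gen J S k l →
      ∀ f : V ⟶ U', k = f ≫ h → I.Mem f l := by
    intro V k l hl
    induction hl with
    | base k l hl =>
      rintro f rfl
      exact H f l hl
    | isLocal k l R hR _ ih =>
      rintro f rfl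
      exact I.mem_local f hR fun W g hg => ih g hg _ (by simp)
    | mono k l l' hl _ ih =>
      rintro f rfl
      exact I.mem_mono f hl (ih f rfl)
    | total k l x _ ih =>
      rintro f rfl
      exact I.mem_total f x fun W g y => ih g y _ (by simp)
    | single k l x y y' h =>
      rintro f rfl
      exact I.2.single f l x y y' h
  exact fun V f l hl => key _ l hl f rfl

theorem pull_id (I : GraphOpen J X Y U) : I.pull (𝟙 U) = I :=
  ext_mem fun V f l => by simp

theorem hull_le {S : SubFamily (words X Y) U} {I : GraphOpen J X Y U} : hull S ≤ I ↔
    ∀ ⦃V : C⦄ (f : V ⟶ U) (l : Word X Y V), l ∈ S.carrier f → I.Mem f l := by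
  have := pull_hull_le (S := S) (𝟙 U) (I := I)
  simpa [pull_id] using this

theorem mem_hull {S : SubFamily (words X Y) U} {V : C} {f : V ⟶ U} {l : Word X Y V}
    (h : l ∈ S.carrier f) : (hull (J := J) S).Mem f l := .base _ _ h

/-- The union of a set of graph opens. -/
def union (s : Set (GraphOpen J X Y U)) : SubFamily (words X Y) U :=
  LocalFamily.union (Subtype.val '' s)

theorem mem_union {s : Set (GraphOpen J X Y U)} {V : C} {f : V ⟶ U} {l : Word X Y V} :
    l ∈ (union s).carrier f ↔ ∃ I ∈ s, I.Mem f l := by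
  constructor
  · rintro ⟨_, ⟨I, hI, rfl⟩, h⟩
    exact ⟨I, hI, h⟩
  · rintro ⟨I, hI, h⟩
    exact ⟨_, ⟨I, hI, rfl⟩, h⟩

/-- Meets are intersections, joins are generated by unions. -/
instance : CompleteLattice (GraphOpen J X Y U) where
  inf I K := mk' (fun _ f l => I.Mem f l ∧ K.Mem f l)
    (fun _ f _ h _ g => ⟨I.mem_restrict f h.1 g, K.mem_restrict f h.2 g⟩)
    (fun _ f _ _ hR h => ⟨I.mem_local f hR fun _ g hg => (h g hg).1,
      K.mem_local f hR fun _ g hg => (h g hg).2⟩)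
    (fun _ f _ _ hl h => ⟨I.mem_mono f hl h.1, K.mem_mono f hl h.2⟩)
    (fun _ f _ x h => ⟨I.mem_total f x fun _ g y => (h g y).1,
      K.mem_total f x fun _ g y => (h g y).2⟩)
    (fun _ f l x y y' h => ⟨I.2.single f l x y y' h, K.2.single f l x y y' h⟩)
  inf_le_left _ _ _ _ _ h := h.1
  inf_le_right _ _ _ _ _ h := h.2
  le_inf _ _ _ h h' _ f l hl := ⟨h f l hl, h' f l hl⟩
  sup I K := hull (union {I, K})
  le_sup_left I K _ _ _ h := mem_hull (mem_union.2 ⟨I, by simp, h⟩)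
  le_sup_right I K _ _ _ h := mem_hull (mem_union.2 ⟨K, by simp, h⟩)
  sup_le I K T h h' := hull_le.2 fun V f l hl => by
    obtain ⟨Q, rfl | rfl, hQ⟩ := mem_union.1 hl
    · exact h f l hQ
    · exact h' f l hQ
  sSup s := hull (union s)
  isLUB_sSup s := ⟨fun I hI _ _ _ h => mem_hull (mem_union.2 ⟨I, hI, h⟩), fun T hT =>
    hull_le.2 fun V f l hl => by
      obtain ⟨Q, hQ, hl⟩ := mem_union.1 hl
      exact hT hQ f l hl⟩
  sInf s := mk' (fun _ f l => ∀ I ∈ s, I.Mem f l)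
    (fun _ f _ h _ g I hI => I.mem_restrict f (h I hI) g)
    (fun _ f _ _ hR h I hI => I.mem_local f hR fun _ g hg => h g hg I hI)
    (fun _ f _ _ hl h I hI => I.mem_mono f hl (h I hI))
    (fun _ f _ x h I hI => I.mem_total f x fun _ g y => h g y I hI)
    (fun _ f l x y y' h I _ => I.2.single f l x y y' h)
  isGLB_sInf s := ⟨fun I hI _ _ _ h => h I hI, fun T hT _ f l hl I hI => hT hI f l hl⟩
  top := mk' (fun _ _ _ => True) (fun _ _ _ _ _ _ => trivial) (fun _ _ _ _ _ _ => trivial)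
    (fun _ _ _ _ _ _ => trivial) (fun _ _ _ _ _ => trivial) (fun _ _ _ _ _ _ _ => trivial)
  le_top _ _ _ _ _ := trivial
  bot := hull
    { carrier := fun _ _ => ∅
      restrict := fun _ _ _ h => h.elim }
  bot_le _ := hull_le.2 fun _ _ _ h => h.elim

theorem mem_inf {I K : GraphOpen J X Y U} {V : C} {f : V ⟶ U} {l : Word X Y V} :
    (I ⊓ K).Mem f l ↔ I.Mem f l ∧ K.Mem f l := Iff.rfl

theorem mem_top {V : C} {f : V ⟶ U} {l : Word X Y V} :
    (⊤ : GraphOpen J X Y U).Mem f l := trivial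

/-- The empty word is the empty meet: it is contained in every word, so `mem_mono` spreads it
everywhere. -/
theorem eq_top_iff_nil {I : GraphOpen J X Y U} : I = ⊤ ↔ I.Mem (𝟙 U) [] := by
  constructor
  · rintro rfl
    exact mem_top
  · intro h
    refine top_le_iff.1 fun V f l _ => I.mem_mono f (List.nil_subset l) ?_
    simpa using I.mem_restrict _ h f

/-- Heyting implication. -/
def imp (I K : GraphOpen J X Y U) : GraphOpen J X Y U :=
  -- Forcing over two orders at once, later stages and longer words.
  mk' (fun V f l => ∀ ⦃W : C⦄ (g : W ⟶ V) (l' : Word X Y W), wres g l ⊆ l' →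
      I.Mem (g ≫ f) l' → K.Mem (g ≫ f) l')
    (fun V f l h W g W' k l' hl' hI => by
      have := h (k ≫ g) l' (by simpa using hl')
      simp only [Category.assoc] at this hI ⊢
      exact this hI)
    (fun V f l R hR h W g l' hl' hI => by
      refine K.mem_local _ (J.pullback_stable g hR) fun W' k hk => ?_
      have := h (k ≫ g) hk (𝟙 _) (wres k l') (by simpa using wres_subset k hl')
      simp only [Category.id_comp, Category.assoc] at this
      exact this (I.mem_restrict _ hI k))
    (fun V f l l' hl h W g l'' hl'' => h g l'' (fun _ ha => hl'' (wres_subset g hl ha)))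
    (fun V f l x h W g l' hl' hI => by
      -- Totality is applied to `K` at `l'`: extending `l'` by `(x, y)` also extends the extension
      -- of `l`, to which the hypothesis applies.
      refine K.mem_total _ (X.map g.op x) fun W' k y => ?_
      have := h (k ≫ g) y (𝟙 _) ((X.map k.op (X.map g.op x), y) :: wres k l') (by
        have := wres_subset k hl'
        simp only [wres_wres] at this
        simp only [wres_id, map_map_type]
        exact List.cons_subset_cons _ this)
      simp only [Category.id_comp, Category.assoc] at this
      exact this (I.mem_mono _ (List.subset_cons_self _ _) (I.mem_restrict _ hI k)))
    (fun V f l x y y' h W g l' hl' _ =>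
      K.mem_single _ (h.map g) (x := X.map g.op x) (hl' (by simp)) (hl' (by simp)))

theorem le_imp_iff {T I K : GraphOpen J X Y U} : T ≤ imp I K ↔ T ⊓ I ≤ K := by
  constructor
  · intro h V f (l : Word X Y V) hl
    have := h f l hl.1 (𝟙 _) l (by simp)
    simp only [Category.id_comp] at this
    exact this hl.2
  · intro h V f l hl W g l' hl' hI
    exact h _ _ ⟨T.mem_mono _ hl' (T.mem_restrict f hl g), hI⟩

theorem mem_imp {I K : GraphOpen J X Y U} {V : C} {f : V ⟶ U} {l : Word X Y V} :
    (imp I K).Mem f l ↔ ∀ ⦃W : C⦄ (g : W ⟶ V) (l' : Word X Y W), wres g l ⊆ l' →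
      I.Mem (g ≫ f) l' → K.Mem (g ≫ f) l' := Iff.rfl

/-- This compatibility makes the implication internal, so that it can witness distributivity at
every stage in `graphFrame`. -/
theorem pull_imp (I K : GraphOpen J X Y U) {U' : C} (h : U' ⟶ U) :
    (imp I K).pull h = imp (I.pull h) (K.pull h) :=
  ext_mem fun V f l => by simp [mem_imp]

instance : Order.Frame (GraphOpen J X Y U) where
  himp := imp
  le_himp_iff _ _ _ := le_imp_iff
  compl I := imp I ⊥
  himp_bot _ := rfl

/-- Restriction is a frame homomorphism. -/
def pullHom {U' : C} (h : U' ⟶ U) : FrameHom (GraphOpen J X Y U) (GraphOpen J X Y U') where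
  toFun := pull h
  map_inf' _ _ := rfl
  map_top' := rfl
  map_sSup' s := by
    apply le_antisymm
    · refine (pull_hull_le h).2 fun V f l hl => ?_
      obtain ⟨I, hI, hl⟩ := mem_union.1 hl
      exact (le_sSup (Set.mem_image_of_mem _ hI) : I.pull h ≤ _) f l hl
    · refine sSup_le ?_
      rintro _ ⟨I, hI, rfl⟩
      exact fun V f l hl => (le_sSup hI : I ≤ _) (f ≫ h) l hl

end GraphOpen

/-- The presheaf of graph opens. -/
def graphFrm (J : GrothendieckTopology C) (X Y : Cᵒᵖ ⥤ Type u) : Cᵒᵖ ⥤ Frm.{u} where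
  obj U := Frm.of (GraphOpen J X Y U.unop)
  map h := Frm.ofHom (GraphOpen.pullHom h.unop)
  map_id U := by
    apply Frm.hom_ext
    refine DFunLike.ext _ _ fun (S : GraphOpen J X Y U.unop) => ?_
    exact S.pull_id
  map_comp {U _ _} h k := by
    apply Frm.hom_ext
    refine DFunLike.ext _ _ fun (S : GraphOpen J X Y U.unop) => ?_
    refine GraphOpen.ext_mem fun V f x => ?_
    change S.Mem (f ≫ k.unop ≫ h.unop) x ↔ S.Mem ((f ≫ k.unop) ≫ h.unop) x
    rw [Category.assoc]

/-- A word is put into the glued open when each of its restrictions into the sieve belongs to the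
local piece. This universal form, unlike generation from below, inherits the closure conditions
directly from the pieces. -/
theorem graphFrm_isSheaf (J : GrothendieckTopology C) (X Y : Cᵒᵖ ⥤ Type u) :
    Presieve.IsSheaf J (graphFrm J X Y ⋙ forget Frm) := by
  intro U R hR x hx
  rw [Presieve.compatible_iff_sieveCompatible] at hx
  let y : ∀ ⦃V : C⦄ (f : V ⟶ U), R f → GraphOpen J X Y V := fun V f h => x f h
  have hy : ∀ ⦃V W : C⦄ (f : V ⟶ U) (g : W ⟶ V) (h : R f) (h' : R (g ≫ f)),
      y (g ≫ f) h' = (y f h).pull g := fun V W f g h _ => hx f g h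
  -- The composite is a free variable `k`, so that the comparison survives different bracketings of
  -- composites.
  have hy' : ∀ ⦃V W : C⦄ (f : V ⟶ U) (g : W ⟶ V) (h : R f) (k : W ⟶ U) (h' : R k) (l),
      k = g ≫ f → ((y k h').Mem (𝟙 W) l ↔ (y f h).Mem g l) := by
    rintro V W f g h _ h' l rfl
    rw [hy f g h]
    simp
  let S : GraphOpen J X Y U := GraphOpen.mk'
    (fun V f l => ∀ ⦃W : C⦄ (g : W ⟶ V) (h : R (g ≫ f)), (y _ h).Mem (𝟙 W) (wres g l))
    (fun V f l hl W g W' k hk => by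
      have := hl (k ≫ g) (by simpa using hk)
      simp only [wres_wres]
      convert this using 2
      all_goals simp)
    (fun V f l Q hQ hl W g hg => by
      refine GraphOpen.mem_local _ _ (J.pullback_stable g hQ) fun W' k hk => ?_
      have := hl (k ≫ g) hk (𝟙 _) (by simpa using R.downward_closed hg k)
      rw [← hy' (g ≫ f) (k ≫ 𝟙 _) hg ((𝟙 _) ≫ (k ≫ g) ≫ f)
        (by simpa using R.downward_closed hg k) _ (by simp)]
      simpa using this)
    (fun V f l l' hl h W g hg => GraphOpen.mem_mono _ _ (wres_subset g hl) (h g hg))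
    (fun V f l x hl W g hg => by
      refine GraphOpen.mem_total _ _ (X.map g.op x) fun W' k y' => ?_
      have := hl (k ≫ g) y' (𝟙 _) (by simpa using R.downward_closed hg k)
      rw [← hy' (g ≫ f) (k ≫ 𝟙 _) hg ((𝟙 _) ≫ (k ≫ g) ≫ f)
        (by simpa using R.downward_closed hg k) _ (by simp)]
      simpa using this)
    (fun V f l x y y' h W g hg =>
      GraphOpen.mem_single _ _ (h.map g) (x := X.map g.op x) (by simp) (by simp))
  have hS : ∀ ⦃V : C⦄ (f : V ⟶ U) (h : R f), S.pull f = y f h := by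
    intro V f h
    refine GraphOpen.ext_mem fun W k l => ?_
    constructor
    · intro hl
      have := hl (𝟙 _) (by simpa using R.downward_closed h k)
      rw [hy' f k h _ _ _ (by simp)] at this
      simpa using this
    · intro hl W' g hg
      rw [hy' f (g ≫ k) h _ _ _ (by simp)]
      exact (y f h).mem_restrict k hl g
  refine ⟨S, hS, fun T hT => ?_⟩
  change GraphOpen J X Y U at T
  have hT' : ∀ ⦃V : C⦄ (f : V ⟶ U), R f → T.pull f = S.pull f :=
    fun V f h => (hT f h).trans (hS f h).symm
  have key : ∀ T S : GraphOpen J X Y U, (∀ ⦃V : C⦄ (f : V ⟶ U), R f → T.pull f = S.pull f) →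
      T ≤ S := by
    intro T S h V f l hl
    refine S.mem_local f (J.pullback_stable f hR) fun W g hg => ?_
    have h1 : (T.pull (g ≫ f)).Mem (𝟙 W) (wres g l) := by
      simpa using T.mem_restrict f hl g
    rw [h _ hg] at h1
    simpa using h1
  have e : T = S := le_antisymm (key T S hT') (key S T fun V f h => (hT' f h).symm)
  exact e

/-- The union of an internal family of graph opens. -/
def graphUnion (Φ : SubFamily (graphFrm J X Y ⋙ forget Frm) U) : SubFamily (words X Y) U where
  carrier V f := {l | ∃ T : GraphOpen J X Y V, T ∈ Φ.carrier f ∧ T.Mem (𝟙 V) l}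
  restrict := by
    rintro V f l ⟨T, hT, hl⟩ W g
    refine ⟨T.pull g, Φ.restrict f T hT g, ?_⟩
    refine (T.mem_pull_id _ _).2 ?_
    have := T.mem_restrict (𝟙 V) hl g
    rwa [Category.comp_id] at this

theorem isJoin_graphUnion (Φ : SubFamily (graphFrm J X Y ⋙ forget Frm) U) :
    IsJoin (graphFrm J X Y) Φ (GraphOpen.hull (graphUnion Φ) : GraphOpen J X Y U) := by
  intro V f (b : GraphOpen J X Y V)
  change (GraphOpen.hull (graphUnion Φ) : GraphOpen J X Y U).pull f ≤ b ↔
    ∀ ⦃W : C⦄ (g : W ⟶ V) (a : GraphOpen J X Y W), a ∈ Φ.carrier (g ≫ f) → a ≤ b.pull g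
  rw [GraphOpen.pull_hull_le]
  constructor
  · intro h W g a ha W' k l hl
    refine h (k ≫ g) l ⟨a.pull k, ?_, (a.mem_pull_id _ _).2 hl⟩
    have := Φ.restrict _ _ ha k
    simp only [← Category.assoc] at this ⊢
    exact this
  · rintro h W g l ⟨T, hT, hl⟩
    exact (b.mem_pull_id _ _).1 (h g T hT (𝟙 W) l hl)

/-- The frame of opens of the locale of functional graphs in `X × Y`. -/
def graphFrame (J : GrothendieckTopology C) (X Y : Cᵒᵖ ⥤ Type u) : IFrame J where
  obj := graphFrm J X Y
  isSheaf := graphFrm_isSheaf J X Y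
  exists_isJoin Φ := ⟨_, isJoin_graphUnion Φ⟩
  inf_isJoin {U} Φ s t h := by
    change GraphOpen J X Y U at s t
    intro V f b
    change GraphOpen J X Y V at b
    -- Distributivity is adjointness: `t` is moved to the right by implication, the hypothesis that
    -- `s` is a join is applied, and `t` is moved back under each member of the family.
    have h1 : (s ⊓ t).pull f ≤ b ↔ s.pull f ≤ GraphOpen.imp (t.pull f) b :=
      (GraphOpen.le_imp_iff (T := s.pull f) (I := t.pull f)).symm
    refine h1.trans ((h f _).trans ?_)
    constructor
    · rintro H W g _ ⟨a, ha, rfl⟩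
      change GraphOpen J X Y W at a
      have := H g a ha
      change a ≤ (GraphOpen.imp (t.pull f) b).pull g at this
      rw [GraphOpen.pull_imp, GraphOpen.le_imp_iff] at this
      have e : (t.pull f).pull g = t.pull (g ≫ f) := GraphOpen.ext_mem fun V f l => by simp
      rw [e] at this
      exact this
    · intro H W g a ha
      change GraphOpen J X Y W at a
      change a ≤ (GraphOpen.imp (t.pull f) b).pull g
      rw [GraphOpen.pull_imp, GraphOpen.le_imp_iff]
      have e : (t.pull f).pull g = t.pull (g ≫ f) := GraphOpen.ext_mem fun V f l => by simp
      rw [e]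
      exact H g _ ⟨a, ha, rfl⟩

end GraphOpens

/-! ### Calculus of internal joins, and gluing of homomorphisms along a partition. -/

section InternalFrames

variable {C : Type u} [SmallCategory C] {J : GrothendieckTopology C}

theorem frm_map_mono (L : Cᵒᵖ ⥤ Frm.{u}) {U V : C} (f : V ⟶ U) {a b : L.obj (op U)} (h : a ≤ b) :
    L.map f.op a ≤ L.map f.op b :=
  OrderHomClass.mono (L.map f.op).hom h

/-- Restriction of a family along `h : U' ⟶ U`. -/
def SubFamily.pull {P : Cᵒᵖ ⥤ Type u} {U U' : C} (h : U' ⟶ U) (S : SubFamily P U) :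
    SubFamily P U' where
  carrier _ f := S.carrier (f ≫ h)
  restrict _ f x hx _ g := by
    simpa using S.restrict (f ≫ h) x hx g

theorem SubFamily.mem_congr {P : Cᵒᵖ ⥤ Type u} {U V : C} (S : SubFamily P U) {f f' : V ⟶ U}
    (h : f = f') {x : P.obj (op V)} (hx : x ∈ S.carrier f) : x ∈ S.carrier f' := h ▸ hx

section Joins

variable {L : Cᵒᵖ ⥤ Frm.{u}} {U V : C} {Φ : SubFamily (L ⋙ forget Frm) U} {s : L.obj (op U)}

theorem IsJoin.pull (h : IsJoin L Φ s) (f : V ⟶ U) : IsJoin L (Φ.pull f) (L.map f.op s) := by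
  intro W g b
  rw [map_map_frm, h (g ≫ f) b]
  simp [SubFamily.pull]

theorem IsJoin.le_iff (h : IsJoin L Φ s) {b : L.obj (op U)} : s ≤ b ↔
    ∀ ⦃V : C⦄ (f : V ⟶ U) (a : L.obj (op V)), a ∈ Φ.carrier f → a ≤ L.map f.op b := by
  simpa using h (𝟙 U) b

theorem IsJoin.le (h : IsJoin L Φ s) {f : V ⟶ U} {a : L.obj (op V)} (ha : a ∈ Φ.carrier f) :
    a ≤ L.map f.op s :=
  h.le_iff.1 le_rfl f a ha

theorem IsJoin.of_le_iff (h : ∀ ⦃V : C⦄ (f : V ⟶ U) (a : L.obj (op V)), a ∈ Φ.carrier f →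
      a ≤ L.map f.op s)
    (h' : ∀ ⦃V : C⦄ (f : V ⟶ U) (b : L.obj (op V)),
      (∀ ⦃W : C⦄ (g : W ⟶ V) (a : L.obj (op W)), a ∈ Φ.carrier (g ≫ f) → a ≤ L.map g.op b) →
        L.map f.op s ≤ b) : IsJoin L Φ s := by
  refine fun V f b => ⟨fun H W g a ha => ?_, h' f b⟩
  refine (h _ a ha).trans ?_
  rw [← map_map_frm]
  exact frm_map_mono L g H

end Joins

namespace IFrame

variable (L : IFrame J) {U V : C}

/-- An inequality is the equation `a ⊓ b = a`, and equations are local in a sheaf. -/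
theorem le_of_cover {R : Sieve U} (hR : R ∈ J U) {a b : L.obj.obj (op U)}
    (h : ∀ ⦃V : C⦄ (f : V ⟶ U), R f → L.obj.map f.op a ≤ L.obj.map f.op b) : a ≤ b := by
  have e : a ⊓ b = a := by
    refine (L.isSheaf R hR).isSeparatedFor.ext fun V f hf => ?_
    change L.obj.map f.op (a ⊓ b) = L.obj.map f.op a
    rw [map_inf]
    exact inf_eq_left.2 (h f hf)
  exact inf_eq_left.1 e

/-- The internal join of a family. -/
noncomputable def sup (Φ : SubFamily (L.obj ⋙ forget Frm) U) : L.obj.obj (op U) :=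
  (L.exists_isJoin Φ).choose

theorem isJoin_sup (Φ : SubFamily (L.obj ⋙ forget Frm) U) : IsJoin L.obj Φ (L.sup Φ) :=
  (L.exists_isJoin Φ).choose_spec

variable {L}

/-- Internal distributivity, in the form used throughout to test meets with joins on members of the
family. -/
theorem inf_le_iff_of_isJoin {Φ : SubFamily (L.obj ⋙ forget Frm) U} {s t b : L.obj.obj (op U)}
    (h : IsJoin L.obj Φ s) : s ⊓ t ≤ b ↔
      ∀ ⦃V : C⦄ (f : V ⟶ U) (a : L.obj.obj (op V)), a ∈ Φ.carrier f →
        a ⊓ L.obj.map f.op t ≤ L.obj.map f.op b := by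
  rw [(L.inf_isJoin Φ s t h).le_iff]
  constructor
  · exact fun H V f a ha => H f _ ⟨a, ha, rfl⟩
  · rintro H V f _ ⟨a, ha, rfl⟩
    exact H f a ha

/-- The action of a frame homomorphism on sections. -/
abbrev ap {M L : IFrame J} (φ : M ⟶ L) {U : C} (a : M.obj.obj (op U)) : L.obj.obj (op U) :=
  IFrame.Hom.hom φ |>.app (op U) a

theorem ap_map {M L : IFrame J} (φ : M ⟶ L) {U V : C} (f : V ⟶ U) (a : M.obj.obj (op U)) :
    ap φ (M.obj.map f.op a) = L.obj.map f.op (ap φ a) :=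
  NatTrans.naturality_apply (IFrame.Hom.hom φ) f.op a

theorem ap_top {M L : IFrame J} (φ : M ⟶ L) (U : C) : ap φ (⊤ : M.obj.obj (op U)) = ⊤ :=
  map_top ((IFrame.Hom.hom φ).app (op U)).hom

theorem ap_inf {M L : IFrame J} (φ : M ⟶ L) {U : C} (a b : M.obj.obj (op U)) :
    ap φ (a ⊓ b) = ap φ a ⊓ ap φ b :=
  map_inf ((IFrame.Hom.hom φ).app (op U)).hom a b

theorem ap_mono {M L : IFrame J} (φ : M ⟶ L) {U : C} {a b : M.obj.obj (op U)} (h : a ≤ b) :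
    ap φ a ≤ ap φ b :=
  OrderHomClass.mono ((IFrame.Hom.hom φ).app (op U)).hom h

theorem ap_isJoin_le_iff {M L : IFrame J} (φ : M ⟶ L) {U : C}
    {Φ : SubFamily (M.obj ⋙ forget Frm) U} {s : M.obj.obj (op U)} (h : IsJoin M.obj Φ s)
    {b : L.obj.obj (op U)} : ap φ s ≤ b ↔ ∀ ⦃V : C⦄ (f : V ⟶ U) (a : M.obj.obj (op V)),
      a ∈ Φ.carrier f → ap φ a ≤ L.obj.map f.op b := by
  rw [(IFrame.Hom.isJoin φ Φ s h).le_iff]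
  constructor
  · exact fun H V f a ha => H f _ ⟨a, ha, rfl⟩
  · rintro H V f _ ⟨a, ha, rfl⟩
    exact H f a ha

theorem hom_ext {M L : IFrame J} {φ ψ : M ⟶ L}
    (h : ∀ (U : C) (a : M.obj.obj (op U)), ap φ a = ap ψ a) : φ = ψ := by
  apply IFrame.Hom.ext
  ext U a
  exact h U.unop a

/-- The family of restrictions of a set of sections. -/
def constFamily (L : Cᵒᵖ ⥤ Frm.{u}) {U : C} (s : Set (L.obj (op U))) :
    SubFamily (L ⋙ forget Frm) U where
  carrier _ f := {c | ∃ a ∈ s, c = L.map f.op a}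
  restrict := by
    rintro V f _ ⟨a, ha, rfl⟩ W g
    exact ⟨a, ha, map_map_frm L f g a⟩

/-- External suprema are internal joins of constant families, so a map that respects internal joins
also preserves `sSup`; `Hom.ofFun` relies on this. -/
theorem isJoin_constFamily (L : Cᵒᵖ ⥤ Frm.{u}) {U : C} (s : Set (L.obj (op U))) :
    IsJoin L (constFamily L s) (sSup s) := by
  refine .of_le_iff ?_ ?_
  · rintro V f _ ⟨a, ha, rfl⟩
    exact frm_map_mono L f (le_sSup ha)
  · intro V f b H
    have e : L.map f.op (sSup s) = sSup ((L.map f.op) '' s) := map_sSup (L.map f.op).hom s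
    rw [e]
    refine sSup_le ?_
    rintro _ ⟨a, ha, rfl⟩
    simpa using H (𝟙 V) (L.map f.op a) ⟨a, ha, by simp⟩

/-- Construction of frame homomorphisms from their action on sections. -/
def Hom.ofFun {M L : IFrame J} (E : ∀ ⦃U : C⦄, M.obj.obj (op U) → L.obj.obj (op U))
    (nat : ∀ ⦃U V : C⦄ (f : V ⟶ U) (a : M.obj.obj (op U)),
      E (M.obj.map f.op a) = L.obj.map f.op (E a))
    (top : ∀ U : C, E (⊤ : M.obj.obj (op U)) = ⊤)
    (inf : ∀ ⦃U : C⦄ (a b : M.obj.obj (op U)), E (a ⊓ b) = E a ⊓ E b)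
    (join : ∀ ⦃U : C⦄ (Φ : SubFamily (M.obj ⋙ forget Frm) U) (s : M.obj.obj (op U))
      (b : L.obj.obj (op U)), IsJoin M.obj Φ s →
      (∀ ⦃V : C⦄ (f : V ⟶ U) (a : M.obj.obj (op V)), a ∈ Φ.carrier f → E a ≤ L.obj.map f.op b) →
      E s ≤ b) : M ⟶ L :=
  have mono : ∀ ⦃U : C⦄ (a b : M.obj.obj (op U)), a ≤ b → E a ≤ E b := fun U a b h => by
    rw [← inf_eq_left, ← inf, inf_eq_left.2 h]
  IFrame.Hom.mk
    { app := fun U => Frm.ofHom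
        { toFun := @E U.unop
          map_inf' := @inf U.unop
          map_top' := top U.unop
          map_sSup' := fun s => by
            apply le_antisymm
            · refine join _ _ _ (isJoin_constFamily M.obj s) ?_
              rintro V f _ ⟨a, ha, rfl⟩
              rw [nat]
              exact frm_map_mono L.obj f (le_sSup (Set.mem_image_of_mem _ ha))
            · refine sSup_le ?_
              rintro _ ⟨a, ha, rfl⟩
              exact mono _ _ (le_sSup ha) }
      naturality := fun U V f => by
        apply Frm.hom_ext
        exact DFunLike.ext _ _ fun a => nat f.unop a }
    (fun Φ s h => by
      refine .of_le_iff ?_ ?_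
      · rintro V f _ ⟨a, ha, rfl⟩
        change E a ≤ L.obj.map f.op (E s)
        rw [← nat]
        exact mono _ _ (h.le ha)
      · intro V f b H
        change L.obj.map f.op (E s) ≤ b
        rw [← nat]
        exact join _ _ b (h.pull f) fun W g a ha => H g _ ⟨a, ha, rfl⟩)

end IFrame

/-- A partition of an internal locale indexed by `X`: the data of a map to the discrete space. -/
structure IPartition (X : Cᵒᵖ ⥤ Type u) (L : IFrame J) where
  /-- The members of the partition. -/
  app : ∀ ⦃U : C⦄, X.obj (op U) → L.obj.obj (op U)
  nat : ∀ ⦃U V : C⦄ (f : V ⟶ U) (x : X.obj (op U)), app (X.map f.op x) = L.obj.map f.op (app x)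
  total : ∀ ⦃U : C⦄ (b : L.obj.obj (op U)),
    (∀ ⦃V : C⦄ (f : V ⟶ U) (x : X.obj (op V)), app x ≤ L.obj.map f.op b) → ⊤ ≤ b
  -- Equality in `X` need not be decidable, so disjointness is put positively: the overlap of two
  -- members lies below the join of the restrictions of a member to the stages where the indices
  -- agree.
  disjoint : ∀ ⦃U : C⦄ (x x' : X.obj (op U)) (b : L.obj.obj (op U)),
    (∀ ⦃V : C⦄ (f : V ⟶ U), X.map f.op x = X.map f.op x' →
      app (X.map f.op x) ≤ L.obj.map f.op b) → app x ⊓ app x' ≤ b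

namespace IPartition

variable {X : Cᵒᵖ ⥤ Type u} {L : IFrame J} (p : IPartition X L)

/-- The members cover, so by distributivity an inequality may be checked on each of them. -/
theorem le_of_forall {U : C} {t b : L.obj.obj (op U)}
    (h : ∀ ⦃V : C⦄ (f : V ⟶ U) (x : X.obj (op V)), p.app x ⊓ L.obj.map f.op t ≤ L.obj.map f.op b) :
    t ≤ b := by
  let Φ : SubFamily (L.obj ⋙ forget Frm) U :=
    { carrier := fun V f => {c | ∃ x, c = p.app x}
      restrict := by
        rintro V f _ ⟨x, rfl⟩ W g
        exact ⟨_, (p.nat g x).symm⟩ }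
  have hΦ := L.isJoin_sup Φ
  have e : ⊤ ≤ L.sup Φ := p.total _ fun V f x => hΦ.le ⟨x, rfl⟩
  have := (IFrame.inf_le_iff_of_isJoin (t := t) (b := b) hΦ).2 (by
    rintro V f _ ⟨x, rfl⟩
    exact h f x)
  simpa [top_le_iff.1 e] using this

/-- On the overlap of two members one may argue as if their indices were equal. -/
theorem inf_inf_le {U : C} {x x' : X.obj (op U)} {t b : L.obj.obj (op U)}
    (h : ∀ ⦃V : C⦄ (f : V ⟶ U), X.map f.op x = X.map f.op x' →
      p.app (X.map f.op x) ⊓ L.obj.map f.op t ≤ L.obj.map f.op b) :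
    p.app x ⊓ p.app x' ⊓ t ≤ b := by
  let Φ : SubFamily (L.obj ⋙ forget Frm) U :=
    { carrier := fun V f => {c | X.map f.op x = X.map f.op x' ∧ c = p.app (X.map f.op x)}
      restrict := by
        rintro V f _ ⟨hx, rfl⟩ W g
        refine ⟨by rw [← map_map_type, hx, map_map_type], ?_⟩
        rw [← map_map_type, p.nat g]
        rfl }
  have hΦ := L.isJoin_sup Φ
  refine le_trans (inf_le_inf_right t (p.disjoint x x' (L.sup Φ) fun V f hf => hΦ.le ⟨hf, rfl⟩)) ?_
  refine (IFrame.inf_le_iff_of_isJoin hΦ).2 ?_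
  rintro V f _ ⟨hx, rfl⟩
  exact h f hx

/-- Data for gluing a frame homomorphism along a partition: `rel x m d` says that `d` is part of
the value at `m` of the homomorphism on the piece indexed by `x`. -/
structure Gluing (p : IPartition X L) (M : IFrame J) where
  /-- The values on the pieces. -/
  rel : ∀ ⦃U : C⦄, X.obj (op U) → M.obj.obj (op U) → L.obj.obj (op U) → Prop
  restrict : ∀ ⦃U V : C⦄ (f : V ⟶ U) {x m d}, rel x m d →
    rel (X.map f.op x) (M.obj.map f.op m) (L.obj.map f.op d)
  top : ∀ ⦃U : C⦄ (x : X.obj (op U)), rel x ⊤ ⊤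
  inf : ∀ ⦃U : C⦄ {x : X.obj (op U)} {m m' d d'}, rel x m d → rel x m' d' →
    rel x (m ⊓ m') (d ⊓ d')
  mono : ∀ ⦃U : C⦄ {x : X.obj (op U)} {m m' d}, m ≤ m' → rel x m d → rel x m' d
  join : ∀ ⦃U : C⦄ {Φ : SubFamily (M.obj ⋙ forget Frm) U} {x s d b}, IsJoin M.obj Φ s →
    rel x s d → (∀ ⦃V : C⦄ (f : V ⟶ U) (m d'), m ∈ Φ.carrier f → rel (X.map f.op x) m d' →
      p.app (X.map f.op x) ⊓ d' ≤ L.obj.map f.op b) → p.app x ⊓ d ≤ b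

namespace Gluing

variable {p} {M : IFrame J} (G : p.Gluing M)

/-- The pieces of the value at `m`. -/
def pieces {U : C} (m : M.obj.obj (op U)) : SubFamily (L.obj ⋙ forget Frm) U where
  carrier V f := {c | ∃ x d, G.rel x (M.obj.map f.op m) d ∧ c = p.app x ⊓ d}
  restrict := by
    rintro V f _ ⟨x, d, h, rfl⟩ W g
    refine ⟨_, _, by simpa using G.restrict g h, ?_⟩
    rw [p.nat]
    exact map_inf (L.obj.map g.op).hom _ _

/-- The value at `m` of the glued homomorphism. -/
noncomputable def val {U : C} (m : M.obj.obj (op U)) : L.obj.obj (op U) := L.sup (G.pieces m)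

theorem map_val_le_iff {U V : C} (f : V ⟶ U) {m : M.obj.obj (op U)} {b : L.obj.obj (op V)} :
    L.obj.map f.op (G.val m) ≤ b ↔ ∀ ⦃W : C⦄ (g : W ⟶ V) (x : X.obj (op W)) (d),
      G.rel x (M.obj.map (g ≫ f).op m) d → p.app x ⊓ d ≤ L.obj.map g.op b := by
  refine (L.isJoin_sup (G.pieces m) f b).trans ?_
  constructor
  · exact fun H W g x d h => H g _ ⟨x, d, h, rfl⟩
  · rintro H W g _ ⟨x, d, h, rfl⟩
    exact H g x d h

theorem val_le_iff {U : C} {m b} : G.val (U := U) m ≤ b ↔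
    ∀ ⦃V : C⦄ (f : V ⟶ U) (x : X.obj (op V)) (d),
      G.rel x (M.obj.map f.op m) d → p.app x ⊓ d ≤ L.obj.map f.op b := by
  simpa using G.map_val_le_iff (𝟙 U) (m := m) (b := b)

theorem le_val {U : C} {m : M.obj.obj (op U)} {x : X.obj (op U)} {d} (h : G.rel x m d) :
    p.app x ⊓ d ≤ G.val m := by
  simpa using G.val_le_iff.1 le_rfl (𝟙 U) x d (by simpa using h)

theorem val_map {U V : C} (f : V ⟶ U) (m : M.obj.obj (op U)) :
    G.val (M.obj.map f.op m) = L.obj.map f.op (G.val m) := by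
  refine eq_of_forall_ge_iff fun b => ?_
  rw [G.map_val_le_iff, G.val_le_iff]
  simp only [map_map_frm]

theorem val_mono {U : C} {m m' : M.obj.obj (op U)} (h : m ≤ m') : G.val m ≤ G.val m' :=
  G.val_le_iff.2 fun V f x d hd => by
    rw [← G.val_map]
    exact G.le_val (G.mono (frm_map_mono _ f h) hd)

/-- Distributivity reduces this to two pieces indexed by `x` and `x'`. On their overlap the indices
agree, and then the field `inf`, which concerns a single index, applies. -/
theorem val_inf {U : C} (m m' : M.obj.obj (op U)) : G.val (m ⊓ m') = G.val m ⊓ G.val m' := by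
  apply le_antisymm (le_inf (G.val_mono inf_le_left) (G.val_mono inf_le_right))
  refine (IFrame.inf_le_iff_of_isJoin (L.isJoin_sup (G.pieces m))).2 ?_
  rintro V f _ ⟨x, d, h, rfl⟩
  rw [inf_comm, ← G.val_map, ← G.val_map]
  refine (IFrame.inf_le_iff_of_isJoin (L.isJoin_sup (G.pieces _))).2 ?_
  rintro W g _ ⟨x', d', h', rfl⟩
  rw [map_inf, ← p.nat, ← G.val_map]
  rw [show p.app x' ⊓ d' ⊓ (p.app (X.map g.op x) ⊓ L.obj.map g.op d) =
    p.app x' ⊓ p.app (X.map g.op x) ⊓ (d' ⊓ L.obj.map g.op d) by ac_rfl]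
  refine p.inf_inf_le fun W' k hk => ?_
  rw [← G.val_map]
  apply G.le_val
  rw [map_inf, map_inf, map_inf, map_inf]
  refine G.mono (le_of_eq (inf_comm _ _)) (G.inf (G.restrict k h') ?_)
  rw [hk]
  exact G.restrict k (G.restrict g h)

/-- The glued frame homomorphism. -/
noncomputable def hom : M ⟶ L :=
  IFrame.Hom.ofFun (fun _ m => G.val m) (fun _ _ f m => G.val_map f m)
    (fun U => top_le_iff.1 (p.total _ fun V f x => by
      rw [← G.val_map, map_top]
      simpa using G.le_val (G.top x)))
    (fun _ m m' => G.val_inf m m')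
    (fun U Φ s b h H => G.val_le_iff.2 fun V f x d hd =>
      G.join (h.pull f) hd fun W g m d' hm hd' => by
        rw [map_map_frm]
        exact (G.le_val hd').trans (H _ m hm))

end Gluing

end IPartition

end InternalFrames

/-! ### Maps to discrete spaces, and the frame `L ^ X`. -/

section Products

variable {C : Type u} [SmallCategory C] {J : GrothendieckTopology C}

section Power

variable {X : Sheaf J (Type u)} {L : IFrame J} {U V : C}

/-- The open point `{x}`, as a local family. -/
def pt (x : X.obj.obj (op U)) : LocalFamily J X.obj U := point X x

theorem mem_pt {x : X.obj.obj (op U)} {f : V ⟶ U} {z : X.obj.obj (op V)} :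
    z ∈ (pt x).carrier f ↔ z = X.obj.map f.op x :=
  Iff.rfl

theorem map_point (f : V ⟶ U) (x : X.obj.obj (op U)) :
    (power X).obj.map f.op (point X x) = point X (X.obj.map f.op x) := by
  change (pt x).pull f = pt (X.obj.map f.op x)
  refine LocalFamily.ext_mem fun W g z => ?_
  rw [LocalFamily.mem_pull, mem_pt, mem_pt, map_map_type]

theorem point_le_iff {x : X.obj.obj (op U)} {T : LocalFamily J X.obj U} :
    pt x ≤ T ↔ x ∈ T.carrier (𝟙 U) := by
  constructor
  · exact fun h => h (𝟙 U) x (by rw [mem_pt]; simp)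
  · rintro h V f z rfl
    simpa using T.restrict (𝟙 U) x h f

/-- The points of a subsheaf. -/
def pointsFamily (T : LocalFamily J X.obj U) : SubFamily ((power X).obj ⋙ forget Frm) U where
  carrier V f := {c | ∃ x : X.obj.obj (op V), x ∈ T.carrier f ∧ c = point X x}
  restrict := by
    rintro V f _ ⟨x, hx, rfl⟩ W g
    exact ⟨_, T.restrict f x hx g, map_point g x⟩

/-- This is where discreteness is used: a subsheaf is the union of its points, so a map to `X` is
determined by the inverse images of points. -/
theorem isJoin_pointsFamily (T : LocalFamily J X.obj U) :
    IsJoin (power X).obj (pointsFamily T) T := by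
  refine .of_le_iff ?_ ?_
  · rintro V f _ ⟨x, hx, rfl⟩
    exact point_le_iff (T := T.pull f).2 (by
      rw [LocalFamily.mem_pull]
      simpa using hx)
  · intro V f (b : LocalFamily J X.obj V) H W g x hx
    have := point_le_iff (T := b.pull g).1 (H g _ ⟨x, hx, rfl⟩)
    rw [LocalFamily.mem_pull] at this
    simpa using this

theorem ap_power_le_iff (φ : power X ⟶ L) {T : LocalFamily J X.obj U} {b : L.obj.obj (op U)} :
    IFrame.ap φ (U := U) T ≤ b ↔ ∀ ⦃V : C⦄ (f : V ⟶ U) (x : X.obj.obj (op V)),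
      x ∈ T.carrier f → IFrame.ap φ (point X x) ≤ L.obj.map f.op b := by
  refine (IFrame.ap_isJoin_le_iff φ (isJoin_pointsFamily T)).trans ?_
  constructor
  · exact fun H V f x hx => H f _ ⟨x, hx, rfl⟩
  · rintro H V f _ ⟨x, hx, rfl⟩
    exact H f x hx

theorem power_hom_ext {φ ψ : power X ⟶ L}
    (h : ∀ ⦃U : C⦄ (x : X.obj.obj (op U)),
      IFrame.ap φ (point X x) = IFrame.ap ψ (point X x)) : φ = ψ := by
  refine IFrame.hom_ext fun U T => eq_of_forall_ge_iff fun b => ?_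
  refine (ap_power_le_iff φ).trans (Iff.trans ?_ (ap_power_le_iff ψ).symm)
  simp only [h]

/-- The partition of a locale given by a map to a discrete space. -/
def IPartition.ofHom (φ : power X ⟶ L) : IPartition X.obj L where
  app _ x := IFrame.ap φ (point X x)
  nat _ _ f x :=
    (congrArg (IFrame.ap φ) (map_point f x)).symm.trans (IFrame.ap_map φ f _)
  total U b h := by
    rw [← map_top (φ.hom.app (op U)).hom]
    exact (ap_power_le_iff φ (T := ⊤)).2 fun V f x _ => h f x
  disjoint U x x' b h := by
    refine (IFrame.ap_inf φ _ _).symm.trans_le ?_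
    refine (ap_power_le_iff φ (T := pt x ⊓
      pt x')).2 ?_
    -- An element of both singletons is the restriction of `x` to a stage where `x` and `x'` agree.
    rintro V f _ ⟨rfl, h'⟩
    exact h f h'

/-- A partition determines a map to a discrete space. -/
def powerGluing (p : IPartition X.obj L) : p.Gluing (power X) where
  -- The value on the piece `x` is the truth value of membership, so every `d` is admitted and the
  -- largest, `⊤`, decides.
  rel := fun U x (m : LocalFamily J X.obj U) _ => x ∈ m.carrier (𝟙 U)
  restrict := fun U V f x (m : LocalFamily J X.obj U) d h => by
    change _ ∈ (m.pull f).carrier (𝟙 V)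
    rw [LocalFamily.mem_pull]
    simpa using m.restrict (𝟙 U) x h f
  top _ _ := trivial
  inf _ _ _ _ _ _ h h' := ⟨h, h'⟩
  mono _ _ _ _ _ h h' := h _ _ h'
  join U Φ x s d b hs h H := by
    -- Joins are unique, so `s` is the explicit union, and membership in it means membership in some
    -- member of `Φ` on a cover.
    rw [hs.unique (isJoin_unionFamily X.obj Φ)] at h
    obtain ⟨R, hR, h⟩ := h
    refine L.le_of_cover hR fun V f hf => ?_
    obtain ⟨T, hT, hx⟩ := h f hf
    rw [map_inf, ← p.nat]
    exact H f T _ (Φ.mem_congr (Category.comp_id f) hT) hx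

theorem powerGluing_val_point (p : IPartition X.obj L) (x : X.obj.obj (op U)) :
    (powerGluing p).val (point X x) = p.app x := by
  apply le_antisymm
  · refine (powerGluing p).val_le_iff.2 fun V f x' d h => ?_
    rw [map_point] at h
    have e : x' = X.obj.map f.op x := by
      have h : x' ∈ (pt (X.obj.map f.op x)).carrier (𝟙 V) := h
      simpa [mem_pt] using h
    rw [e, p.nat]
    exact inf_le_left
  · have h : (powerGluing p).rel x (point X x) ⊤ := by
      change x ∈ (pt x).carrier (𝟙 U)
      rw [mem_pt]
      simp
    simpa using (powerGluing p).le_val h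

end Power

/-- A section over `U` of the internal power `L ^ X`. -/
@[ext]
structure PowSection (L : IFrame J) (X : Cᵒᵖ ⥤ Type u) (U : C) where
  /-- The values. -/
  app : ∀ ⦃V : C⦄ (_ : V ⟶ U), X.obj (op V) → L.obj.obj (op V)
  nat : ∀ ⦃V W : C⦄ (f : V ⟶ U) (g : W ⟶ V) (x : X.obj (op V)),
    app (g ≫ f) (X.map g.op x) = L.obj.map g.op (app f x)

namespace PowSection

variable {L : IFrame J} {X : Cᵒᵖ ⥤ Type u} {U V : C}

theorem ext_app {s t : PowSection L X U}
    (h : ∀ ⦃V : C⦄ (f : V ⟶ U) (x : X.obj (op V)), s.app f x = t.app f x) : s = t := by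
  apply PowSection.ext
  funext V f x
  exact h f x

instance : PartialOrder (PowSection L X U) where
  le s t := ∀ ⦃V : C⦄ (f : V ⟶ U) (x : X.obj (op V)), s.app f x ≤ t.app f x
  le_refl _ _ _ _ := le_rfl
  le_trans _ _ _ h h' _ f x := (h f x).trans (h' f x)
  le_antisymm _ _ h h' := ext_app fun _ f x => le_antisymm (h f x) (h' f x)

instance : SupSet (PowSection L X U) where
  sSup S :=
    { app := fun V f x => sSup ((fun s => s.app f x) '' S)
      nat := fun V W f g x => by
        have e : L.obj.map g.op (sSup ((fun s => s.app f x) '' S)) =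
            sSup ((L.obj.map g.op) '' ((fun s => s.app f x) '' S)) :=
          map_sSup (L.obj.map g.op).hom _
        rw [e, Set.image_image]
        simp only [nat] }

/-- Everything but the infima of sets is computed pointwise. -/
instance : CompleteLattice (PowSection L X U) where
  __ := completeLatticeOfSup (PowSection L X U) fun S =>
    ⟨by
      intro s hs V f x
      exact le_sSup (Set.mem_image_of_mem (fun s : PowSection L X U => s.app f x) hs),
      fun t ht _ f x => sSup_le (by
      rintro _ ⟨s, hs, rfl⟩
      exact ht hs f x)⟩
  inf s t := ⟨fun _ f x => s.app f x ⊓ t.app f x, fun V W f g x => by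
    rw [s.nat, t.nat, map_inf]⟩
  inf_le_left _ _ _ _ _ := inf_le_left
  inf_le_right _ _ _ _ _ := inf_le_right
  le_inf _ _ _ h h' _ f x := le_inf (h f x) (h' f x)
  top := ⟨fun _ _ _ => ⊤, fun V W f g x => (map_top (L.obj.map g.op).hom).symm⟩
  le_top _ _ _ _ := le_top

theorem inf_app (s t : PowSection L X U) (f : V ⟶ U) (x : X.obj (op V)) :
    (s ⊓ t).app f x = s.app f x ⊓ t.app f x := rfl

theorem sSup_app (S : Set (PowSection L X U)) (f : V ⟶ U) (x : X.obj (op V)) :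
    (sSup S).app f x = sSup ((fun s => s.app f x) '' S) := rfl

instance : Order.Frame (PowSection L X U) := Order.Frame.ofMinimalAxioms
  { inf_sSup_le_iSup_inf := by
      intro t S V f x
      rw [inf_app, sSup_app, inf_sSup_eq]
      refine iSup₂_le ?_
      rintro _ ⟨s, hs, rfl⟩
      have h : t ⊓ s ≤ ⨆ b ∈ S, t ⊓ b := le_iSup₂_of_le s hs le_rfl
      exact h f x }

/-- Restriction of sections. -/
def pull {U' : C} (h : U' ⟶ U) (s : PowSection L X U) : PowSection L X U' where
  app _ f := s.app (f ≫ h)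
  nat _ _ f g x := by
    rw [Category.assoc, s.nat]

theorem pull_app {U' : C} (h : U' ⟶ U) (s : PowSection L X U) (f : V ⟶ U') (x : X.obj (op V)) :
    (s.pull h).app f x = s.app (f ≫ h) x := rfl

theorem pull_app_id (h : V ⟶ U) (s : PowSection L X U) (x : X.obj (op V)) :
    (s.pull h).app (𝟙 V) x = s.app h x := by
  rw [pull_app, Category.id_comp]

/-- Restriction is a frame homomorphism. -/
def pullHom {U' : C} (h : U' ⟶ U) : FrameHom (PowSection L X U) (PowSection L X U') where
  toFun := pull h
  map_inf' _ _ := rfl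
  map_top' := rfl
  map_sSup' S := ext_app fun V f x => by
    rw [pull_app, sSup_app, sSup_app, Set.image_image]
    rfl

end PowSection

variable (L : IFrame J) (X : Cᵒᵖ ⥤ Type u) {U V : C}

/-- The presheaf of sections of `L ^ X`. -/
def powFrm : Cᵒᵖ ⥤ Frm.{u} where
  obj U := Frm.of (PowSection L X U.unop)
  map h := Frm.ofHom (PowSection.pullHom h.unop)
  map_id U := by
    apply Frm.hom_ext
    refine DFunLike.ext _ _ fun (s : PowSection L X U.unop) => PowSection.ext_app fun V f x => ?_
    change s.app (f ≫ 𝟙 _) x = s.app f x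
    rw [Category.comp_id]
  map_comp {U _ _} h k := by
    apply Frm.hom_ext
    refine DFunLike.ext _ _ fun (s : PowSection L X U.unop) => PowSection.ext_app fun V f x => ?_
    change s.app (f ≫ k.unop ≫ h.unop) x = s.app ((f ≫ k.unop) ≫ h.unop) x
    rw [Category.assoc]

theorem powFrm_isSheaf : Presieve.IsSheaf J (powFrm L X ⋙ forget Frm) := by
  intro U R hR y hy
  rw [Presieve.compatible_iff_sieveCompatible] at hy
  let y : ∀ ⦃V : C⦄ (f : V ⟶ U), R f → PowSection L X V := fun V f h => y f h
  have hy : ∀ ⦃V W : C⦄ (f : V ⟶ U) (g : W ⟶ V) (h : R f) (k : W ⟶ U) (h' : R k) (x),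
      k = g ≫ f → (y k h').app (𝟙 W) x = (y f h).app g x := by
    rintro V W f g h _ h' x rfl
    have e : y (g ≫ f) h' = (y f h).pull g := hy f g h
    rw [e, PowSection.pull_app_id]
  have hR' : ∀ ⦃V : C⦄ (f : V ⟶ U), R.pullback f ∈ J V := fun V f => J.pullback_stable f hR
  -- Each value is glued separately in `L`, over the pullback of the sieve; naturality of the glued
  -- values then follows from separatedness.
  have amal : ∀ ⦃V : C⦄ (f : V ⟶ U) (x : X.obj (op V)), ∃ c : L.obj.obj (op V),
      ∀ ⦃W : C⦄ (g : W ⟶ V) (h : R (g ≫ f)),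
        L.obj.map g.op c = (y (g ≫ f) h).app (𝟙 W) (X.map g.op x) := by
    intro V f x
    let z : Presieve.FamilyOfElements (L.obj ⋙ forget Frm) (R.pullback f).arrows :=
      fun W g h => (y (g ≫ f) h).app (𝟙 W) (X.map g.op x)
    have hz : z.Compatible := by
      rw [Presieve.compatible_iff_sieveCompatible]
      intro W W' g k h
      have h1 := hy (g ≫ f) k h ((k ≫ g) ≫ f) (by simpa using R.downward_closed h k)
        (X.map (k ≫ g).op x) (by simp)
      have h2 := (y (g ≫ f) h).nat (𝟙 W) k (X.map g.op x)
      rw [Category.comp_id, map_map_type] at h2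
      exact h1.trans h2
    obtain ⟨c, hc, -⟩ := L.isSheaf _ (hR' f) z hz
    exact ⟨c, hc⟩
  choose c hc using amal
  have sep : ∀ ⦃V : C⦄ (f : V ⟶ U) (a b : L.obj.obj (op V)),
      (∀ ⦃W : C⦄ (g : W ⟶ V), R (g ≫ f) → L.obj.map g.op a = L.obj.map g.op b) → a = b :=
    fun V f a b h => (L.isSheaf _ (hR' f)).isSeparatedFor.ext fun W g hg => h g hg
  let s : PowSection L X U :=
    { app := c
      nat := fun V W f g x => by
        refine sep (g ≫ f) _ _ fun W' k hk => ?_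
        have hk' : R ((k ≫ g) ≫ f) := by simpa using hk
        rw [hc (g ≫ f) _ k hk, map_map_frm, hc f x (k ≫ g) hk', map_map_type]
        simp }
  have hs : ∀ ⦃V : C⦄ (f : V ⟶ U) (h : R f), s.pull f = y f h := by
    intro V f h
    refine PowSection.ext_app fun W g x => ?_
    have h1 := hc (g ≫ f) x (𝟙 W) (by simpa using R.downward_closed h g)
    rw [hy f g h _ _ _ (by simp)] at h1
    simpa [PowSection.pull_app] using h1
  refine ⟨s, hs, fun t ht => ?_⟩
  change PowSection L X U at t
  have ht' : ∀ ⦃V : C⦄ (f : V ⟶ U), R f → t.pull f = s.pull f :=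
    fun V f h => (ht f h).trans (hs f h).symm
  have e : t = s := by
    refine PowSection.ext_app fun V f x => sep f _ _ fun W g hg => ?_
    rw [← t.nat, ← s.nat, ← t.pull_app_id, ht' _ hg, s.pull_app_id]
  exact e

variable {L X}

/-- The values at `x` of a family of sections of `L ^ X`. -/
def evalFamily (Φ : SubFamily (powFrm L X ⋙ forget Frm) U) (f : V ⟶ U) (x : X.obj (op V)) :
    SubFamily (L.obj ⋙ forget Frm) V where
  carrier W g := {c | ∃ m : PowSection L X W, m ∈ Φ.carrier (g ≫ f) ∧
    c = m.app (𝟙 W) (X.map g.op x)}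
  restrict := by
    rintro W g _ ⟨m, hm, rfl⟩ W' k
    refine ⟨m.pull k, ?_, ?_⟩
    · have := Φ.restrict _ _ hm k
      rw [Category.assoc]
      exact this
    · rw [PowSection.pull_app_id]
      have := m.nat (𝟙 W) k (X.map g.op x)
      rw [Category.comp_id, map_map_type] at this
      exact this.symm

/-- The pointwise join of a family of sections of `L ^ X`. -/
noncomputable def powSup (Φ : SubFamily (powFrm L X ⋙ forget Frm) U) : PowSection L X U where
  app _ f x := L.sup (evalFamily Φ f x)
  nat V W f g x := by
    refine IsJoin.unique (L.isJoin_sup _) ?_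
    have e : evalFamily Φ (g ≫ f) (X.map g.op x) = (evalFamily Φ f x).pull g := by
      apply SubFamily.ext
      funext W' k
      simp [evalFamily, SubFamily.pull]
    rw [e]
    exact (L.isJoin_sup _).pull g

theorem isJoin_powSup (Φ : SubFamily (powFrm L X ⋙ forget Frm) U) :
    IsJoin (powFrm L X) Φ (powSup Φ) := by
  refine .of_le_iff ?_ ?_
  · intro V f (a : PowSection L X V) ha W g x
    change a.app g x ≤ (powSup Φ).app (g ≫ f) x
    have hm : (a.pull g) ∈ Φ.carrier (g ≫ f) := Φ.restrict _ _ ha g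
    have := (L.isJoin_sup (evalFamily Φ (g ≫ f) x)).le (f := 𝟙 W)
      (a := (a.pull g).app (𝟙 W) x) ⟨a.pull g, by simpa using hm, by simp⟩
    rw [PowSection.pull_app_id, op_id, CategoryTheory.Functor.map_id] at this
    exact this
  · intro V f (b : PowSection L X V) H W g x
    change (powSup Φ).app (g ≫ f) x ≤ b.app g x
    refine (L.isJoin_sup (evalFamily Φ (g ≫ f) x)).le_iff.2 ?_
    rintro W' k _ ⟨m, hm, rfl⟩
    rw [← b.nat]
    have := H (k ≫ g) m (Φ.mem_congr (Category.assoc _ _ _).symm hm) (𝟙 W') (X.map k.op x)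
    change _ ≤ (b.pull (k ≫ g)).app (𝟙 W') _ at this
    rwa [PowSection.pull_app_id] at this

/-- Joins are unique and the pointwise join is one, so evaluation respects every join of `L ^ X`. -/
theorem IsJoin.app {Φ : SubFamily (powFrm L X ⋙ forget Frm) U} {s : PowSection L X U}
    (h : IsJoin (powFrm L X) Φ s) (f : V ⟶ U) (x : X.obj (op V)) :
    IsJoin L.obj (evalFamily Φ f x) (s.app f x) := by
  have e : s = powSup Φ := h.unique (isJoin_powSup Φ)
  rw [e]
  exact L.isJoin_sup _

variable (L X) in
/-- The frame `L ^ X`. -/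
def powFrame : IFrame J where
  obj := powFrm L X
  isSheaf := powFrm_isSheaf L X
  exists_isJoin Φ := ⟨_, isJoin_powSup Φ⟩
  inf_isJoin {U} Φ s t h := by
    change PowSection L X U at s t
    refine .of_le_iff ?_ ?_
    · rintro V f _ ⟨a, ha, rfl⟩
      exact (inf_le_inf_right _ (h.le ha)).trans_eq rfl
    · intro V f (b : PowSection L X V) H W g x
      change s.app (g ≫ f) x ⊓ t.app (g ≫ f) x ≤ b.app g x
      refine (IFrame.inf_le_iff_of_isJoin (h.app (g ≫ f) x)).2 ?_
      rintro W' k _ ⟨m, hm, rfl⟩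
      have h1 := H (k ≫ g) (m ⊓ t.pull ((k ≫ g) ≫ f))
        ⟨m, Φ.mem_congr (Category.assoc _ _ _).symm hm, rfl⟩ (𝟙 W')
        (X.map k.op x)
      change m.app _ _ ⊓ (t.pull ((k ≫ g) ≫ f)).app _ _ ≤ (b.pull (k ≫ g)).app (𝟙 W') _ at h1
      rw [PowSection.pull_app_id, PowSection.pull_app_id, Category.assoc,
        t.nat, b.nat] at h1
      exact h1

variable (L) in
/-- The truth value of `x = x'` in `L`. -/
def eqFamily (x x' : X.obj (op U)) : SubFamily (L.obj ⋙ forget Frm) U where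
  carrier V f := {_c | X.map f.op x = X.map f.op x'}
  restrict := by
    intro V f _ (h : _ = _) W g
    change _ = _
    rw [← map_map_type, h, map_map_type]

variable (L) in
/-- The truth value of `x = x'` in `L`. -/
noncomputable def eqv (x x' : X.obj (op U)) : L.obj.obj (op U) := L.sup (eqFamily L x x')

theorem map_eqv (f : V ⟶ U) (x x' : X.obj (op U)) :
    L.obj.map f.op (eqv L x x') = eqv L (X.map f.op x) (X.map f.op x') := by
  refine IsJoin.unique ((L.isJoin_sup _).pull f) ?_
  have e : (eqFamily L x x').pull f = eqFamily L (X.map f.op x) (X.map f.op x') := by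
    apply SubFamily.ext
    funext W g
    simp [eqFamily, SubFamily.pull]
  rw [e]
  exact L.isJoin_sup _

/-- `eqv` is the join of everything that lives over stages where the two elements agree, so meeting
with it amounts to assuming their equality. -/
theorem eqv_inf_le_iff {x x' : X.obj (op U)} {t b : L.obj.obj (op U)} : eqv L x x' ⊓ t ≤ b ↔
    ∀ ⦃V : C⦄ (f : V ⟶ U), X.map f.op x = X.map f.op x' → L.obj.map f.op t ≤ L.obj.map f.op b := by
  refine (IFrame.inf_le_iff_of_isJoin (L.isJoin_sup _)).trans ?_
  constructor
  · exact fun H V f h => by simpa using H f ⊤ h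
  · exact fun H V f a h => inf_le_right.trans (H f h)

theorem eqv_self (x : X.obj (op U)) : eqv L x x = ⊤ := by
  have := (L.isJoin_sup (eqFamily L x x)).le (f := 𝟙 U) (a := ⊤) rfl
  rw [op_id, CategoryTheory.Functor.map_id] at this
  exact top_le_iff.1 this

/-- Frame homomorphisms preserve internal joins, so the image of the truth value of an equation
still acts as the assumption of that equation. -/
theorem ap_eqv_inf_le_iff {M : IFrame J} (φ : L ⟶ M) {x x' : X.obj (op U)}
    {t b : M.obj.obj (op U)} : IFrame.ap φ (eqv L x x') ⊓ t ≤ b ↔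
    ∀ ⦃V : C⦄ (f : V ⟶ U), X.map f.op x = X.map f.op x' → M.obj.map f.op t ≤ M.obj.map f.op b := by
  have h := IFrame.Hom.isJoin φ _ _ (L.isJoin_sup (eqFamily L x x'))
  refine (IFrame.inf_le_iff_of_isJoin h).trans ?_
  constructor
  · intro H V f h
    have := H f _ ⟨⊤, h, rfl⟩
    rwa [map_top, top_inf_eq] at this
  · rintro H V f _ ⟨a, h, rfl⟩
    exact inf_le_right.trans (H f h)

variable (L X) in
/-- The partition of `L ^ X` given by the projection of `Z × X` to `X`. -/
noncomputable def diagonal : IPartition X (powFrame L X) where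
  app U x := show PowSection L X U from
    { app := fun V f x' => eqv L x' (X.map f.op x)
      nat := fun V W f g x' => by
        rw [map_eqv, map_map_type] }
  nat U V f x := PowSection.ext_app (L := L) (X := X) fun W g x' => by
    change eqv L x' (X.map g.op (X.map f.op x)) = eqv L x' (X.map (g ≫ f).op x)
    rw [map_map_type]
  total U b h := by
    change PowSection L X U at b
    intro V f x
    have : eqv L x (X.map (𝟙 V).op x) ≤ b.app (𝟙 V ≫ f) x := h f x (𝟙 V) x
    rw [op_id, CategoryTheory.Functor.map_id] at this
    change ⊤ ≤ b.app f x
    simpa [eqv_self] using this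
  disjoint U x x' b h := by
    change PowSection L X U at b
    intro V f z
    change eqv L z (X.map f.op x) ⊓ eqv L z (X.map f.op x') ≤ b.app f z
    refine eqv_inf_le_iff.2 fun W g hg => ?_
    -- The first equation identifies `z` with `x`. A second one, between `x` and `x'`, is extracted
    -- by writing the remaining `eqv` as a meet with `⊤`.
    rw [map_eqv, hg, ← b.nat, ← inf_top_eq (eqv L _ _)]
    refine eqv_inf_le_iff.2 fun W' k hk => ?_
    rw [map_map_type, map_map_type, map_map_type] at hk
    have : eqv L (X.map k.op (X.map g.op z)) (X.map (𝟙 W').op (X.map (k ≫ g ≫ f).op x)) ≤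
      b.app (𝟙 W' ≫ k ≫ g ≫ f) (X.map k.op (X.map g.op z)) := h (k ≫ g ≫ f) (by simpa using hk)
        (𝟙 W') (X.map k.op (X.map g.op z))
    rw [hg] at this
    rw [← b.nat, hg]
    simpa [eqv_self] using this

variable (L X) in
/-- Pulling back opens along the projection of `Z × X` to `Z`. -/
def constHom : L ⟶ powFrame L X :=
  IFrame.Hom.ofFun (L := powFrame L X)
    (fun U a => show PowSection L X U from
      { app := fun V f _ => L.obj.map f.op a
        nat := fun V W f g _ => (map_map_frm L.obj f g a).symm })
    (fun U V f a => PowSection.ext_app (L := L) (X := X) fun W g _ => map_map_frm L.obj f g a)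
    (fun U => PowSection.ext_app (L := L) (X := X) fun W g _ => map_top (L.obj.map g.op).hom)
    (fun U a b => PowSection.ext_app (L := L) (X := X) fun W g _ =>
      map_inf (L.obj.map g.op).hom a b)
    (fun U Φ s b h H => by
      change PowSection L X U at b
      intro V f x
      refine (h.pull f).le_iff.2 fun W g a ha => ?_
      have h1 : L.obj.map (𝟙 W).op a ≤ b.app (𝟙 W ≫ g ≫ f) (X.map g.op x) :=
        H (g ≫ f) a ha (𝟙 W) (X.map g.op x)
      rw [← b.nat]
      simpa using h1)

/-- The data for the map to `Z × X` induced by maps to `Z` and to `X`. -/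
def liftGluing {T : IFrame J} (a : L ⟶ T) (p : IPartition X T) : p.Gluing (powFrame L X) where
  -- With this relation the glued value of `m` is the join over `x` of the member at `x` met with
  -- the image under `a` of the value of `m` at `x`.
  rel := fun U x (m : PowSection L X U) d => d ≤ IFrame.ap a (m.app (𝟙 U) x)
  restrict := fun U V f x (m : PowSection L X U) d h => by
    change _ ≤ IFrame.ap a ((m.pull f).app (𝟙 V) (X.map f.op x))
    have := m.nat (𝟙 U) f x
    rw [Category.comp_id] at this
    rw [m.pull_app_id, this, IFrame.ap_map]
    exact frm_map_mono _ f h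
  top U x := by
    change _ ≤ IFrame.ap a ⊤
    rw [IFrame.ap_top]
  inf := fun U x (m m' : PowSection L X U) d d' h h' => by
    change _ ≤ IFrame.ap a (m.app (𝟙 U) x ⊓ m'.app (𝟙 U) x)
    rw [IFrame.ap_inf]
    exact inf_le_inf h h'
  mono U x m m' d h h' := h'.trans (IFrame.ap_mono a (h (𝟙 U) x))
  join U Φ x s d b hs h H := by
    change PowSection L X U at s
    refine (inf_le_inf_left _ h).trans ?_
    rw [inf_comm]
    refine (IFrame.inf_le_iff_of_isJoin (IFrame.Hom.isJoin a _ _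
      (IsJoin.app (s := s) hs (𝟙 U) x))).2 ?_
    rintro V f _ ⟨_, ⟨m, hm, rfl⟩, rfl⟩
    rw [inf_comm, ← p.nat]
    exact H f m _ (Φ.mem_congr (Category.comp_id f) hm) le_rfl

end Products

/-! ### The product of a locale with a discrete space. -/

section ProductFans

variable {C : Type u} [SmallCategory C] {J : GrothendieckTopology C}
variable {L T : IFrame J} {X : Sheaf J (Type u)} {U V : C}

/-- A section of `L` as a constant section of `L ^ X`. -/
def constSection (a : L.obj.obj (op U)) (X : Cᵒᵖ ⥤ Type u) : PowSection L X U :=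
  IFrame.ap (constHom L X) a

theorem constSection_app (a : L.obj.obj (op U)) {X : Cᵒᵖ ⥤ Type u} (f : V ⟶ U)
    (x : X.obj (op V)) : (constSection a X).app f x = L.obj.map f.op a := rfl

/-- The section `x' ↦ (x' = x)` of `L ^ X`. -/
noncomputable def diagSection (L : IFrame J) {X : Cᵒᵖ ⥤ Type u} (x : X.obj (op U)) :
    PowSection L X U :=
  (diagonal L X).app x

theorem diagSection_app {X : Cᵒᵖ ⥤ Type u} (x : X.obj (op U)) (f : V ⟶ U) (x' : X.obj (op V)) :
    (diagSection L x).app f x' = eqv L x' (X.map f.op x) := rfl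

/-- `diagSection L x` is the open `Z × {x}` of the product, and on it a section only remembers its
value at `x`. -/
theorem diagSection_inf_le_iff {X : Cᵒᵖ ⥤ Type u} {x : X.obj (op U)} {s t : PowSection L X U} :
    diagSection L x ⊓ s ≤ t ↔ s.app (𝟙 U) x ≤ t.app (𝟙 U) x := by
  constructor
  · intro h
    have := h (𝟙 U) x
    rw [PowSection.inf_app, diagSection_app, op_id, CategoryTheory.Functor.map_id] at this
    simpa [eqv_self] using this
  · intro h V f x'
    rw [PowSection.inf_app, diagSection_app]
    refine eqv_inf_le_iff.2 fun W g hg => ?_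
    rw [map_map_type] at hg
    rw [← s.nat, ← t.nat, hg]
    have hs := s.nat (𝟙 U) (g ≫ f) x
    have ht := t.nat (𝟙 U) (g ≫ f) x
    rw [Category.comp_id] at hs ht
    rw [hs, ht]
    exact frm_map_mono _ _ h

/-- Slice by slice, every section is thus a constant one. This gives uniqueness of maps into the
product and, later, the description of evaluation on a slice. -/
theorem diagSection_inf_constSection {X : Cᵒᵖ ⥤ Type u} (x : X.obj (op U))
    (s : PowSection L X U) :
    diagSection L x ⊓ s = diagSection L x ⊓ constSection (s.app (𝟙 U) x) X := by
  have e : (constSection (s.app (𝟙 U) x) X).app (𝟙 U) x = s.app (𝟙 U) x := by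
    rw [constSection_app, op_id, CategoryTheory.Functor.map_id]
    rfl
  apply le_antisymm
  · exact le_inf inf_le_left (diagSection_inf_le_iff.2 e.ge)
  · exact le_inf inf_le_left (diagSection_inf_le_iff.2 e.le)

/-- The frame homomorphism of the projection from `Z × X` to `X`. -/
noncomputable def diagHom (L : IFrame J) (X : Sheaf J (Type u)) : power X ⟶ powFrame L X.obj :=
  (powerGluing (diagonal L X.obj)).hom

theorem ap_diagHom_point (x : X.obj.obj (op U)) :
    IFrame.ap (diagHom L X) (point X x) = diagSection L x :=
  powerGluing_val_point _ x

/-- The action of a frame homomorphism on sections of `L ^ X`. -/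
def powAp {X : Cᵒᵖ ⥤ Type u} (ψ : powFrame L X ⟶ T) (s : PowSection L X U) : T.obj.obj (op U) :=
  IFrame.ap ψ s

theorem map_powAp {X : Cᵒᵖ ⥤ Type u} (ψ : powFrame L X ⟶ T) (f : V ⟶ U)
    (s : PowSection L X U) : T.obj.map f.op (powAp ψ s) = powAp ψ (s.pull f) :=
  (IFrame.ap_map ψ f s).symm

theorem powAp_inf {X : Cᵒᵖ ⥤ Type u} (ψ : powFrame L X ⟶ T) (s t : PowSection L X U) :
    powAp ψ (s ⊓ t) = powAp ψ s ⊓ powAp ψ t :=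
  IFrame.ap_inf ψ s t

/-- The frame homomorphism of the map to `Z × X` induced by maps to `Z` and `X`. -/
noncomputable def liftHom (a : L ⟶ T) (b : power X ⟶ T) : powFrame L X.obj ⟶ T :=
  (liftGluing a (IPartition.ofHom b)).hom

theorem ap_liftHom_le_iff (a : L ⟶ T) (b : power X ⟶ T) {s : PowSection L X.obj U}
    {c : T.obj.obj (op U)} : powAp (liftHom a b) s ≤ c ↔
      ∀ ⦃V : C⦄ (f : V ⟶ U) (x : X.obj.obj (op V)),
        (IPartition.ofHom b).app x ⊓ IFrame.ap a (s.app f x) ≤ T.obj.map f.op c := by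
  refine (liftGluing a (IPartition.ofHom b)).val_le_iff.trans ?_
  constructor
  · exact fun H V f x => H f x _ (by
      change _ ≤ IFrame.ap a ((s.pull f).app (𝟙 V) x)
      rw [s.pull_app_id])
  · intro H V f x d hd
    change _ ≤ IFrame.ap a ((s.pull f).app (𝟙 V) x) at hd
    rw [s.pull_app_id] at hd
    exact (inf_le_inf_left _ hd).trans (H f x)

theorem point_inf_le_ap_liftHom (a : L ⟶ T) (b : power X ⟶ T) (s : PowSection L X.obj U)
    (x : X.obj.obj (op U)) : (IPartition.ofHom b).app x ⊓ IFrame.ap a (s.app (𝟙 U) x) ≤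
      powAp (liftHom a b) s :=
  (liftGluing a (IPartition.ofHom b)).le_val le_rfl

theorem constHom_liftHom (a : L ⟶ T) (b : power X ⟶ T) :
    constHom L X.obj ≫ liftHom a b = a := by
  refine IFrame.hom_ext fun U m => ?_
  change powAp (liftHom a b) (constSection m X.obj) = _
  apply le_antisymm
  · refine (ap_liftHom_le_iff a b).2 fun V f x => ?_
    rw [constSection_app, IFrame.ap_map]
    exact inf_le_right
  · refine (IPartition.ofHom b).le_of_forall fun V f x => ?_
    rw [← IFrame.ap_map, map_powAp]
    exact point_inf_le_ap_liftHom a b ((constSection m X.obj).pull f) x |>.trans_eq' (by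
      rw [PowSection.pull_app_id, constSection_app])

theorem diagHom_liftHom (a : L ⟶ T) (b : power X ⟶ T) :
    diagHom L X ≫ liftHom a b = b := by
  refine power_hom_ext fun U x => ?_
  refine (congrArg (IFrame.ap (liftHom a b)) (ap_diagHom_point x)).trans ?_
  change powAp (liftHom a b) (diagSection L x) = (IPartition.ofHom b).app x
  apply le_antisymm
  · refine (ap_liftHom_le_iff a b).2 fun V f x' => ?_
    rw [diagSection_app, inf_comm]
    refine (ap_eqv_inf_le_iff a).2 fun W g hg => ?_
    -- Where `x'` equals `x`, the member indexed by `x'` is the one indexed by `x`.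
    rw [← (IPartition.ofHom b).nat, ← (IPartition.ofHom b).nat, ← (IPartition.ofHom b).nat, hg]
  · have := point_inf_le_ap_liftHom a b (diagSection L x) x
    rw [diagSection_app, op_id, CategoryTheory.Functor.map_id] at this
    change _ ⊓ IFrame.ap a (eqv L x x) ≤ _ at this
    rw [eqv_self, IFrame.ap_top, inf_top_eq] at this
    exact this

/-- Over the member of the partition indexed by `x`, the map `ψ` sees a section only through its
value at `x`, where it is prescribed by `a`; and the members cover. -/
theorem eq_liftHom {a : L ⟶ T} {b : power X ⟶ T} (ψ : powFrame L X.obj ⟶ T)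
    (ha : constHom L X.obj ≫ ψ = a) (hb : diagHom L X ≫ ψ = b) : ψ = liftHom a b := by
  have key : ∀ ⦃U : C⦄ (s : PowSection L X.obj U) (x : X.obj.obj (op U)),
      (IPartition.ofHom b).app x ⊓ powAp ψ s =
        (IPartition.ofHom b).app x ⊓ IFrame.ap a (s.app (𝟙 U) x) := by
    intro U s x
    have e : (IPartition.ofHom b).app x = powAp ψ (diagSection L x) := by
      rw [← hb]
      exact congrArg (IFrame.ap ψ (U := U)) (ap_diagHom_point x)
    have e' : IFrame.ap a (s.app (𝟙 U) x) =
        powAp ψ (constSection (s.app (𝟙 U) x) X.obj) := by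
      rw [← ha]
      rfl
    rw [e, e', ← powAp_inf, ← powAp_inf, diagSection_inf_constSection]
  refine IFrame.hom_ext fun U s => ?_
  change PowSection L X.obj U at s
  change powAp ψ s = powAp (liftHom a b) s
  apply le_antisymm
  · refine (IPartition.ofHom b).le_of_forall fun V f x => ?_
    rw [map_powAp, map_powAp]
    exact (key (s.pull f) x).trans_le (point_inf_le_ap_liftHom a b (s.pull f) x)
  · refine (ap_liftHom_le_iff a b).2 fun V f x => ?_
    rw [map_powAp]
    have := key (s.pull f) x
    rw [s.pull_app_id] at this
    exact this.symm.trans_le inf_le_right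

/-- The product of a locale with a discrete space. -/
noncomputable def prodFan (Z : ILocale J) (X : Sheaf J (Type u)) : BinaryFan Z (discrete X) :=
  BinaryFan.mk (P := op (powFrame Z.unop X.obj)) (constHom Z.unop X.obj).op (diagHom Z.unop X).op

/-- The product of a locale with a discrete space is a product. -/
noncomputable def prodFanIsLimit (Z : ILocale J) (X : Sheaf J (Type u)) : IsLimit (prodFan Z X) :=
  BinaryFan.IsLimit.mk _ (fun f g => (liftHom f.unop g.unop).op)
    (fun f g => congrArg Quiver.Hom.op (constHom_liftHom f.unop g.unop))
    (fun f g => congrArg Quiver.Hom.op (diagHom_liftHom f.unop g.unop))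
    (fun _ _ m hf hg => congrArg Quiver.Hom.op (eq_liftHom m.unop
      (congrArg Quiver.Hom.unop hf) (congrArg Quiver.Hom.unop hg)))

end ProductFans

/-! ### A discrete Stone space is finite and decidable. -/

section StoneDiscrete

variable {C : Type u} [SmallCategory C] {J : GrothendieckTopology C}

theorem bool_map_mono (A : Cᵒᵖ ⥤ BoolAlg.{u}) {U V : C} (f : V ⟶ U) {a b : A.obj (op U)}
    (h : a ≤ b) : A.map f.op a ≤ A.map f.op b :=
  OrderHomClass.mono (A.map f.op).hom h

theorem IBool.eq_of_cover (A : IBool J) {U : C} {R : Sieve U} (hR : R ∈ J U)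
    {a b : A.obj.obj (op U)}
    (h : ∀ ⦃V : C⦄ (f : V ⟶ U), R f → A.obj.map f.op a = A.obj.map f.op b) : a = b :=
  (A.isSheaf R hR).isSeparatedFor.ext fun _ f hf => h f hf

theorem IBool.le_of_cover (A : IBool J) {U : C} {R : Sieve U} (hR : R ∈ J U)
    {a b : A.obj.obj (op U)}
    (h : ∀ ⦃V : C⦄ (f : V ⟶ U), R f → A.obj.map f.op a ≤ A.obj.map f.op b) : a ≤ b := by
  refine inf_eq_left.1 (A.eq_of_cover hR fun V f hf => ?_)
  rw [map_inf]
  exact inf_eq_left.2 (h f hf)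

namespace Idl

variable {A : IBool J} {U V : C}

/-- Membership in an internal ideal. -/
def Mem (I : Idl A U) (f : V ⟶ U) (a : A.obj.obj (op V)) : Prop := a ∈ I.1.carrier f

variable (I : Idl A U) (f : V ⟶ U)

theorem mem_restrict {a : A.obj.obj (op V)} (h : I.Mem f a) {W : C} (g : W ⟶ V) :
    I.Mem (g ≫ f) (A.obj.map g.op a) := I.1.restrict f a h g

theorem mem_local {a : A.obj.obj (op V)} {R : Sieve V} (hR : R ∈ J V)
    (h : ∀ ⦃W : C⦄ (g : W ⟶ V), R g → I.Mem (g ≫ f) (A.obj.map g.op a)) : I.Mem f a :=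
  I.1.isLocal f a R hR h

theorem mem_bot : I.Mem f ⊥ := (I.2 f).1

theorem mem_of_le {a b : A.obj.obj (op V)} (h : a ≤ b) (hb : I.Mem f b) : I.Mem f a :=
  (I.2 f).2.1 a b h hb

theorem mem_sup {a b : A.obj.obj (op V)} (ha : I.Mem f a) (hb : I.Mem f b) : I.Mem f (a ⊔ b) :=
  (I.2 f).2.2 a b ha hb

theorem mem_pull {U' : C} (h : U' ⟶ U) (f : V ⟶ U') (a : A.obj.obj (op V)) :
    (I.pull h).Mem f a ↔ I.Mem (f ≫ h) a := Iff.rfl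

theorem mem_pull_id (f : V ⟶ U) (a : A.obj.obj (op V)) :
    (I.pull f).Mem (𝟙 V) a ↔ I.Mem f a := by
  rw [mem_pull, Category.id_comp]

/-- The ideal with given members. -/
def mk' (M : ∀ ⦃V : C⦄, (V ⟶ U) → A.obj.obj (op V) → Prop)
    (restrict : ∀ ⦃V : C⦄ (f : V ⟶ U) (a : A.obj.obj (op V)), M f a → ∀ ⦃W : C⦄ (g : W ⟶ V),
      M (g ≫ f) (A.obj.map g.op a))
    (isLocal : ∀ ⦃V : C⦄ (f : V ⟶ U) (a : A.obj.obj (op V)) (R : Sieve V), R ∈ J V →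
      (∀ ⦃W : C⦄ (g : W ⟶ V), R g → M (g ≫ f) (A.obj.map g.op a)) → M f a)
    (bot : ∀ ⦃V : C⦄ (f : V ⟶ U), M f ⊥)
    (le : ∀ ⦃V : C⦄ (f : V ⟶ U) (a b : A.obj.obj (op V)), a ≤ b → M f b → M f a)
    (sup : ∀ ⦃V : C⦄ (f : V ⟶ U) (a b : A.obj.obj (op V)), M f a → M f b → M f (a ⊔ b)) :
    Idl A U :=
  ⟨{ carrier := fun _ f => {a | M f a}
     restrict := restrict
     isLocal := isLocal }, fun _ f => ⟨bot f, le f, sup f⟩⟩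

/-- The ideal with given members locally. -/
def mkLocal (M : ∀ ⦃V : C⦄, (V ⟶ U) → A.obj.obj (op V) → Prop)
    (restrict : ∀ ⦃V : C⦄ (f : V ⟶ U) (a : A.obj.obj (op V)), M f a → ∀ ⦃W : C⦄ (g : W ⟶ V),
      M (g ≫ f) (A.obj.map g.op a))
    (bot : ∀ ⦃V : C⦄ (f : V ⟶ U), M f ⊥)
    (le : ∀ ⦃V : C⦄ (f : V ⟶ U) (a b : A.obj.obj (op V)), a ≤ b → M f b → M f a)
    (sup : ∀ ⦃V : C⦄ (f : V ⟶ U) (a b : A.obj.obj (op V)), M f a → M f b → M f (a ⊔ b)) :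
    Idl A U :=
  ⟨LocalFamily.closure
    { carrier := fun _ f => {a | M f a}
      restrict := restrict }, fun V f => by
    refine ⟨LocalFamily.subset_closure (bot f), ?_, ?_⟩
    · rintro a b hab ⟨R, hR, h⟩
      exact ⟨R, hR, fun W g hg => le _ _ _ (bool_map_mono A.obj g hab) (h g hg)⟩
    · rintro a b ⟨R, hR, h⟩ ⟨R', hR', h'⟩
      refine ⟨R ⊓ R', J.intersection_covering hR hR', fun W g hg => ?_⟩
      change M _ (A.obj.map g.op (a ⊔ b))
      rw [map_sup]
      exact sup _ _ _ (h g hg.1) (h' g hg.2)⟩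

/-- The principal ideals. -/
def principal (a : A.obj.obj (op U)) : Idl A U :=
  mk' (fun _ f b => b ≤ A.obj.map f.op a)
    (fun V f b h W g => by
      rw [← map_map_bool]
      exact bool_map_mono A.obj g h)
    (fun V f b R hR h => A.le_of_cover hR fun W g hg => by
      rw [map_map_bool]
      exact h g hg)
    (fun _ _ => bot_le) (fun _ _ _ _ h h' => h.trans h') (fun _ _ _ _ h h' => sup_le h h')

theorem mem_principal {a : A.obj.obj (op U)} {b : A.obj.obj (op V)} :
    (principal a).Mem f b ↔ b ≤ A.obj.map f.op a := Iff.rfl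

theorem pull_principal (a : A.obj.obj (op U)) :
    (principal a).pull f = principal (A.obj.map f.op a) := by
  apply le_antisymm
  · intro W g (b : A.obj.obj (op W)) (h : b ≤ A.obj.map (g ≫ f).op a)
    change b ≤ A.obj.map g.op (A.obj.map f.op a)
    rwa [map_map_bool]
  · intro W g (b : A.obj.obj (op W)) (h : b ≤ A.obj.map g.op (A.obj.map f.op a))
    change b ≤ A.obj.map (g ≫ f).op a
    rwa [← map_map_bool]

theorem principal_le_iff {a : A.obj.obj (op U)} {I : Idl A U} :
    principal a ≤ I ↔ I.Mem (𝟙 U) a := by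
  constructor
  · exact fun h => h (𝟙 U) a (mem_principal _ |>.2 (by simp))
  · intro h V f b hb
    have := I.mem_restrict _ h f
    rw [Category.comp_id] at this
    exact I.mem_of_le f hb this

end Idl

section

variable {Y : Cᵒᵖ ⥤ Type u} {U : C}

/-- The truth value of `y = y' ∨ y ≠ y'`. -/
def decSieve (J : GrothendieckTopology C) (y y' : Y.obj (op U)) : Sieve U where
  arrows _ f := Y.map f.op y = Y.map f.op y' ∨ Apart J Y (Y.map f.op y) (Y.map f.op y')
  downward_closed := by
    rintro V W f h g
    rw [← map_map_type, ← map_map_type]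
    exact h.imp (congrArg (Y.map g.op)) fun h => h.map g

/-- The list `l` exhausts the elements of `Y`. -/
def Exhausts (J : GrothendieckTopology C) (l : List (Y.obj (op U))) : Prop :=
  ∀ ⦃V : C⦄ (f : V ⟶ U) (y : Y.obj (op V)), ∃ R ∈ J V, ∀ ⦃W : C⦄ (g : W ⟶ V), R g →
    ∃ z ∈ l, Y.map g.op y = Y.map (g ≫ f).op z

variable (Y U) in
/-- The truth value of `Y` being finite. -/
def finSieve (J : GrothendieckTopology C) : Sieve U where
  arrows V _ := ∃ l : List (Y.obj (op V)), Exhausts J l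
  downward_closed := by
    rintro V W _ ⟨l, hl⟩ g
    refine ⟨l.map (Y.map g.op), fun W' k y => ?_⟩
    obtain ⟨R, hR, h⟩ := hl (k ≫ g) y
    refine ⟨R, hR, fun W'' m hm => ?_⟩
    obtain ⟨z, hz, e⟩ := h m hm
    refine ⟨_, List.mem_map_of_mem hz, ?_⟩
    rw [e, map_map_type, Category.assoc]

/-- The subsheaf generated by a list of elements. -/
def span (J : GrothendieckTopology C) (l : List (Y.obj (op U))) : LocalFamily J Y U :=
  LocalFamily.closure
    { carrier := fun _ f => {y | ∃ z ∈ l, y = Y.map f.op z}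
      restrict := by
        rintro V f _ ⟨z, hz, rfl⟩ W g
        exact ⟨z, hz, map_map_type Y f g z⟩ }

theorem span_mono {l l' : List (Y.obj (op U))} (h : l ⊆ l') : span J l ≤ span J l' := by
  rintro V f y ⟨R, hR, hy⟩
  refine ⟨R, hR, fun W g hg => ?_⟩
  obtain ⟨z, hz, e⟩ := hy g hg
  exact ⟨z, h hz, e⟩

end

theorem LocalFamily.mem_sup {P : Cᵒᵖ ⥤ Type u} {U V : C} {S T : LocalFamily J P U} {f : V ⟶ U}
    {x : P.obj (op V)} (h : x ∈ (S ⊔ T).carrier f) : ∃ R ∈ J V, ∀ ⦃W : C⦄ (g : W ⟶ V), R g →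
      P.map g.op x ∈ S.carrier (g ≫ f) ∨ P.map g.op x ∈ T.carrier (g ≫ f) := by
  obtain ⟨R, hR, h⟩ := h
  refine ⟨R, hR, fun W g hg => ?_⟩
  obtain ⟨Q, rfl | rfl, hQ⟩ := h g hg
  · exact .inl hQ
  · exact .inr hQ

theorem LocalFamily.bot_mem_of_mem_bot {P : Cᵒᵖ ⥤ Type u} {U V : C} {f : V ⟶ U}
    {x : P.obj (op V)} (h : x ∈ (⊥ : LocalFamily J P U).carrier f) : ⊥ ∈ J V := by
  obtain ⟨R, hR, h⟩ := h
  have e : R = ⊥ := by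
    refine le_bot_iff.1 fun W g hg => ?_
    exact (h g hg).elim
  rwa [← e]

/-- An isomorphism between the subsheaves of `Y` and the ideals of `A`. -/
structure StoneIso (Y : Sheaf J (Type u)) (A : IBool J) where
  /-- The isomorphism on sections. -/
  iso : ∀ U : C, LocalFamily J Y.obj U ≃o Idl A U
  nat : ∀ ⦃U V : C⦄ (h : V ⟶ U) (T : LocalFamily J Y.obj U), iso V (T.pull h) = (iso U T).pull h

namespace StoneIso

variable {Y : Sheaf J (Type u)} {A : IBool J} (e : StoneIso Y A) {U V : C}

/-- The subsheaf corresponding to an element of the Boolean algebra. -/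
def sub (a : A.obj.obj (op U)) : LocalFamily J Y.obj U := (e.iso U).symm (Idl.principal a)

theorem symm_pull (I : Idl A U) (f : V ⟶ U) :
    ((e.iso U).symm I).pull f = (e.iso V).symm (I.pull f) := by
  rw [OrderIso.eq_symm_apply, e.nat, OrderIso.apply_symm_apply]

theorem sub_pull (a : A.obj.obj (op U)) (f : V ⟶ U) :
    (e.sub a).pull f = e.sub (A.obj.map f.op a) := by
  rw [sub, symm_pull, Idl.pull_principal, sub]

theorem sub_le_iff {a : A.obj.obj (op U)} {T : LocalFamily J Y.obj U} :
    e.sub a ≤ T ↔ (e.iso U T).Mem (𝟙 U) a := by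
  rw [sub, OrderIso.symm_apply_le, Idl.principal_le_iff]

theorem le_sub_iff {a : A.obj.obj (op U)} {T : LocalFamily J Y.obj U} :
    T ≤ e.sub a ↔ e.iso U T ≤ Idl.principal a := by
  rw [sub, OrderIso.le_symm_apply]

theorem mem_iso_iff {a : A.obj.obj (op V)} {T : LocalFamily J Y.obj U} {f : V ⟶ U} :
    (e.iso U T).Mem f a ↔ e.sub a ≤ T.pull f := by
  rw [sub_le_iff, e.nat, Idl.mem_pull_id]

theorem sub_mono {a b : A.obj.obj (op U)} (h : a ≤ b) : e.sub a ≤ e.sub b :=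
  e.sub_le_iff.2 ((e.iso U _).mem_of_le _ h (e.sub_le_iff.1 le_rfl))

theorem sub_bot_le (T : LocalFamily J Y.obj U) : e.sub ⊥ ≤ T :=
  e.sub_le_iff.2 (Idl.mem_bot _ _)

theorem le_sub_top (T : LocalFamily J Y.obj U) : T ≤ e.sub ⊤ :=
  e.le_sub_iff.2 fun V f (a : A.obj.obj (op V)) _ => by
    change a ≤ A.obj.map f.op ⊤
    rw [map_top]
    exact le_top

theorem sub_sup_le {a b : A.obj.obj (op U)} {T : LocalFamily J Y.obj U} (ha : e.sub a ≤ T)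
    (hb : e.sub b ≤ T) : e.sub (a ⊔ b) ≤ T :=
  e.sub_le_iff.2 (Idl.mem_sup _ _ (e.sub_le_iff.1 ha) (e.sub_le_iff.1 hb))

theorem le_sub_inf {a b : A.obj.obj (op U)} {T : LocalFamily J Y.obj U} (ha : T ≤ e.sub a)
    (hb : T ≤ e.sub b) : T ≤ e.sub (a ⊓ b) :=
  e.le_sub_iff.2 fun V f (c : A.obj.obj (op V)) hc => by
    change c ≤ A.obj.map f.op (a ⊓ b)
    rw [map_inf]
    exact le_inf (e.le_sub_iff.1 ha f c hc) (e.le_sub_iff.1 hb f c hc)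

/-- The ideal of elements corresponding to finite subsheaves. -/
def finIdeal (U : C) : Idl A U :=
  Idl.mkLocal (fun V _ a => ∃ l : List (Y.obj.obj (op V)), e.sub a ≤ span J l)
    (by
      rintro V f a ⟨l, hl⟩ W g
      refine ⟨l.map (Y.obj.map g.op), ?_⟩
      rw [← sub_pull]
      intro W' k y hy
      obtain ⟨R, hR, h⟩ := hl _ y hy
      refine ⟨R, hR, fun W'' m hm => ?_⟩
      obtain ⟨z, hz, e⟩ := h m hm
      refine ⟨_, List.mem_map_of_mem hz, ?_⟩
      rw [e, map_map_type, Category.assoc])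
    (fun _ _ => ⟨[], e.sub_bot_le _⟩)
    (by
      rintro V f a b h ⟨l, hl⟩
      exact ⟨l, (e.sub_mono h).trans hl⟩)
    (by
      rintro V f a b ⟨l, hl⟩ ⟨l', hl'⟩
      exact ⟨l ++ l', e.sub_sup_le (hl.trans (span_mono (List.subset_append_left _ _)))
        (hl'.trans (span_mono (List.subset_append_right _ _)))⟩)

-- Compactness: every point of `Y` lies in the subsheaf of the ideal `finIdeal`, so this ideal
-- contains `⊤`; its membership being local, a cover results on which `Y` is exhausted by lists.
include e in
theorem finSieve_mem (U : C) : finSieve Y.obj U J ∈ J U := by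
  have h1 : ⊤ ≤ (e.iso U).symm (e.finIdeal U) := by
    intro V f y _
    have h2 : pt y ≤ ((e.iso U).symm (e.finIdeal U)).pull f := by
      rw [symm_pull, OrderIso.le_symm_apply]
      intro W g a ha
      -- An element whose subsheaf lies in the singleton of `y` is bounded by a list of length one.
      refine LocalFamily.subset_closure ⟨[Y.obj.map g.op y], (e.mem_iso_iff.1 ha).trans ?_⟩
      intro W' k z hz
      refine LocalFamily.subset_closure ⟨_, List.mem_singleton_self _, ?_⟩
      rw [map_map_type]
      exact mem_pt.1 hz
    have := point_le_iff.1 h2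
    rwa [LocalFamily.mem_pull, Category.id_comp] at this
  rw [OrderIso.le_symm_apply] at h1
  obtain ⟨R, hR, h⟩ := h1 (𝟙 U) (⊤ : A.obj.obj (op U)) (e.sub_le_iff.1 le_top)
  refine J.superset_covering (fun V f hf => ?_) hR
  obtain ⟨l, hl⟩ := h f hf
  refine ⟨l, fun W g y => ?_⟩
  change e.sub (A.obj.map f.op ⊤) ≤ span J l at hl
  rw [map_top] at hl
  exact hl g y (e.le_sub_top ⊤ g y trivial)

-- A singleton is the join of the subsheaves `e.sub a` below it, so on a cover `y` itself lies in
-- one of these. That `e.sub a` then equals the singleton and has the complement `e.sub aᶜ`, and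
-- `y'` falls locally into one of the two.
include e in
theorem decSieve_mem (y y' : Y.obj.obj (op U)) : decSieve J y y' ∈ J U := by
  -- `S` is the union of the subsheaves of the elements in the ideal of the singleton of `y`.
  let S : LocalFamily J Y.obj U := LocalFamily.closure
    { carrier := fun V f => {z | ∃ a, (e.iso U (pt y)).Mem f a ∧ z ∈ (e.sub a).carrier (𝟙 V)}
      restrict := by
        rintro V f z ⟨a, ha, hz⟩ W g
        refine ⟨_, Idl.mem_restrict _ f ha g, ?_⟩
        rw [← sub_pull, LocalFamily.mem_pull, Category.id_comp]
        have := (e.sub a).restrict _ z hz g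
        rwa [Category.comp_id] at this }
  have hS : pt y ≤ S := by
    rw [← (e.iso U).le_iff_le]
    intro V f a ha
    refine e.mem_iso_iff.2 fun W g z hz => LocalFamily.subset_closure ?_
    refine ⟨_, Idl.mem_restrict _ f ha g, ?_⟩
    rw [← sub_pull, LocalFamily.mem_pull]
    simpa using hz
  obtain ⟨R, hR, h⟩ := point_le_iff.1 hS
  refine J.transitive hR _ fun V f hf => ?_
  obtain ⟨a, ha, hy⟩ := h f hf
  rw [Category.comp_id] at ha
  have ha : e.sub a ≤ (pt y).pull f := e.mem_iso_iff.1 ha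
  have hy' : ⊤ ≤ e.sub a ⊔ e.sub aᶜ := by
    refine (e.le_sub_top ⊤).trans ?_
    rw [← sup_compl_eq_top (x := a)]
    exact e.sub_sup_le le_sup_left le_sup_right
  obtain ⟨R', hR', h'⟩ := LocalFamily.mem_sup (hy' (𝟙 V) (Y.obj.map f.op y') trivial)
  refine J.superset_covering (fun W g hg => ?_) hR'
  rcases h' g hg with h1 | h1
  · left
    rw [Category.comp_id, map_map_type] at h1
    exact (ha _ _ h1).symm
  · right
    -- If `y` and `y'` become equal here, their common value lies in `e.sub a` and in `e.sub aᶜ`,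
    -- hence in the least subsheaf, which has points only at stages covered by the empty sieve.
    intro W' k hk
    rw [Category.comp_id, map_map_type] at h1
    have h2 := (e.sub aᶜ).restrict _ _ h1 k
    rw [← hk, map_map_type] at h2
    have h3 := (e.sub a).restrict _ _ hy (k ≫ g)
    rw [map_map_type, Category.comp_id, Category.assoc] at h3
    have h4 : pt (Y.obj.map (k ≫ g ≫ f).op y) ≤ e.sub (A.obj.map (k ≫ g).op a) := by
      rw [← sub_pull, point_le_iff, LocalFamily.mem_pull, Category.id_comp]
      exact h3
    have h5 : pt (Y.obj.map (k ≫ g ≫ f).op y) ≤ e.sub (A.obj.map (k ≫ g).op aᶜ) := by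
      rw [← sub_pull, point_le_iff, LocalFamily.mem_pull, Category.id_comp]
      exact h2
    have h6 := e.le_sub_inf h4 h5
    rw [← map_inf, inf_compl_self, map_bot] at h6
    exact LocalFamily.bot_mem_of_mem_bot (point_le_iff.1 (h6.trans (e.sub_bot_le ⊥)))

end StoneIso

/-- `Y` is decidable and finite, in the internal logic. -/
structure IsDecFinite (J : GrothendieckTopology C) (Y : Cᵒᵖ ⥤ Type u) : Prop where
  dec : ∀ ⦃U : C⦄ (y y' : Y.obj (op U)), decSieve J y y' ∈ J U
  fin : ∀ U : C, finSieve Y U J ∈ J U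

theorem isDecFinite_of_isStone {Y : Sheaf J (Type u)} (hY : IsStone (discrete Y)) :
    IsDecFinite J Y.obj := by
  obtain ⟨A, e, he⟩ := hY
  let e' : StoneIso Y A := ⟨e, he⟩
  exact ⟨fun _ => e'.decSieve_mem, e'.finSieve_mem⟩

end StoneDiscrete

/-! ### Finite meets indexed by lists. -/

section Meets

variable {α β γ : Type*} [SemilatticeInf β] [OrderTop β] [SemilatticeInf γ] [OrderTop γ]

/-- The meet of a finite list of elements. -/
def meet (F : α → β) (l : List α) : β := l.foldr (fun a b => F a ⊓ b) ⊤

theorem meet_nil (F : α → β) : meet F [] = ⊤ := rfl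

theorem meet_cons (F : α → β) (a : α) (l : List α) : meet F (a :: l) = F a ⊓ meet F l := rfl

theorem le_meet_iff {F : α → β} {l : List α} {b : β} : b ≤ meet F l ↔ ∀ a ∈ l, b ≤ F a := by
  induction l with
  | nil => simp [meet_nil]
  | cons a l ih => simp [meet_cons, ih]

theorem meet_anti (F : α → β) {l l' : List α} (h : l ⊆ l') : meet F l' ≤ meet F l :=
  le_meet_iff.2 fun a ha => le_meet_iff.1 le_rfl a (h ha)

theorem meet_append (F : α → β) (l l' : List α) : meet F (l ++ l') = meet F l ⊓ meet F l' := by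
  refine eq_of_forall_le_iff fun b => ?_
  simp only [le_inf_iff, le_meet_iff, List.mem_append]
  exact ⟨fun h => ⟨fun a ha => h a (.inl ha), fun a ha => h a (.inr ha)⟩,
    fun h a ha => ha.elim (h.1 a) (h.2 a)⟩

theorem map_meet {S : Type*} [FunLike S β γ] [InfTopHomClass S β γ] (φ : S) (F : α → β)
    (l : List α) : φ (meet F l) = meet (fun a => φ (F a)) l := by
  induction l with
  | nil => simp [meet_nil]
  | cons a l ih => simp [meet_cons, ih]

theorem meet_map {α' : Type*} (F : α → β) (k : α' → α) (l : List α') :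
    meet F (l.map k) = meet (fun a => F (k a)) l := by
  induction l with
  | nil => rfl
  | cons a l ih => rw [List.map_cons, meet_cons, meet_cons, ih]

end Meets

/-! ### Functional relations with values in a frame, and the universal property of the frame of
graphs. -/

section Universal

variable {C : Type u} [SmallCategory C] {J : GrothendieckTopology C}

namespace GraphOpen

variable {X Y : Cᵒᵖ ⥤ Type u} {U V : C}

/-- The graph open generated by a word. -/
def principal (J : GrothendieckTopology C) (l : Word X Y U) : GraphOpen J X Y U :=
  hull
    { carrier := fun V f => {w | w = wres f l}
      restrict := by
        rintro V f _ rfl W g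
        exact wres_wres f g l }

theorem pull_principal_le_iff {l : Word X Y U} (h : V ⟶ U) {I : GraphOpen J X Y V} :
    (principal J l).pull h ≤ I ↔ I.Mem (𝟙 V) (wres h l) := by
  refine (pull_hull_le h).trans ⟨fun H => H (𝟙 V) _ (by
    rw [Category.id_comp]
    exact rfl), ?_⟩
  rintro H W f w (rfl : w = _)
  have := I.mem_restrict _ H f
  rwa [Category.comp_id, wres_wres] at this

theorem principal_le_iff {l : Word X Y U} {I : GraphOpen J X Y U} :
    principal J l ≤ I ↔ I.Mem (𝟙 U) l := by
  have := pull_principal_le_iff (J := J) (𝟙 U) (l := l) (I := I)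
  rwa [pull_id, wres_id] at this

theorem mem_iff_principal_le {l : Word X Y V} {f : V ⟶ U} {I : GraphOpen J X Y U} :
    I.Mem f l ↔ principal J l ≤ I.pull f := by
  rw [principal_le_iff, mem_pull_id]

theorem pull_principal (h : V ⟶ U) (l : Word X Y U) :
    (principal J l).pull h = principal J (wres h l) :=
  eq_of_forall_ge_iff fun I => by rw [pull_principal_le_iff, principal_le_iff]

theorem mem_principal_self (l : Word X Y U) : (principal J l).Mem (𝟙 U) l :=
  principal_le_iff.1 le_rfl

/-- Heyting implication with a principal graph open as its premise. -/
def shift (I : GraphOpen J X Y U) (l : Word X Y U) : GraphOpen J X Y U :=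
  mk' (fun _ f w => I.Mem f (w ++ wres f l))
    (fun V f w h W g => by simpa using I.mem_restrict f h g)
    (fun V f w R hR h => I.mem_local f hR fun W g hg => by simpa using h g hg)
    (fun V f w w' hw h => I.mem_mono f (List.append_subset.2
      ⟨fun _ h => List.mem_append_left _ (hw h), List.subset_append_right _ _⟩) h)
    (fun V f w x h => I.mem_total f x fun W g y => by simpa using h g y)
    (fun V f w x y y' h => I.mem_single f h (x := x) (by simp) (by simp))

theorem mem_shift {I : GraphOpen J X Y U} {l : Word X Y U} {f : V ⟶ U} {w : Word X Y V} :
    (I.shift l).Mem f w ↔ I.Mem f (w ++ wres f l) := Iff.rfl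

/-- Meeting with a word acts by concatenation, so this implication needs no quantification over
longer words, unlike `imp`. -/
theorem principal_inf_le_iff {l : Word X Y U} {I K : GraphOpen J X Y U} :
    principal J l ⊓ K ≤ I ↔ K ≤ I.shift l := by
  constructor
  · intro h V f (w : Word X Y V) hw
    refine h f _ ⟨?_, K.mem_mono f (List.subset_append_left _ _) hw⟩
    refine mem_mono _ f (List.subset_append_right _ _) ?_
    simpa using mem_restrict _ _ (mem_principal_self (J := J) l) f
  · intro h V f (w : Word X Y V) hw
    have h1 : I.Mem f (w ++ wres f l) := h f w hw.2
    -- The roles are exchanged: `l` together with `w` lies in `I`, so the open generated by `l` lies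
    -- in `I` shifted by `w`, and this is applied to `w` itself.
    have h2 : (principal J l).pull f ≤ (I.pull f).shift w := by
      rw [pull_principal_le_iff, mem_shift, mem_pull_id, wres_id]
      exact I.mem_mono f (List.append_subset.2 ⟨List.subset_append_right _ _,
        List.subset_append_left _ _⟩) h1
    have h3 := h2 (𝟙 V) w ((mem_pull_id _ _ _).2 hw.1)
    have h4 := mem_shift.1 h3
    rw [mem_pull_id, wres_id] at h4
    -- Doubling a word does not change its set of letters, so `mem_mono` contracts `w ++ w` to `w`.
    exact I.mem_mono f (List.append_subset.2 ⟨List.Subset.refl _, List.Subset.refl _⟩) h4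

/-- The graph open `{θ | θ x = y}`. -/
def gen (J : GrothendieckTopology C) (x : X.obj (op U)) (y : Y.obj (op U)) : GraphOpen J X Y U :=
  principal J [(x, y)]

theorem pull_gen (h : V ⟶ U) (x : X.obj (op U)) (y : Y.obj (op U)) :
    (gen J x y).pull h = gen J (X.map h.op x) (Y.map h.op y) :=
  pull_principal h _

theorem meet_gen (l : Word X Y U) : meet (fun p => gen J p.1 p.2) l = principal J l := by
  induction l with
  | nil =>
    rw [meet_nil, eq_comm, eq_top_iff_nil]
    exact mem_principal_self _
  | cons p l ih =>
    rw [meet_cons, ih]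
    refine eq_of_forall_ge_iff fun I => ?_
    rw [gen, principal_inf_le_iff, principal_le_iff, principal_le_iff, mem_shift, wres_id]
    constructor
    · exact I.mem_mono _ (by simp)
    · exact I.mem_mono _ (by simp)

/-- The principal graph opens below a graph open. -/
def principalFamily (I : GraphOpen J X Y U) : SubFamily (graphFrm J X Y ⋙ forget Frm) U where
  carrier V f := {c | ∃ l : Word X Y V, I.Mem f l ∧ c = principal J l}
  restrict := by
    rintro V f _ ⟨l, hl, rfl⟩ W g
    exact ⟨_, I.mem_restrict f hl g, pull_principal g l⟩

theorem isJoin_principalFamily (I : GraphOpen J X Y U) :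
    IsJoin (graphFrm J X Y) (principalFamily I) I := by
  refine .of_le_iff ?_ ?_
  · rintro V f _ ⟨l, hl, rfl⟩
    exact mem_iff_principal_le.1 hl
  · intro V f (b : GraphOpen J X Y V) H W g l hl
    exact mem_iff_principal_le.2 (H g _ ⟨l, hl, rfl⟩)

/-- Every open is the internal join of the principal ones below it, and these are finite meets of
generators. -/
theorem hom_ext {L : IFrame J} {φ ψ : graphFrame J X Y ⟶ L}
    (h : ∀ ⦃U : C⦄ (x : X.obj (op U)) (y : Y.obj (op U)),
      IFrame.ap φ (U := U) (gen J x y) = IFrame.ap ψ (U := U) (gen J x y)) : φ = ψ := by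
  have key : ∀ ⦃U : C⦄ (l : Word X Y U),
      IFrame.ap φ (U := U) (principal J l) = IFrame.ap ψ (U := U) (principal J l) := by
    intro U l
    rw [← meet_gen]
    refine (map_meet ((IFrame.Hom.hom φ).app (op U)).hom _ l).trans
      (Eq.trans ?_ (map_meet ((IFrame.Hom.hom ψ).app (op U)).hom _ l).symm)
    exact congrArg (meet · l) (funext fun p => h p.1 p.2)
  refine IFrame.hom_ext fun U I => eq_of_forall_ge_iff fun b => ?_
  rw [IFrame.ap_isJoin_le_iff φ (isJoin_principalFamily I),
    IFrame.ap_isJoin_le_iff ψ (isJoin_principalFamily I)]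
  constructor
  · rintro H V f _ ⟨l, hl, rfl⟩
    exact (key l).symm.trans_le (H f _ ⟨l, hl, rfl⟩)
  · rintro H V f _ ⟨l, hl, rfl⟩
    exact (key l).trans_le (H f _ ⟨l, hl, rfl⟩)

end GraphOpen

/-- A functional relation between `X` and `Y` with values in `L`. -/
structure GraphData (X Y : Cᵒᵖ ⥤ Type u) (L : IFrame J) where
  /-- The truth value of `θ x = y`. -/
  app : ∀ ⦃U : C⦄, X.obj (op U) → Y.obj (op U) → L.obj.obj (op U)
  nat : ∀ ⦃U V : C⦄ (f : V ⟶ U) (x : X.obj (op U)) (y : Y.obj (op U)),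
    app (X.map f.op x) (Y.map f.op y) = L.obj.map f.op (app x y)
  total : ∀ ⦃U : C⦄ (x : X.obj (op U)) (b : L.obj.obj (op U)),
    (∀ ⦃V : C⦄ (f : V ⟶ U) (y : Y.obj (op V)), app (X.map f.op x) y ≤ L.obj.map f.op b) → ⊤ ≤ b
  single : ∀ ⦃U : C⦄ (x : X.obj (op U)) (y y' : Y.obj (op U)), Apart J Y y y' →
    app x y ⊓ app x y' ≤ ⊥

namespace GraphData

variable {X Y : Cᵒᵖ ⥤ Type u} {L : IFrame J} (F : GraphData X Y L) {U V : C}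

/-- For fixed `x` the values `F.app x y` cover, so an inequality may be tested on each of them. -/
theorem le_of_forall (x : X.obj (op U)) {t b : L.obj.obj (op U)}
    (h : ∀ ⦃V : C⦄ (f : V ⟶ U) (y : Y.obj (op V)),
      F.app (X.map f.op x) y ⊓ L.obj.map f.op t ≤ L.obj.map f.op b) : t ≤ b := by
  let Φ : SubFamily (L.obj ⋙ forget Frm) U :=
    { carrier := fun V f => {c | ∃ y, c = F.app (X.map f.op x) y}
      restrict := by
        rintro V f _ ⟨y, rfl⟩ W g
        refine ⟨Y.map g.op y, ?_⟩
        rw [← map_map_type, F.nat]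
        rfl }
  have hΦ := L.isJoin_sup Φ
  have e : ⊤ ≤ L.sup Φ := F.total x _ fun V f y => hΦ.le ⟨y, rfl⟩
  have := (IFrame.inf_le_iff_of_isJoin (t := t) (b := b) hΦ).2 (by
    rintro V f _ ⟨y, rfl⟩
    exact h f y)
  simpa [top_le_iff.1 e] using this

/-- The truth value of a word. -/
def word (l : Word X Y U) : L.obj.obj (op U) := meet (fun p => F.app p.1 p.2) l

theorem word_wres (f : V ⟶ U) (l : Word X Y U) : F.word (wres f l) = L.obj.map f.op (F.word l) := by
  rw [word, word, wres, meet_map]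
  refine Eq.trans ?_ (map_meet (L.obj.map f.op).hom _ l).symm
  exact congrArg (meet · l) (funext fun p => F.nat f p.1 p.2)

theorem word_cons (x : X.obj (op U)) (y : Y.obj (op U)) (l : Word X Y U) :
    F.word ((x, y) :: l) = F.app x y ⊓ F.word l := rfl

/-- The graph open of all words below a given element. -/
def below (b : L.obj.obj (op U)) : GraphOpen J X Y U :=
  GraphOpen.mk' (fun _ f l => F.word l ≤ L.obj.map f.op b)
    (fun V f l h W g => by
      rw [F.word_wres, ← map_map_frm]
      exact frm_map_mono _ g h)
    (fun V f l R hR h => L.le_of_cover hR fun W g hg => by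
      rw [← F.word_wres, map_map_frm]
      exact h g hg)
    (fun V f l l' hl h => (meet_anti _ hl).trans h)
    (fun V f l x h => F.le_of_forall x fun W g y => by
      rw [← F.word_wres, ← F.word_cons, map_map_frm]
      exact h g y)
    (fun V f l x y y' h => by
      rw [F.word_cons, F.word_cons, ← inf_assoc]
      exact (inf_le_left.trans (F.single x y y' h)).trans bot_le)

theorem mem_below {b : L.obj.obj (op U)} {f : V ⟶ U} {l : Word X Y V} :
    (F.below b).Mem f l ↔ F.word l ≤ L.obj.map f.op b := Iff.rfl

theorem pull_below (b : L.obj.obj (op U)) (f : V ⟶ U) :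
    (F.below b).pull f = F.below (L.obj.map f.op b) :=
  GraphOpen.ext_mem fun W g l => by
    rw [GraphOpen.mem_pull, mem_below, mem_below, map_map_frm]

/-- The truth values of the words in a graph open. -/
def wordFamily (I : GraphOpen J X Y U) : SubFamily (L.obj ⋙ forget Frm) U where
  carrier V f := {c | ∃ l, I.Mem f l ∧ c = F.word l}
  restrict := by
    rintro V f _ ⟨l, hl, rfl⟩ W g
    exact ⟨_, I.mem_restrict f hl g, (F.word_wres g l).symm⟩

/-- The inverse image of a graph open. -/
noncomputable def val (I : GraphOpen J X Y U) : L.obj.obj (op U) := L.sup (F.wordFamily I)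

/-- `F.val` is left adjoint to `F.below`. The relations on `F` enter through `F.below` being a graph
open; preservation of joins then comes from the adjunction, and only finite meets remain to be
checked on words. -/
theorem val_le_iff {I : GraphOpen J X Y U} {b : L.obj.obj (op U)} :
    F.val I ≤ b ↔ I ≤ F.below b := by
  refine (L.isJoin_sup (F.wordFamily I)).le_iff.trans ?_
  constructor
  · exact fun H V f l hl => H f _ ⟨l, hl, rfl⟩
  · rintro H V f _ ⟨l, hl, rfl⟩
    exact H f l hl

theorem val_pull (f : V ⟶ U) (I : GraphOpen J X Y U) :
    F.val (I.pull f) = L.obj.map f.op (F.val I) := by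
  refine IsJoin.unique (L.isJoin_sup _) ?_
  have e : F.wordFamily (I.pull f) = (F.wordFamily I).pull f := rfl
  rw [e]
  exact (L.isJoin_sup _).pull f

theorem val_mono {I K : GraphOpen J X Y U} (h : I ≤ K) : F.val I ≤ F.val K :=
  F.val_le_iff.2 (h.trans (F.val_le_iff.1 le_rfl))

theorem word_le_val {I : GraphOpen J X Y U} {l : Word X Y U} (h : I.Mem (𝟙 U) l) :
    F.word l ≤ F.val I := by
  have : (F.below (F.val I)).Mem (𝟙 U) l := F.val_le_iff.1 le_rfl (𝟙 U) l h
  rw [mem_below] at this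
  simpa using this

/-- By distributivity it is enough to meet a word of `I` with a word of `K`, and their concatenation
lies in both. -/
theorem val_inf (I K : GraphOpen J X Y U) : F.val (I ⊓ K) = F.val I ⊓ F.val K := by
  apply le_antisymm (le_inf (F.val_mono inf_le_left) (F.val_mono inf_le_right))
  refine (IFrame.inf_le_iff_of_isJoin (L.isJoin_sup (F.wordFamily I))).2 ?_
  rintro V f _ ⟨l, hl, rfl⟩
  rw [inf_comm, ← F.val_pull, ← F.val_pull]
  refine (IFrame.inf_le_iff_of_isJoin (L.isJoin_sup (F.wordFamily _))).2 ?_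
  rintro W g _ ⟨l', hl', rfl⟩
  rw [← F.word_wres, ← F.val_pull]
  refine (meet_append _ l' (wres g l)).ge.trans (F.word_le_val ?_)
  rw [GraphOpen.mem_pull_id, GraphOpen.mem_pull]
  exact ⟨I.mem_mono _ (List.subset_append_right _ _) (I.mem_restrict f hl g),
    K.mem_mono _ (List.subset_append_left _ _) hl'⟩

/-- The frame homomorphism classifying a functional relation. -/
noncomputable def hom : graphFrame J X Y ⟶ L :=
  IFrame.Hom.ofFun (M := graphFrame J X Y) (fun _ I => F.val I) (fun _ _ f I => F.val_pull f I)
    (fun U => top_le_iff.1 ((F.word_le_val (l := []) (GraphOpen.mem_top (f := 𝟙 U))).trans' le_rfl))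
    (fun _ I K => F.val_inf I K)
    (fun U Φ s b h H => by
      refine F.val_le_iff.2 (h.le_iff.2 fun V f I hI => ?_)
      refine (F.val_le_iff.1 (H f I hI)).trans_eq ?_
      exact (F.pull_below b f).symm)

theorem ap_hom_gen (x : X.obj (op U)) (y : Y.obj (op U)) :
    IFrame.ap F.hom (U := U) (GraphOpen.gen J x y) = F.app x y := by
  change F.val (GraphOpen.gen J x y) = _
  refine eq_of_forall_ge_iff fun b => ?_
  rw [F.val_le_iff, GraphOpen.gen, GraphOpen.principal_le_iff, mem_below]
  change F.app x y ⊓ ⊤ ≤ _ ↔ _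
  simp

variable (J X Y) in
/-- The generic functional relation. -/
def generic : GraphData X Y (graphFrame J X Y) where
  app _ x y := GraphOpen.gen J x y
  nat _ _ f x y := (GraphOpen.pull_gen f x y).symm
  total U x b h := by
    change GraphOpen J X Y U at b
    refine top_le_iff.2 (GraphOpen.eq_top_iff_nil.2 (b.mem_total _ x fun V f y => ?_))
    rw [GraphOpen.mem_iff_principal_le, Category.comp_id]
    exact h f y
  single U x y y' h := by
    refine GraphOpen.principal_inf_le_iff.2 (GraphOpen.principal_le_iff.2 ?_)
    refine GraphOpen.mem_shift.2 ?_
    rw [wres_id]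
    exact GraphOpen.mem_single _ _ h (x := x) (by simp) (by simp)

/-- The partition of `L ^ X` given by a functional relation. -/
def partition (hY : ∀ ⦃U : C⦄ (y y' : Y.obj (op U)), decSieve J y y' ∈ J U) :
    IPartition Y (powFrame L X) where
  app U y := show PowSection L X U from
    { app := fun V f x => F.app x (Y.map f.op y)
      nat := fun V W f g x => by
        rw [← F.nat, map_map_type] }
  nat U V f y := PowSection.ext_app (L := L) (X := X) fun W g x => by
    change F.app x (Y.map g.op (Y.map f.op y)) = F.app x (Y.map (g ≫ f).op y)
    rw [map_map_type]
  total U b h := by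
    change PowSection L X U at b
    intro V f x
    refine F.total x _ fun W g y => ?_
    have : F.app (X.map g.op x) (Y.map (𝟙 W).op y) ≤ b.app (𝟙 W ≫ g ≫ f) (X.map g.op x) :=
      h (g ≫ f) y (𝟙 W) (X.map g.op x)
    rw [← b.nat]
    simpa using this
  disjoint U y y' b h := by
    change PowSection L X U at b
    intro V f x
    change F.app x (Y.map f.op y) ⊓ F.app x (Y.map f.op y') ≤ b.app f x
    -- Decidability enters here: `single` speaks only of apart elements while a partition must
    -- handle any pair, so one passes to the cover on which the two are equal or apart.
    refine L.le_of_cover (hY (Y.map f.op y) (Y.map f.op y')) fun W g hg => ?_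
    rw [map_inf, ← F.nat, ← F.nat, ← b.nat]
    rcases hg with hg | hg
    · refine inf_le_left.trans ?_
      rw [map_map_type, map_map_type] at hg
      have : F.app (X.map g.op x) (Y.map (𝟙 W).op (Y.map (g ≫ f).op y)) ≤
          b.app (𝟙 W ≫ g ≫ f) (X.map g.op x) := h (g ≫ f) hg (𝟙 W) (X.map g.op x)
      rw [map_map_type]
      simpa using this
    · exact (F.single _ _ _ hg).trans bot_le

end GraphData

theorem IFrame.le_of_bot_mem (L : IFrame J) {U : C} (h : ⊥ ∈ J U) (a b : L.obj.obj (op U)) :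
    a ≤ b :=
  L.le_of_cover h fun _ _ h => h.elim

theorem diagSection_pull {L : IFrame J} {X : Cᵒᵖ ⥤ Type u} {U V : C} (f : V ⟶ U)
    (x : X.obj (op U)) : (diagSection L x).pull f = diagSection L (X.map f.op x) :=
  ((diagonal L X).nat f x).symm

theorem constSection_pull {L : IFrame J} {X : Cᵒᵖ ⥤ Type u} {U V : C} (f : V ⟶ U)
    (b : L.obj.obj (op U)) : (constSection b X).pull f = constSection (L.obj.map f.op b) X :=
  (IFrame.ap_map (constHom L X) f b).symm

theorem constSection_app_id {L : IFrame J} {X : Cᵒᵖ ⥤ Type u} {U : C} (b : L.obj.obj (op U))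
    (x : X.obj (op U)) : (constSection b X).app (𝟙 U) x = b := by
  rw [constSection_app]
  simp

/-- A member of a partition of `L ^ X`, as a section. -/
def IPartition.sec {L : IFrame J} {X Y : Cᵒᵖ ⥤ Type u} (p : IPartition Y (powFrame L X)) {U : C}
    (y : Y.obj (op U)) : PowSection L X U := p.app y

theorem IPartition.sec_map {L : IFrame J} {X Y : Cᵒᵖ ⥤ Type u} (p : IPartition Y (powFrame L X))
    {U V : C} (f : V ⟶ U) (y : Y.obj (op U)) : p.sec (Y.map f.op y) = (p.sec y).pull f :=
  p.nat f y

/-- The functional relation given by a map `Z × X ⟶ Y`. -/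
def GraphData.ofPartition {X Y : Cᵒᵖ ⥤ Type u} {L : IFrame J} (p : IPartition Y (powFrame L X)) :
    GraphData X Y L where
  app U x y := (p.sec y).app (𝟙 U) x
  nat U V f x y := by
    have h := (p.sec y).nat (𝟙 U) f x
    rw [Category.comp_id] at h
    rw [p.sec_map, PowSection.pull_app_id, h]
  total U x b h := by
    -- The partition `p` covers the slice `Z × {x}`, so the slice lies in the inverse image of `b`;
    -- evaluating at `x` then gives `⊤ ≤ b`.
    have h1 : diagSection L x ≤ constSection b X := by
      refine p.le_of_forall fun V f y => ?_
      change p.sec y ⊓ (diagSection L x).pull f ≤ (constSection b X).pull f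
      rw [inf_comm, diagSection_pull, constSection_pull, diagSection_inf_le_iff,
        constSection_app_id]
      exact h f y
    have h2 := (diagSection_inf_le_iff (x := x) (s := ⊤) (t := constSection b X)).1
      (inf_le_left.trans h1)
    rwa [constSection_app_id] at h2
  single U x y y' h := by
    -- Apart elements agree only at stages covered by the empty sieve, where every inequality holds.
    have h1 : p.sec y ⊓ p.sec y' ≤ constSection ⊥ X :=
      p.disjoint y y' _ fun V f hf => IFrame.le_of_bot_mem _ (h f hf) _ _
    have h2 := h1 (𝟙 U) x
    rwa [constSection_app_id] at h2

end Universal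

/-! ### Values of clopens in a Boolean algebra that satisfies the relations. -/

section BooleanPresentation

/-- The join of a finite list of elements. -/
def join {α β : Type*} [SemilatticeSup β] [OrderBot β] (F : α → β) (l : List α) : β :=
  l.foldr (fun a b => F a ⊔ b) ⊥

section

variable {α β γ : Type*} [SemilatticeSup β] [OrderBot β] [SemilatticeSup γ] [OrderBot γ]

theorem join_cons (F : α → β) (a : α) (l : List α) : join F (a :: l) = F a ⊔ join F l := rfl

theorem join_le_iff {F : α → β} {l : List α} {b : β} : join F l ≤ b ↔ ∀ a ∈ l, F a ≤ b := by
  induction l with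
  | nil => simp [join]
  | cons a l ih => simp [join_cons, ih]

theorem le_join (F : α → β) {l : List α} {a : α} (h : a ∈ l) : F a ≤ join F l :=
  join_le_iff.1 le_rfl a h

theorem join_mono (F : α → β) {l l' : List α} (h : l ⊆ l') : join F l ≤ join F l' :=
  join_le_iff.2 fun _ ha => le_join F (h ha)

theorem map_join {S : Type*} [FunLike S β γ] [SupBotHomClass S β γ] (φ : S) (F : α → β)
    (l : List α) : φ (join F l) = join (fun a => φ (F a)) l := by
  induction l with
  | nil => simp [join]
  | cons a l ih => simp [join_cons, ih]

theorem join_map {α' : Type*} (F : α → β) (k : α' → α) (l : List α') :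
    join F (l.map k) = join (fun a => F (k a)) l := by
  induction l with
  | nil => rfl
  | cons a l ih => rw [List.map_cons, join_cons, join_cons, ih]

end

variable {C : Type u} [SmallCategory C] {J : GrothendieckTopology C} {X Y : Sheaf J (Type u)}

namespace Generators

variable {A : IBool J} (δ : Generators X Y A) {U V : C}

theorem elt_map (f : V ⟶ U) (x : X.obj.obj (op U)) (y : Y.obj.obj (op U)) :
    δ.elt (X.obj.map f.op x) (Y.obj.map f.op y) = A.obj.map f.op (δ.elt x y) := by
  let p : X.obj.obj (op U) × Y.obj.obj (op U) := (x, y)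
  have h := ConcreteCategory.congr_hom (δ.naturality f.op) p
  exact h

/-- The meet of the generators in a word. -/
def word (l : Word X.obj Y.obj U) : A.obj.obj (op U) := meet (fun p => δ.elt p.1 p.2) l

theorem word_wres (f : V ⟶ U) (l : Word X.obj Y.obj U) :
    δ.word (wres f l) = A.obj.map f.op (δ.word l) := by
  rw [word, word, wres, meet_map]
  refine Eq.trans ?_ (map_meet (A.obj.map f.op).hom _ l).symm
  exact congrArg (meet · l) (funext fun p => δ.elt_map f p.1 p.2)

theorem word_cons (x : X.obj.obj (op U)) (y : Y.obj.obj (op U)) (l : Word X.obj Y.obj U) :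
    δ.word ((x, y) :: l) = δ.elt x y ⊓ δ.word l := rfl

theorem word_append (l l' : Word X.obj Y.obj U) : δ.word (l ++ l') = δ.word l ⊓ δ.word l' :=
  meet_append _ l l'

variable {δ}

/-- Every `y` is locally in an exhausting list, so the finite join is an upper bound of all
generators over `x`, and `total` applies to it. -/
theorem top_le_join (hδ : SatisfiesRelations δ) (x : X.obj.obj (op U))
    {l : List (Y.obj.obj (op U))} (hl : Exhausts J l) : ⊤ ≤ join (fun y => δ.elt x y) l := by
  refine hδ.total x _ fun V f y => ?_
  obtain ⟨R, hR, h⟩ := hl f y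
  refine A.le_of_cover hR fun W g hg => ?_
  obtain ⟨z, hz, e⟩ := h g hg
  rw [← δ.elt_map, e, map_map_type, map_map_bool, δ.elt_map]
  exact bool_map_mono _ _ (le_join (fun y => δ.elt x y) hz)

/-- The graph open corresponding to an ideal. -/
def pre (hY : IsDecFinite J Y.obj) (hδ : SatisfiesRelations δ) (I : Idl A U) :
    GraphOpen J X.obj Y.obj U :=
  GraphOpen.mk' (fun _ f l => I.Mem f (δ.word l))
    (fun V f l h W g => by
      rw [δ.word_wres]
      exact I.mem_restrict f h g)
    (fun V f l R hR h => I.mem_local f hR fun W g hg => by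
      rw [← δ.word_wres]
      exact h g hg)
    (fun V f l l' hl h => I.mem_of_le f (meet_anti _ hl) h)
    (fun V f l x h => by
      -- Finiteness enters here: on a cover, totality is a join over a finite list, and ideals are
      -- closed under finite joins.
      refine I.mem_local f (hY.fin V) fun W g ⟨zs, hzs⟩ => ?_
      rw [← δ.word_wres]
      have key : ∀ zs : List (Y.obj.obj (op W)), I.Mem (g ≫ f)
          (join (fun z => δ.elt (X.obj.map g.op x) z) zs ⊓ δ.word (wres g l)) := by
        intro zs
        induction zs with
        | nil => exact I.mem_of_le _ inf_le_left (I.mem_bot _)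
        | cons z zs ih =>
          rw [join_cons, inf_sup_right]
          exact I.mem_sup _ (h g z) ih
      refine I.mem_of_le _ (le_inf ?_ le_rfl) (key zs)
      exact le_top.trans (top_le_join hδ _ hzs))
    (fun V f l x y y' h => by
      rw [δ.word_cons, δ.word_cons, ← inf_assoc]
      exact I.mem_of_le f (inf_le_left.trans (hδ.single x y y' h)) (I.mem_bot f))

variable (hY : IsDecFinite J Y.obj) (hδ : SatisfiesRelations δ)

theorem mem_pre {I : Idl A U} {f : V ⟶ U} {l : Word X.obj Y.obj V} :
    (pre hY hδ I).Mem f l ↔ I.Mem f (δ.word l) := Iff.rfl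

/-- Compactness of the space of graphs: the top open contains the empty word, whose value is `⊤`. -/
theorem mem_top_of_pre_eq_top {I : Idl A U} (h : ⊤ ≤ pre hY hδ I) : I.Mem (𝟙 U) ⊤ :=
  h (𝟙 U) ([] : Word X.obj Y.obj U) trivial

/-- The graph open of words whose value is below `a`. -/
def below (a : A.obj.obj (op U)) : GraphOpen J X.obj Y.obj U := pre hY hδ (Idl.principal a)

theorem mem_below {a : A.obj.obj (op U)} {f : V ⟶ U} {l : Word X.obj Y.obj V} :
    (below hY hδ a).Mem f l ↔ δ.word l ≤ A.obj.map f.op a := Iff.rfl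

theorem below_pull (a : A.obj.obj (op U)) (f : V ⟶ U) :
    (below hY hδ a).pull f = below hY hδ (A.obj.map f.op a) :=
  GraphOpen.ext_mem fun W g l => by
    rw [GraphOpen.mem_pull, mem_below, mem_below, map_map_bool]

theorem below_mono {a b : A.obj.obj (op U)} (h : a ≤ b) : below hY hδ a ≤ below hY hδ b :=
  fun _ f l (hl : δ.word l ≤ _) => hl.trans (bool_map_mono _ f h)

theorem below_inf (a b : A.obj.obj (op U)) :
    below hY hδ (a ⊓ b) = below hY hδ a ⊓ below hY hδ b :=
  GraphOpen.ext_mem fun W g l => by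
    rw [GraphOpen.mem_inf, mem_below, mem_below, mem_below, map_inf, le_inf_iff]

theorem eq_top_of_below {a : A.obj.obj (op U)} (h : ⊤ ≤ below hY hδ a) : ⊤ ≤ a := by
  have := mem_top_of_pre_eq_top hY hδ h
  rw [Idl.mem_principal] at this
  simpa using this

/-- `a` is the image of the clopen `c` under the homomorphism determined by `δ`. -/
def Represents (c : Complementeds (GraphOpen J X.obj Y.obj U)) (a : A.obj.obj (op U)) : Prop :=
  c.1 ≤ below hY hδ a ∧ (cᶜ).1 ≤ below hY hδ aᶜ

theorem compl_sup_coe (c : Complementeds (GraphOpen J X.obj Y.obj U)) : c.1 ⊔ (cᶜ).1 = ⊤ :=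
  congrArg Subtype.val (sup_compl_eq_top (x := c))

theorem inf_compl_coe (c : Complementeds (GraphOpen J X.obj Y.obj U)) : c.1 ⊓ (cᶜ).1 = ⊥ :=
  congrArg Subtype.val (inf_compl_eq_bot (a := c))

/-- Restriction of clopens. -/
noncomputable def cpull (f : V ⟶ U) (c : Complementeds (GraphOpen J X.obj Y.obj U)) :
    Complementeds (GraphOpen J X.obj Y.obj V) := complMap (GraphOpen.pullHom f) c

theorem cpull_coe (f : V ⟶ U) (c : Complementeds (GraphOpen J X.obj Y.obj U)) :
    (cpull f c).1 = c.1.pull f := rfl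

theorem cpull_compl_coe (f : V ⟶ U) (c : Complementeds (GraphOpen J X.obj Y.obj U)) :
    ((cpull f c)ᶜ).1 = (cᶜ).1.pull f :=
  congrArg Subtype.val (map_compl' (complMap (GraphOpen.pullHom f)) c).symm

variable {hY hδ} {c d : Complementeds (GraphOpen J X.obj Y.obj U)} {a b : A.obj.obj (op U)}

/-- The clopen `c` and its complement cover, and both lie in `below (aᶜ ⊔ b)`; compactness turns
this into `⊤ ≤ aᶜ ⊔ b`. -/
theorem Represents.le (ha : Represents hY hδ c a) (hb : Represents hY hδ c b) : a ≤ b := by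
  have h : ⊤ ≤ below hY hδ (aᶜ ⊔ b) := by
    rw [← compl_sup_coe c]
    exact sup_le (hb.1.trans (below_mono _ _ le_sup_right))
      (ha.2.trans (below_mono _ _ le_sup_left))
  have h' := eq_top_of_below _ _ h
  rw [top_le_iff, sup_comm, ← himp_eq, himp_eq_top_iff] at h'
  exact h'

theorem Represents.unique (ha : Represents hY hδ c a) (hb : Represents hY hδ c b) : a = b :=
  le_antisymm (ha.le hb) (hb.le ha)

theorem Represents.pull (h : Represents hY hδ c a) (f : V ⟶ U) :
    Represents hY hδ (cpull f c) (A.obj.map f.op a) := by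
  refine ⟨?_, ?_⟩
  · rw [cpull_coe, ← below_pull]
    exact fun W g => h.1 (g ≫ f)
  · rw [cpull_compl_coe, ← map_compl', ← below_pull]
    exact fun W g => h.2 (g ≫ f)

theorem Represents.compl (h : Represents hY hδ c a) : Represents hY hδ cᶜ aᶜ := by
  refine ⟨h.2, ?_⟩
  rw [compl_compl, compl_compl]
  exact h.1

theorem Represents.inf (h : Represents hY hδ c a) (h' : Represents hY hδ d b) :
    Represents hY hδ (c ⊓ d) (a ⊓ b) := by
  refine ⟨?_, ?_⟩
  · rw [below_inf]
    exact inf_le_inf h.1 h'.1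
  · rw [compl_inf, compl_inf]
    exact sup_le (h.2.trans (below_mono _ _ le_sup_left))
      (h'.2.trans (below_mono _ _ le_sup_right))

theorem Represents.sup (h : Represents hY hδ c a) (h' : Represents hY hδ d b) :
    Represents hY hδ (c ⊔ d) (a ⊔ b) := by
  simpa using (h.compl.inf h'.compl).compl

theorem represents_top : Represents hY hδ (⊤ : Complementeds (GraphOpen J X.obj Y.obj U)) ⊤ := by
  refine ⟨fun V f l _ => (mem_below hY hδ).2 ?_, ?_⟩
  · rw [map_top]
    exact le_top
  · rw [compl_top]
    exact (bot_le : (⊥ : GraphOpen J X.obj Y.obj U) ≤ _)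

theorem represents_bot : Represents hY hδ (⊥ : Complementeds (GraphOpen J X.obj Y.obj U)) ⊥ := by
  simpa using (represents_top (hY := hY) (hδ := hδ) (U := U)).compl

/-- The concatenated word lies in the least graph open, hence in `below ⊥`. -/
theorem word_inf_word_eq_bot (hY : IsDecFinite J Y.obj) (hδ : SatisfiesRelations δ) {f : V ⟶ U}
    {l m : Word X.obj Y.obj V} (hl : c.1.Mem f l)
    (hm : (cᶜ).1.Mem f m) : δ.word l ⊓ δ.word m ≤ ⊥ := by
  have h : (c.1 ⊓ (cᶜ).1).Mem f (l ++ m) :=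
    ⟨GraphOpen.mem_mono _ f (List.subset_append_left _ _) hl,
      GraphOpen.mem_mono _ f (List.subset_append_right _ _) hm⟩
  rw [inf_compl_coe] at h
  have h' := (bot_le : ⊥ ≤ below hY hδ ⊥) f _ h
  change δ.word (l ++ m) ≤ A.obj.map f.op ⊥ at h'
  rwa [map_bot, word_append] at h'

variable (δ c) in
/-- The ideal generated by the values of the words in `c` and in its complement. -/
def splitIdeal : Idl A U :=
  Idl.mkLocal (fun V f a => ∃ l m : List (Word X.obj Y.obj V), (∀ w ∈ l, c.1.Mem f w) ∧
      (∀ w ∈ m, (cᶜ).1.Mem f w) ∧ a ≤ join δ.word l ⊔ join δ.word m)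
    (by
      rintro V f a ⟨l, m, hl, hm, h⟩ W g
      refine ⟨l.map (wres g), m.map (wres g), ?_, ?_, ?_⟩
      · intro w hw
        obtain ⟨w', hw', rfl⟩ := List.mem_map.1 hw
        exact GraphOpen.mem_restrict _ f (hl w' hw') g
      · intro w hw
        obtain ⟨w', hw', rfl⟩ := List.mem_map.1 hw
        exact GraphOpen.mem_restrict _ f (hm w' hw') g
      · have h' := bool_map_mono A.obj g h
        rw [map_sup] at h'
        refine h'.trans_eq (congrArg₂ _ ?_ ?_)
        all_goals
          refine (map_join (A.obj.map g.op).hom _ _).trans ?_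
          rw [join_map]
          exact congrArg (join · _) (funext fun w => (δ.word_wres g w).symm))
    (fun _ _ => ⟨[], [], by simp, by simp, bot_le⟩)
    (by
      rintro V f a b hab ⟨l, m, hl, hm, h⟩
      exact ⟨l, m, hl, hm, hab.trans h⟩)
    (by
      rintro V f a b ⟨l, m, hl, hm, h⟩ ⟨l', m', hl', hm', h'⟩
      refine ⟨l ++ l', m ++ m', ?_, ?_, sup_le (h.trans (sup_le_sup ?_ ?_))
        (h'.trans (sup_le_sup ?_ ?_))⟩
      · exact fun w hw => (List.mem_append.1 hw).elim (hl w) (hl' w)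
      · exact fun w hw => (List.mem_append.1 hw).elim (hm w) (hm' w)
      · exact join_mono _ (List.subset_append_left _ _)
      · exact join_mono _ (List.subset_append_left _ _)
      · exact join_mono _ (List.subset_append_right _ _)
      · exact join_mono _ (List.subset_append_right _ _))

/-- The words of `c` and of its complement cover, so compactness gives, on a cover of the stage,
finitely many of each whose values join to `⊤`. Values from the two sides are disjoint, so the two
finite joins are complementary. -/
theorem exists_local_represents (hY : IsDecFinite J Y.obj) (hδ : SatisfiesRelations δ)
    (c : Complementeds (GraphOpen J X.obj Y.obj U)) :
    ∃ R ∈ J U, ∀ ⦃V : C⦄ (f : V ⟶ U), R f → ∃ a, Represents hY hδ (cpull f c) a := by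
  have h : ⊤ ≤ pre hY hδ (splitIdeal δ c) := by
    rw [← compl_sup_coe c]
    refine sup_le (fun V f (l : Word X.obj Y.obj V) hl => ?_)
      (fun V f (l : Word X.obj Y.obj V) hl => ?_)
    · exact LocalFamily.subset_closure
        ⟨[l], [], List.forall_mem_singleton.2 hl, by simp,
          le_sup_of_le_left (le_join δ.word (by simp))⟩
    · exact LocalFamily.subset_closure
        ⟨[], [l], by simp, List.forall_mem_singleton.2 hl,
          le_sup_of_le_right (le_join δ.word (by simp))⟩
  obtain ⟨R, hR, h⟩ := mem_top_of_pre_eq_top hY hδ h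
  refine ⟨R, hR, fun V f hf => ?_⟩
  obtain ⟨l, m, hl, hm, h⟩ := h f hf
  change A.obj.map f.op ⊤ ≤ _ at h
  rw [map_top] at h
  simp only [Category.comp_id] at hl hm
  -- The representative is the join over the chosen words of `c`. Any word of `c` is disjoint from
  -- every word in `m`, so its value must lie below that join.
  refine ⟨join δ.word l, ?_, ?_⟩
  · intro W g w hw
    change δ.word w ≤ A.obj.map g.op _
    have h' := bool_map_mono A.obj g h
    rw [map_top, map_sup] at h'
    have h1 : δ.word w ⊓ A.obj.map g.op (join δ.word m) ≤ ⊥ := by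
      rw [show A.obj.map g.op (join δ.word m) = _ from map_join (A.obj.map g.op).hom _ _,
        inf_comm, ← le_himp_iff, join_le_iff]
      intro v hv
      rw [le_himp_iff, inf_comm]
      refine (inf_le_inf_left _ (δ.word_wres g v).ge).trans ?_
      exact word_inf_word_eq_bot hY hδ (f := g ≫ f) (c := c) hw
        (GraphOpen.mem_restrict _ _ (hm v hv) g)
    calc δ.word w ≤ δ.word w ⊓ (A.obj.map g.op (join δ.word l) ⊔
          A.obj.map g.op (join δ.word m)) := le_inf le_rfl (le_top.trans h')
      _ ≤ _ := by
        rw [inf_sup_left]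
        exact sup_le inf_le_right (h1.trans bot_le)
  -- A word of the complement is disjoint from each word in `l`, hence from the join.
  · intro W g w hw
    rw [cpull_compl_coe] at hw
    change δ.word w ≤ A.obj.map g.op _
    rw [map_compl', le_compl_iff_disjoint_right, disjoint_iff_inf_le,
      show A.obj.map g.op (join δ.word l) = _ from map_join (A.obj.map g.op).hom _ _,
      inf_comm, ← le_himp_iff, join_le_iff]
    intro v hv
    rw [le_himp_iff]
    refine (inf_le_inf_right _ (δ.word_wres g v).ge).trans ?_
    exact word_inf_word_eq_bot hY hδ (f := g ≫ f) (c := c)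
      (GraphOpen.mem_restrict _ _ (hl v hv) g) hw

/-- Local representatives are unique, hence compatible, and they glue; being a representative is
itself a local condition. -/
theorem exists_represents (hY : IsDecFinite J Y.obj) (hδ : SatisfiesRelations δ)
    (c : Complementeds (GraphOpen J X.obj Y.obj U)) : ∃ a, Represents hY hδ c a := by
  obtain ⟨R, hR, h⟩ := exists_local_represents hY hδ c
  choose a ha using h
  have hcomp : ∀ ⦃V W : C⦄ (f : V ⟶ U) (g : W ⟶ V), cpull g (cpull f c) = cpull (g ≫ f) c := by
    intro V W f g
    refine Subtype.ext (GraphOpen.ext_mem fun W' k l => ?_)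
    simp [cpull_coe]
  let z : Presieve.FamilyOfElements (A.obj ⋙ forget BoolAlg) R.arrows := a
  obtain ⟨b, hb, -⟩ := A.isSheaf R hR z (by
    rw [Presieve.compatible_iff_sieveCompatible]
    intro V W f g hf
    have h1 := (ha f hf).pull g
    rw [hcomp] at h1
    exact (ha (g ≫ f) (R.downward_closed hf g)).unique h1)
  change A.obj.obj (op U) at b
  have hb : ∀ ⦃V : C⦄ (f : V ⟶ U) (hf : R f), A.obj.map f.op b = a f hf := hb
  refine ⟨b, ?_, ?_⟩
  · intro V f (w : Word X.obj Y.obj V) hw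
    refine GraphOpen.mem_local _ f (J.pullback_stable f hR) fun W g (hg : R (g ≫ f)) => ?_
    have h1 := (ha (g ≫ f) hg).1 (𝟙 W) (wres g w) (by
      rw [cpull_coe]
      exact (GraphOpen.mem_pull_id _ _ _).2 (GraphOpen.mem_restrict _ f hw g))
    rw [← hb, ← below_pull] at h1
    exact (GraphOpen.mem_pull_id _ _ _).1 h1
  · intro V f (w : Word X.obj Y.obj V) hw
    refine GraphOpen.mem_local _ f (J.pullback_stable f hR) fun W g (hg : R (g ≫ f)) => ?_
    have h1 := (ha (g ≫ f) hg).2 (𝟙 W) (wres g w) (by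
      rw [cpull_compl_coe]
      exact (GraphOpen.mem_pull_id _ _ _).2 (GraphOpen.mem_restrict _ f hw g))
    rw [← hb, ← map_compl', ← below_pull] at h1
    exact (GraphOpen.mem_pull_id _ _ _).1 h1

end Generators

end BooleanPresentation

/-! ### The clopens of the graph locale, and why it is Stone. -/

section Exponential

variable {C : Type u} [SmallCategory C] {J : GrothendieckTopology C}

section

variable {X Y : Cᵒᵖ ⥤ Type u} {U V : C}

/-- The complement is the pseudocomplement. That the two cover is seen by totality at the same `x`,
which introduces a value `y'`, and by decidability, which compares `y'` with `y`. -/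
theorem GraphOpen.isCompl_gen (hY : IsDecFinite J Y) (x : X.obj (op U)) (y : Y.obj (op U)) :
    IsCompl (gen J x y) (shift ⊥ [(x, y)]) := by
  refine ⟨disjoint_iff_inf_le.2 (principal_inf_le_iff.2 le_rfl), codisjoint_iff.2 ?_⟩
  refine eq_top_iff_nil.2 (mem_total _ _ x fun V f y' => ?_)
  rw [Category.comp_id]
  refine mem_local _ f (hY.dec (Y.map f.op y) y') fun W g hg => ?_
  rw [wres_nil, wres_cons, wres_nil]
  rcases hg with hg | hg
  · refine (le_sup_left : gen J x y ≤ _) _ _ ?_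
    rw [← hg]
    exact mem_restrict _ f (by
      have := mem_restrict _ _ (mem_principal_self (J := J) [(x, y)]) f
      rwa [Category.comp_id] at this) g
  · refine (le_sup_right : shift ⊥ [(x, y)] ≤ _) _ _ (mem_shift.2 ?_)
    refine mem_single _ _ hg (x := X.map g.op (X.map f.op x)) ?_ (by simp)
    simp

/-- The clopen `{θ | θ x = y}`. -/
def genClopen (hY : IsDecFinite J Y) (x : X.obj (op U)) (y : Y.obj (op U)) :
    Complementeds (GraphOpen J X Y U) :=
  ⟨GraphOpen.gen J x y, _, GraphOpen.isCompl_gen hY x y⟩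

end

variable {X Y : Sheaf J (Type u)} {U V : C}

variable (X Y) in
/-- The locale of functional graphs in `X × Y`. -/
def graphLocale : ILocale J := op (graphFrame J X.obj Y.obj)

/-- The generating clopens. -/
def clopenGenerators (X : Sheaf J (Type u)) {Y : Sheaf J (Type u)} (hY : IsDecFinite J Y.obj) :
    Generators X Y (Clop (graphLocale X Y)) where
  app U := ↾fun p : X.obj.obj U × Y.obj.obj U =>
    (genClopen hY p.1 p.2 : Complementeds (GraphOpen J X.obj Y.obj U.unop))
  naturality U V f := by
    refine ConcreteCategory.hom_ext _ _ fun (p : X.obj.obj U × Y.obj.obj U) => ?_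
    exact Subtype.ext (GraphOpen.pull_gen f.unop p.1 p.2).symm

/-- A section of the Boolean algebra of clopens, as a complemented graph open. -/
def toCompl (c : (Clop (graphLocale X Y)).obj.obj (op U)) :
    Complementeds (GraphOpen J X.obj Y.obj U) := c

theorem toCompl_le_iff {c d : (Clop (graphLocale X Y)).obj.obj (op U)} :
    c ≤ d ↔ (toCompl c).1 ≤ (toCompl d).1 := Iff.rfl

theorem toCompl_map (f : V ⟶ U) (c : (Clop (graphLocale X Y)).obj.obj (op U)) :
    (toCompl ((Clop (graphLocale X Y)).obj.map f.op c)).1 = (toCompl c).1.pull f := rfl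

/-- A clopen upper bound is in particular an open one, so the relations of the generic graph pass
from the frame to its clopens. -/
theorem clopenGenerators_relations (hY : IsDecFinite J Y.obj) :
    SatisfiesRelations (clopenGenerators X hY) where
  total _ x b h := (GraphData.generic J X.obj Y.obj).total x (toCompl b).1 fun _ f y => h f y
  single _ x y y' h := (GraphData.generic J X.obj Y.obj).single x y y' h

theorem toCompl_word (hY : IsDecFinite J Y.obj) (l : Word X.obj Y.obj U) :
    (toCompl ((clopenGenerators X hY).word l)).1 = GraphOpen.principal J l := by
  rw [← GraphOpen.meet_gen]
  induction l with
  | nil => rfl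
  | cons p l ih =>
    rw [meet_cons, ← ih]
    rfl

/-- The ideal of clopens contained in a graph open. -/
noncomputable def clopensBelow (c : GraphOpen J X.obj Y.obj U) : Idl (Clop (graphLocale X Y)) U :=
  Idl.mk' (fun _ f d => (toCompl d).1 ≤ c.pull f)
    (fun V f d h W g => by
      rw [toCompl_map]
      exact fun W' k l hl => by
        have := h (k ≫ g) l hl
        change c.Mem ((k ≫ g) ≫ f) l at this
        rwa [Category.assoc] at this)
    (fun V f d R hR h W g l hl => by
      change c.Mem (g ≫ f) l
      refine c.mem_local _ (J.pullback_stable g hR) fun W' k hk => ?_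
      have := h (k ≫ g) hk (𝟙 W') (wres k l) (by
        rw [toCompl_map]
        exact (GraphOpen.mem_pull_id _ _ _).2 (GraphOpen.mem_restrict _ g hl k))
      have := (GraphOpen.mem_pull_id _ _ _).1 this
      rwa [Category.assoc] at this)
    (fun _ _ => bot_le (α := GraphOpen J X.obj Y.obj _))
    (fun _ _ _ _ h h' => (toCompl_le_iff.1 h).trans h')
    (fun _ _ _ _ h h' => sup_le (α := GraphOpen J X.obj Y.obj _) h h')

theorem mem_clopensBelow {c : GraphOpen J X.obj Y.obj U} {f : V ⟶ U}
    {d : (Clop (graphLocale X Y)).obj.obj (op V)} :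
    (clopensBelow c).Mem f d ↔ (toCompl d).1 ≤ c.pull f := Iff.rfl

/-- A word lies in an open exactly when the clopen it generates lies below that open, so an open is
recovered from its clopens. -/
theorem pre_clopensBelow (hY : IsDecFinite J Y.obj) (c : GraphOpen J X.obj Y.obj U) :
    Generators.pre hY (clopenGenerators_relations hY) (clopensBelow c) = c :=
  GraphOpen.ext_mem fun V f l => by
    rw [Generators.mem_pre, mem_clopensBelow, toCompl_word, GraphOpen.mem_iff_principal_le]

/-- The ideal of elements whose meet with `d` lies in `I`. -/
def Idl.colon {A : IBool J} (I : Idl A U) (d : A.obj.obj (op U)) : Idl A U :=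
  Idl.mk' (fun _ f e => I.Mem f (e ⊓ A.obj.map f.op d))
    (fun V f e h W g => by
      have := I.mem_restrict f h g
      rwa [map_inf, map_map_bool] at this)
    (fun V f e R hR h => I.mem_local f hR fun W g hg => by
      rw [map_inf, map_map_bool]
      exact h g hg)
    (fun V f => I.mem_of_le f inf_le_left (I.mem_bot f))
    (fun V f a b h hb => I.mem_of_le f (inf_le_inf_right _ h) hb)
    (fun V f a b ha hb => by
      rw [inf_sup_right]
      exact I.mem_sup f ha hb)

/-- The hard direction is compactness for a colon ideal: if `d` lies below the open of `I`, then
both `d` and its complement lie below the open of `I.colon d`, so this ideal contains `⊤`. -/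
theorem le_pre_iff (hY : IsDecFinite J Y.obj) (I : Idl (Clop (graphLocale X Y)) U)
    (d : (Clop (graphLocale X Y)).obj.obj (op U)) :
    (toCompl d).1 ≤ Generators.pre hY (clopenGenerators_relations hY) I ↔ I.Mem (𝟙 U) d := by
  have key : ∀ (I : Idl (Clop (graphLocale X Y)) U) (d), I.Mem (𝟙 U) d →
      (toCompl d).1 ≤ Generators.pre hY (clopenGenerators_relations hY) I := by
    intro I d h V f (l : Word X.obj Y.obj V) hl
    have h1 := I.mem_restrict _ h f
    rw [Category.comp_id] at h1
    refine I.mem_of_le f ?_ h1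
    rw [toCompl_le_iff, toCompl_word, toCompl_map]
    exact GraphOpen.mem_iff_principal_le.1 hl
  refine ⟨fun h => ?_, key I d⟩
  have h1 : ⊤ ≤ Generators.pre hY (clopenGenerators_relations hY) (I.colon d) := by
    rw [← Generators.compl_sup_coe (toCompl d)]
    refine sup_le (h.trans ?_) (key (I.colon d) dᶜ ?_)
    · exact fun V f l hl => I.mem_of_le f inf_le_left hl
    · change I.Mem (𝟙 U) (dᶜ ⊓ (Clop (graphLocale X Y)).obj.map (𝟙 U).op d)
      rw [op_id, CategoryTheory.Functor.map_id]
      exact I.mem_of_le _ (compl_inf_eq_bot (a := d)).le (I.mem_bot _)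
  have h2 : I.Mem (𝟙 U) (⊤ ⊓ (Clop (graphLocale X Y)).obj.map (𝟙 U).op d) :=
    Generators.mem_top_of_pre_eq_top hY (clopenGenerators_relations hY) h1
  rw [op_id, CategoryTheory.Functor.map_id, top_inf_eq] at h2
  exact h2

theorem clopensBelow_pre (hY : IsDecFinite J Y.obj) (I : Idl (Clop (graphLocale X Y)) U) :
    clopensBelow (Generators.pre hY (clopenGenerators_relations hY) I) = I := by
  have h : ∀ ⦃V : C⦄ (f : V ⟶ U) (d : (Clop (graphLocale X Y)).obj.obj (op V)),
      (clopensBelow (Generators.pre hY (clopenGenerators_relations hY) I)).Mem f d ↔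
        I.Mem f d := by
    intro V f d
    rw [mem_clopensBelow, ← I.mem_pull_id, ← le_pre_iff hY]
    rfl
  exact le_antisymm (fun V f d => (h f d).1) (fun V f d => (h f d).2)

theorem isStone_graphLocale (X : Sheaf J (Type u)) (hY : IsDecFinite J Y.obj) :
    IsStone (graphLocale X Y) := by
  refine ⟨Clop (graphLocale X Y), fun U =>
    { toFun := fun c => clopensBelow (X := X) (Y := Y) (U := U) c
      invFun := fun I => Generators.pre hY (clopenGenerators_relations hY) I
      left_inv := pre_clopensBelow hY
      right_inv := clopensBelow_pre hY
      map_rel_iff' := fun {c d} => ?_ }, fun U V h c => ?_⟩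
  · change GraphOpen J X.obj Y.obj U at c d
    change clopensBelow c ≤ clopensBelow d ↔ c ≤ d
    constructor
    · intro h
      rw [← pre_clopensBelow hY c, ← pre_clopensBelow hY d]
      exact fun V f l hl => h f _ hl
    · exact fun h V f e he W g l hl => h _ l (he g l hl)
  · change GraphOpen J X.obj Y.obj U at c
    refine Subtype.ext (LocalFamily.ext_mem fun W f d => ?_)
    change (toCompl d).1 ≤ (c.pull h).pull f ↔ (toCompl d).1 ≤ c.pull (f ≫ h)
    have e : (c.pull h).pull f = c.pull (f ≫ h) := GraphOpen.ext_mem fun V f l => by simp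
    rw [e]

/-! ### The universal property of the Boolean algebra of clopens. -/

section Presentation

variable {A : IBool J} {δ : Generators X Y A}

/-- The value at a clopen of the homomorphism determined by `δ`. -/
noncomputable def clopenVal (hY : IsDecFinite J Y.obj) (hδ : SatisfiesRelations δ)
    (c : Complementeds (GraphOpen J X.obj Y.obj U)) : A.obj.obj (op U) :=
  (Generators.exists_represents hY hδ c).choose

theorem represents_clopenVal (hY : IsDecFinite J Y.obj) (hδ : SatisfiesRelations δ)
    (c : Complementeds (GraphOpen J X.obj Y.obj U)) :
    Generators.Represents hY hδ c (clopenVal hY hδ c) :=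
  (Generators.exists_represents hY hδ c).choose_spec

theorem represents_genClopen (hY : IsDecFinite J Y.obj) (hδ : SatisfiesRelations δ)
    (x : X.obj.obj (op U)) (y : Y.obj.obj (op U)) :
    Generators.Represents hY hδ (genClopen hY x y) (δ.elt x y) := by
  constructor
  · refine GraphOpen.principal_le_iff.2 ((Generators.mem_below hY hδ).2 ?_)
    rw [δ.word_cons, op_id, CategoryTheory.Functor.map_id]
    exact inf_le_left
  -- A word of the complement becomes contradictory once `(x, y)` is appended, so its value is
  -- disjoint from `δ.elt x y`.
  · have h : ((genClopen hY x y)ᶜ).1 ≤ GraphOpen.shift ⊥ [(x, y)] :=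
      GraphOpen.principal_inf_le_iff.1 (Generators.inf_compl_coe (genClopen hY x y)).le
    intro V f (l : Word X.obj Y.obj V) hl
    have h1 := (bot_le : ⊥ ≤ Generators.below hY hδ ⊥) f _ (GraphOpen.mem_shift.1 (h f l hl))
    have h2 := (Generators.mem_below hY hδ).1 h1
    rw [δ.word_append, wres_cons, δ.word_cons, δ.elt_map, map_bot] at h2
    refine (Generators.mem_below hY hδ).2 ?_
    rw [map_compl', le_compl_iff_disjoint_right, disjoint_iff_inf_le]
    exact (inf_le_inf_left _ (le_inf le_rfl le_top)).trans h2

/-- The homomorphism from the clopens determined by `δ`. -/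
noncomputable def clopenHom (hY : IsDecFinite J Y.obj) (hδ : SatisfiesRelations δ) :
    (Clop (graphLocale X Y)).obj ⟶ A.obj where
  app U := BoolAlg.ofHom
    { toFun := fun c : Complementeds (GraphOpen J X.obj Y.obj U.unop) => clopenVal hY hδ c
      map_sup' := fun c d => (represents_clopenVal hY hδ (c ⊔ d)).unique
        ((represents_clopenVal hY hδ c).sup (represents_clopenVal hY hδ d))
      map_inf' := fun c d => (represents_clopenVal hY hδ (c ⊓ d)).unique
        ((represents_clopenVal hY hδ c).inf (represents_clopenVal hY hδ d))
      map_top' := (represents_clopenVal hY hδ ⊤).unique Generators.represents_top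
      map_bot' := (represents_clopenVal hY hδ ⊥).unique Generators.represents_bot }
  naturality U V f := by
    apply BoolAlg.hom_ext
    refine DFunLike.ext _ _ fun (c : Complementeds (GraphOpen J X.obj Y.obj U.unop)) => ?_
    exact (represents_clopenVal hY hδ (Generators.cpull f.unop c)).unique
      ((represents_clopenVal hY hδ c).pull f.unop)

/-- A homomorphism extending `δ` is determined on words, and the words in a clopen are themselves
clopens below it. -/
theorem hom_le_below (hY : IsDecFinite J Y.obj) (hδ : SatisfiesRelations δ)
    (φ : (Clop (graphLocale X Y)).obj ⟶ A.obj)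
    (hφ : ∀ ⦃U : C⦄ (x : X.obj.obj (op U)) (y : Y.obj.obj (op U)),
      φ.app (op U) ((clopenGenerators X hY).elt x y) = δ.elt x y)
    (c : (Clop (graphLocale X Y)).obj.obj (op U)) :
    (toCompl c).1 ≤ Generators.below hY hδ (φ.app (op U) c) := by
  intro V f (l : Word X.obj Y.obj V) hl
  refine (Generators.mem_below hY hδ).2 ?_
  have h1 : (clopenGenerators X hY).word l ≤ (Clop (graphLocale X Y)).obj.map f.op c := by
    rw [toCompl_le_iff, toCompl_word, toCompl_map]
    exact GraphOpen.mem_iff_principal_le.1 hl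
  have h2 : φ.app (op V) ((clopenGenerators X hY).word l) = δ.word l :=
    (map_meet (φ.app (op V)).hom _ l).trans
      (congrArg (meet · l) (funext fun p => hφ p.1 p.2))
  have h3 : φ.app (op V) ((Clop (graphLocale X Y)).obj.map f.op c) =
      A.obj.map f.op (φ.app (op U) c) := NatTrans.naturality_apply φ f.op c
  rw [← h2, ← h3]
  exact OrderHomClass.mono (φ.app (op V)).hom h1

/-- The bound for `c` and the one for its complement together pin down the value; this yields
uniqueness of the homomorphism. -/
theorem represents_hom (hY : IsDecFinite J Y.obj) (hδ : SatisfiesRelations δ)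
    (φ : (Clop (graphLocale X Y)).obj ⟶ A.obj)
    (hφ : ∀ ⦃U : C⦄ (x : X.obj.obj (op U)) (y : Y.obj.obj (op U)),
      φ.app (op U) ((clopenGenerators X hY).elt x y) = δ.elt x y)
    (c : (Clop (graphLocale X Y)).obj.obj (op U)) :
    Generators.Represents hY hδ (toCompl c) (φ.app (op U) c) := by
  refine ⟨hom_le_below hY hδ φ hφ c, ?_⟩
  have h := hom_le_below hY hδ φ hφ cᶜ
  have e : φ.app (op U) cᶜ = (φ.app (op U) c)ᶜ := map_compl' (φ.app (op U)).hom c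
  rw [e] at h
  exact h

theorem isPresentedBy_clopenGenerators (X : Sheaf J (Type u)) (hY : IsDecFinite J Y.obj) :
    IsPresentedBy (clopenGenerators X hY) where
  relations := clopenGenerators_relations hY
  universal A δ hδ := by
    refine ⟨clopenHom hY hδ, fun U x y => ?_, fun φ hφ => ?_⟩
    · exact (represents_clopenVal hY hδ (genClopen hY x y)).unique
        (represents_genClopen hY hδ x y)
    · ext U c
      exact (represents_hom hY hδ φ hφ c).unique (represents_clopenVal hY hδ (toCompl c))

end Presentation

/-! ### Evaluation and the exponential law. -/

section Evaluation

variable {L M : IFrame J}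

/-- The frame homomorphism of the map `Z × X ⟶ Y` given by a functional relation. -/
noncomputable def GraphData.evalHom (F : GraphData X.obj Y.obj L) (hY : IsDecFinite J Y.obj) :
    power Y ⟶ powFrame L X.obj :=
  (powerGluing (F.partition hY.dec)).hom

theorem GraphData.ap_evalHom_point (F : GraphData X.obj Y.obj L) (hY : IsDecFinite J Y.obj)
    (y : Y.obj.obj (op U)) :
    IFrame.ap (F.evalHom hY) (point Y y) = (F.partition hY.dec).sec y :=
  powerGluing_val_point _ y

/-- The pointwise action of `h : Z ⟶ W` on sections. -/
def PowSection.map (h : M ⟶ L) {X : Cᵒᵖ ⥤ Type u} (s : PowSection M X U) : PowSection L X U where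
  app _ f x := IFrame.ap h (s.app f x)
  nat _ _ f g x := by
    rw [s.nat, IFrame.ap_map]

/-- The homomorphism on the left belongs to the product of `h` with the identity of `X`; on each
slice `Z × {x}` it only acts on the value at `x`. -/
theorem ap_liftHom_constHom_diagHom (h : M ⟶ L) (s : PowSection M X.obj U) :
    IFrame.ap (liftHom (h ≫ constHom L X.obj) (diagHom L X)) (U := U) s = s.map h := by
  have e : ∀ {V : C} (x : X.obj.obj (op V)),
      (IPartition.ofHom (diagHom L X)).app x = diagSection L x := fun x => ap_diagHom_point x
  apply le_antisymm
  · refine (ap_liftHom_le_iff _ _).2 fun V f x => ?_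
    rw [e]
    refine diagSection_inf_le_iff.2 ?_
    refine (constSection_app_id (X := X.obj) (IFrame.ap h (s.app f x)) x).le.trans ?_
    change _ ≤ ((s.map h).pull f).app (𝟙 V) x
    rw [PowSection.pull_app_id]
    rfl
  · refine (IPartition.ofHom (diagHom L X)).le_of_forall fun V f x => ?_
    rw [e]
    have h1 := point_inf_le_ap_liftHom (h ≫ constHom L X.obj) (diagHom L X) (s.pull f) x
    rw [← map_powAp] at h1
    refine le_trans ?_ h1
    rw [e]
    refine le_inf inf_le_left (diagSection_inf_le_iff.2 ?_)
    rw [s.pull_app_id]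
    refine le_trans ?_ (constSection_app_id (X := X.obj) (IFrame.ap h (s.app f x)) x).ge
    change ((s.map h).pull f).app (𝟙 V) x ≤ _
    rw [PowSection.pull_app_id]
    rfl

/-- The evaluation map. -/
noncomputable def evalMap (X : Sheaf J (Type u)) (hY : IsDecFinite J Y.obj) :
    (prodFan (graphLocale X Y) X).pt ⟶ discrete Y :=
  Quiver.Hom.op (X := power Y) (Y := powFrame (graphFrame J X.obj Y.obj) X.obj)
    ((GraphData.generic J X.obj Y.obj).evalHom hY)

/-- Transposition: a `Y`-indexed partition of `L ^ X` and a functional relation with values in `L`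
are the same data, a function of `x` and `y`. The two homomorphisms are determined by it on points
and on generators respectively. -/
theorem evalHom_comp_liftHom_eq_iff (hY : IsDecFinite J Y.obj)
    (h : graphFrame J X.obj Y.obj ⟶ L) (g : power Y ⟶ powFrame L X.obj) :
    (GraphData.generic J X.obj Y.obj).evalHom hY ≫
        liftHom (h ≫ constHom L X.obj) (diagHom L X) = g ↔
      h = (GraphData.ofPartition (IPartition.ofHom g)).hom := by
  have key : ∀ {U : C} (y : Y.obj.obj (op U)),
      IFrame.ap ((GraphData.generic J X.obj Y.obj).evalHom hY ≫
        liftHom (h ≫ constHom L X.obj) (diagHom L X)) (point Y y) =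
      (((GraphData.generic J X.obj Y.obj).partition hY.dec).sec y).map h := fun y =>
    (congrArg (IFrame.ap (liftHom (h ≫ constHom L X.obj) (diagHom L X)))
      ((GraphData.generic J X.obj Y.obj).ap_evalHom_point hY y)).trans
      (ap_liftHom_constHom_diagHom h _)
  constructor
  · rintro rfl
    refine GraphOpen.hom_ext fun U x y => ?_
    rw [GraphData.ap_hom_gen]
    refine Eq.trans ?_ (congrArg (fun s : PowSection L X.obj U => s.app (𝟙 U) x) (key y)).symm
    change _ = IFrame.ap h (U := U) (GraphOpen.gen J x (Y.obj.map (𝟙 U).op y))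
    rw [op_id, CategoryTheory.Functor.map_id]
    rfl
  · rintro rfl
    refine power_hom_ext fun U y => (key y).trans ?_
    refine PowSection.ext_app (L := L) (X := X.obj) fun V f x => ?_
    refine ((GraphData.ofPartition (IPartition.ofHom g)).ap_hom_gen x (Y.obj.map f.op y)).trans ?_
    change ((IPartition.ofHom g).sec _).app (𝟙 V) x = ((IPartition.ofHom g).sec y).app f x
    rw [IPartition.sec_map, PowSection.pull_app_id]

theorem isExponential_graphLocale (X : Sheaf J (Type u)) (hY : IsDecFinite J Y.obj) :
    IsExponential (prodFan (graphLocale X Y) X) (prodFanIsLimit (graphLocale X Y) X)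
      (evalMap X hY) where
  hasProducts Z := ⟨⟨⟨_, prodFanIsLimit Z X⟩⟩⟩
  universal Z q hq g := by
    -- The product `q` is arbitrary; composing with the isomorphism from the standard one reduces
    -- the claim to the frame of sections.
    let i := (prodFanIsLimit Z X).conePointUniqueUpToIso hq
    have hi1 : i.hom ≫ q.fst = (prodFan Z X).fst :=
      (prodFanIsLimit Z X).conePointUniqueUpToIso_hom_comp hq ⟨WalkingPair.left⟩
    have hi2 : i.hom ≫ q.snd = (prodFan Z X).snd :=
      (prodFanIsLimit Z X).conePointUniqueUpToIso_hom_comp hq ⟨WalkingPair.right⟩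
    have key : ∀ h : Z ⟶ graphLocale X Y,
        (prodFanIsLimit (graphLocale X Y) X).lift (BinaryFan.mk (q.fst ≫ h) q.snd) ≫
          evalMap X hY = g ↔
        h.unop = (GraphData.ofPartition (IPartition.ofHom (i.hom ≫ g).unop)).hom := by
      intro h
      refine Iff.trans ?_ (evalHom_comp_liftHom_eq_iff hY h.unop (i.hom ≫ g).unop)
      rw [← cancel_epi i.hom]
      have e : i.hom ≫ (prodFanIsLimit (graphLocale X Y) X).lift
          (BinaryFan.mk (q.fst ≫ h) q.snd) =
          (liftHom (h.unop ≫ constHom Z.unop X.obj) (diagHom Z.unop X)).op := by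
        refine BinaryFan.IsLimit.hom_ext (prodFanIsLimit (graphLocale X Y) X) ?_ ?_
        · have h1 : (prodFanIsLimit (graphLocale X Y) X).lift (BinaryFan.mk (q.fst ≫ h) q.snd) ≫
              (prodFan (graphLocale X Y) X).fst = q.fst ≫ h :=
            (prodFanIsLimit (graphLocale X Y) X).fac _ ⟨WalkingPair.left⟩
          rw [Category.assoc, h1]
          have h2 : i.hom ≫ q.fst ≫ h = (prodFan Z X).fst ≫ h :=
            (Category.assoc _ _ _).symm.trans (congrArg (fun k => k ≫ h) hi1)
          exact h2.trans (congrArg Quiver.Hom.op (constHom_liftHom _ _).symm)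
        · have h1 : (prodFanIsLimit (graphLocale X Y) X).lift (BinaryFan.mk (q.fst ≫ h) q.snd) ≫
              (prodFan (graphLocale X Y) X).snd = q.snd :=
            (prodFanIsLimit (graphLocale X Y) X).fac _ ⟨WalkingPair.right⟩
          rw [Category.assoc, h1]
          exact hi2.trans (congrArg Quiver.Hom.op (diagHom_liftHom _ _).symm)
      rw [← Category.assoc, e]
      constructor
      · exact fun H => congrArg Quiver.Hom.unop H
      · exact fun H => congrArg Quiver.Hom.op H
    refine ⟨Quiver.Hom.op (GraphData.ofPartition (IPartition.ofHom (i.hom ≫ g).unop)).hom,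
      (key _).2 rfl, fun h hh => ?_⟩
    exact congrArg Quiver.Hom.op ((key h).1 hh)

/-- On the slice over `x`, the inverse image of `y` under evaluation agrees with the constant
section at its value there, and this value is the generator. It identifies the generator as the open
of those `θ` with `θ x = y`. -/
theorem preim_fst_inf_preim_snd (hY : IsDecFinite J Y.obj) (x : X.obj.obj (op U))
    (y : Y.obj.obj (op U)) :
    preim (prodFan (graphLocale X Y) X).fst (Clop.toOpen ((clopenGenerators X hY).elt x y)) ⊓
        preim (prodFan (graphLocale X Y) X).snd (point X x) =
      preim (evalMap X hY) (point Y y) ⊓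
        preim (prodFan (graphLocale X Y) X).snd (point X x) := by
  let L := graphFrame J X.obj Y.obj
  let s : PowSection L X.obj U := ((GraphData.generic J X.obj Y.obj).partition hY.dec).sec y
  have e1 : preim (prodFan (graphLocale X Y) X).snd (point X x) = diagSection L x :=
    ap_diagHom_point x
  have e2 : preim (evalMap X hY) (point Y y) = s :=
    (GraphData.generic J X.obj Y.obj).ap_evalHom_point hY y
  have e3 : s.app (𝟙 U) x = GraphOpen.gen J x y := by
    change GraphOpen.gen J x (Y.obj.map (𝟙 U).op y) = _
    rw [op_id, CategoryTheory.Functor.map_id]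
    rfl
  have e4 : diagSection L x ⊓ s = diagSection L x ⊓ constSection (s.app (𝟙 U) x) X.obj :=
    diagSection_inf_constSection x s
  rw [e3, inf_comm, inf_comm (diagSection L x)] at e4
  rw [e1, e2]
  exact e4.symm

end Evaluation

end Exponential

end InternalLocale

theorem proposition9p4 {C : Type u} [SmallCategory C] (J : GrothendieckTopology C)
    (X Y : Sheaf J (Type u)) (hY : InternalLocale.IsStone (InternalLocale.discrete Y)) :
    ∃ (W : InternalLocale.ILocale J) (p : BinaryFan W (InternalLocale.discrete X))
      (hp : IsLimit p) (ev : p.pt ⟶ InternalLocale.discrete Y),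
      InternalLocale.IsExponential p hp ev ∧
      InternalLocale.IsStone W ∧
      ∃ γ : InternalLocale.Generators X Y (InternalLocale.Clop W),
        (∀ ⦃U : C⦄ (x : X.obj.obj (op U)) (y : Y.obj.obj (op U)),
          InternalLocale.preim p.fst (InternalLocale.Clop.toOpen (γ.elt x y)) ⊓
              InternalLocale.preim p.snd (InternalLocale.point X x) =
            InternalLocale.preim ev (InternalLocale.point Y y) ⊓
              InternalLocale.preim p.snd (InternalLocale.point X x)) ∧
        InternalLocale.IsPresentedBy γ := by
  have hY := InternalLocale.isDecFinite_of_isStone hY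
  exact ⟨InternalLocale.graphLocale X Y, InternalLocale.prodFan _ X,
    InternalLocale.prodFanIsLimit _ X, InternalLocale.evalMap X hY,
    InternalLocale.isExponential_graphLocale X hY, InternalLocale.isStone_graphLocale X hY,
    InternalLocale.clopenGenerators X hY,
    fun _ x y => InternalLocale.preim_fst_inf_preim_snd hY x y,
    InternalLocale.isPresentedBy_clopenGenerators X hY⟩
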